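/- Let $n\ge 1$, let $\mathbf R^{1+n}_+=\{(t,x): t>0,\ x\in\mathbf R^n\}$ with Lebesgue measure, and fix an aperture $\alpha>0$. Cubes are axis-parallel. For a cube $Q\subset\mathbf R^n$ with sidelength $\ell(Q)$ let $Q^{\rm ca}=(0,\ell(Q))\times Q$ and $Q^w=(\ell(Q)/2,\ell(Q))\times Q$. For scalar (real or complex) functions on $\mathbf R^{1+n}_+$ and $1<q<\infty$ define $$Nf(x)=\operatorname*{ess\,sup}_{|y-x|<\alpha t}|f(t,y)|,\qquad Cf(x)=\sup_{Q\ni x}\frac1{|Q|}\iint_{Q^{\rm ca}}|f(t,y)|\,dt\,dy,\qquad W_qf(t,x)=|Q^w|^{-1/q}\|f\|_{L_q(Q^w)},$$ where the supremum is over all cubes $Q\subset\mathbf R^n$ containing $x$ and where, in the last formula, $Q$ is the cube with center $x$ and sidelength $t$. Fix $1<p,q<\infty$, $1/p+1/p'=1$, $1/q+1/q'=1$, and set, identifying functions that agree almost everywhere, $$Z=\{f\in L_q^{\rm loc}(\mathbf R^{1+n}_+):\ \|C(W_qf)\|_{L_p(\mathbf R^n)}<\infty\},\qquad X=\{f\in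 L_{q'}^{\rm loc}(\mathbf R^{1+n}_+):\ \|N(W_{q'}f)\|_{L_{p'}(\mathbf R^n)}<\infty\},$$ with the indicated norms. Then $Z$ and $X$ are Banach spaces, and the following hold. 1. The subspace $Z_0$ of all $f\in L_q(\mathbf R^{1+n}_+)\cap Z$ with bounded support is dense in $Z$. 2. The subspace $X_0$ of all $f\in L_{q'}(\mathbf R^{1+n}_+)\cap X$ with bounded support is dense in $X$. 3. $Z$ is not reflexive. 4. $X$ equals the dual space $Z^*$, with equivalent norms, through the pairing $\langle f,g\rangle=\iint_{\mathbf R^{1+n}_+} f g\,dt\,dx$: this integral converges absolutely for all $f\in Z$ and $g\in X$, and $g\mapsto\langle\cdot,g\rangle$ is a linear homeomorphism of $X$ onto $Z^*$. -/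

import Mathlib

open MeasureTheory Set
open scoped ENNReal

namespace HalfSpace

/-! ### The half space, cubes, Carleson boxes, Whitney regions and cones -/

/-- Boundary space `ℝⁿ` with its Euclidean norm. -/
abbrev Bdry (n : ℕ) : Type := EuclideanSpace ℝ (Fin n)

/-- Ambient space `ℝ^{1+n}`, points are written `(t, x)`. -/
abbrev Amb (n : ℕ) : Type := ℝ × Bdry n

/-- The open upper half space `ℝ^{1+n}_+ = {(t, x) : t > 0}`. -/
def upper (n : ℕ) : Set (Amb n) := {a | 0 < a.1}

/-- Lebesgue measure on the half space. -/
noncomputable def mu (n : ℕ) : Measure (Amb n) := volume.restrict (upper n)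

/-- The (open, axis-parallel) cube in `ℝⁿ` with center `z` and sidelength `l`. -/
def cube {n : ℕ} (z : Bdry n) (l : ℝ) : Set (Bdry n) := {y | ∀ i, |y i - z i| < l / 2}

/-- The Carleson cube `(0, l) × Q`, where `Q` is the cube with center `z` and sidelength `l`. -/
def carlesonBox {n : ℕ} (z : Bdry n) (l : ℝ) : Set (Amb n) := Ioo 0 l ×ˢ cube z l

/-- The Whitney region `(t/2, t) × Q` of `(t, x)`, where `Q` is the cube with center `x` and
sidelength `t`. -/
def whitneyRegion {n : ℕ} (a : Amb n) : Set (Amb n) := Ioo (a.1 / 2) a.1 ×ˢ cube a.2 a.1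

/-- The cone `{(t, y) : t > 0, |y - x| < α t}` with vertex `x` and aperture `α`. -/
def cone {n : ℕ} (α : ℝ) (x : Bdry n) : Set (Amb n) := {a | 0 < a.1 ∧ ‖a.2 - x‖ < α * a.1}

/-! ### The functionals `N`, `C` and the Whitney averages `W_q` -/

/-- Non-tangential maximal functional: `N F (x) = ess sup_{|y - x| < α t} F(t, y)`. -/
noncomputable def ntMax {n : ℕ} (α : ℝ) (F : Amb n → ℝ≥0∞) (x : Bdry n) : ℝ≥0∞ :=
  essSup F (volume.restrict (cone α x))

/-- Carleson functional: `C F (x) = sup_{Q ∋ x} |Q|⁻¹ ∬_{(0, ℓ(Q)) × Q} F`. -/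
noncomputable def carlesonFun {n : ℕ} (F : Amb n → ℝ≥0∞) (x : Bdry n) : ℝ≥0∞ :=
  ⨆ (z : Bdry n) (l : ℝ) (_ : 0 < l) (_ : x ∈ cube z l),
    (volume (cube z l))⁻¹ * ∫⁻ a in carlesonBox z l, F a

/-- Whitney `L_q` average: `W_q f (t, x) = |Q^w|^{-1/q} ‖f‖_{L_q(Q^w)}`, where `Q` is the cube with
center `x` and sidelength `t` and `Q^w` is its Whitney region. -/
noncomputable def whitneyAvg {n : ℕ} {𝕜 : Type*} [RCLike 𝕜] (q : ℝ) (f : Amb n → 𝕜) (a : Amb n) :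
    ℝ≥0∞ :=
  volume (whitneyRegion a) ^ (-(1 / q)) *
    eLpNorm f (ENNReal.ofReal q) (volume.restrict (whitneyRegion a))

/-- The extended norm `‖C (W_q f)‖_{L_p(ℝⁿ)}`. -/
noncomputable def carlesonNorm {n : ℕ} {𝕜 : Type*} [RCLike 𝕜] (p q : ℝ) (f : Amb n → 𝕜) : ℝ≥0∞ :=
  eLpNorm (carlesonFun (whitneyAvg q f)) (ENNReal.ofReal p) volume

/-- The extended norm `‖N (W_q f)‖_{L_p(ℝⁿ)}`, with aperture `α`. -/
noncomputable def ntNorm {n : ℕ} {𝕜 : Type*} [RCLike 𝕜] (α p q : ℝ) (f : Amb n → 𝕜) : ℝ≥0∞ :=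
  eLpNorm (ntMax α (whitneyAvg q f)) (ENNReal.ofReal p) volume

/-- `f ∈ L_q^loc(ℝ^{1+n}_+)`: `f` is in `L_q` on every compact subset of the open half space. -/
def LocLq {n : ℕ} {𝕜 : Type*} [RCLike 𝕜] (q : ℝ) (f : Amb n → 𝕜) : Prop :=
  ∀ K : Set (Amb n), IsCompact K → K ⊆ upper n →
    MemLp f (ENNReal.ofReal q) (volume.restrict K)

/-! ### Geometric and measurability facts -/

lemma isOpen_upper (n : ℕ) : IsOpen (upper n) := isOpen_lt continuous_const continuous_fst

lemma isOpen_cube {n : ℕ} (z : Bdry n) (l : ℝ) : IsOpen (cube z l) := by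
  have : cube z l = ⋂ i, {y : Bdry n | |y i - z i| < l / 2} := by ext; simp [cube]
  rw [this]
  exact isOpen_iInter_of_finite fun i => isOpen_lt (by fun_prop) continuous_const

lemma isOpen_carlesonBox {n : ℕ} (z : Bdry n) (l : ℝ) : IsOpen (carlesonBox z l) :=
  isOpen_Ioo.prod (isOpen_cube z l)

lemma isOpen_whitneyRegion {n : ℕ} (a : Amb n) : IsOpen (whitneyRegion a) :=
  isOpen_Ioo.prod (isOpen_cube _ _)

lemma isOpen_cone {n : ℕ} (α : ℝ) (x : Bdry n) : IsOpen (cone α x) :=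
  (isOpen_upper n).inter (isOpen_lt (f := fun a : Amb n => ‖a.2 - x‖) (g := fun a => α * a.1)
    (by fun_prop) (by fun_prop))

lemma whitneyRegion_subset {n : ℕ} (a : Amb n) : whitneyRegion a ⊆ upper n := by
  rintro b ⟨⟨h1, h2⟩, -⟩
  show 0 < b.1
  linarith

lemma carlesonBox_subset {n : ℕ} (z : Bdry n) (l : ℝ) : carlesonBox z l ⊆ upper n :=
  fun _ h => h.1.1

lemma cone_subset {n : ℕ} (α : ℝ) (x : Bdry n) : cone α x ⊆ upper n := fun _ h => h.1

lemma ac_of_subset {n : ℕ} {s : Set (Amb n)} (h : s ⊆ upper n) : volume.restrict s ≪ mu n :=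
  (Measure.restrict_mono h le_rfl).absolutelyContinuous

lemma isOpen_whitneyRel (n : ℕ) : IsOpen {w : Amb n × Amb n | w.2 ∈ whitneyRegion w.1} := by
  have : {w : Amb n × Amb n | w.2 ∈ whitneyRegion w.1} =
      ({w | w.1.1 / 2 < w.2.1} ∩ {w | w.2.1 < w.1.1}) ∩
        ⋂ i, {w | |w.2.2 i - w.1.2 i| < w.1.1 / 2} := by
    ext w; simp [whitneyRegion, cube]
  rw [this]
  refine ((isOpen_lt ?_ ?_).inter (isOpen_lt ?_ ?_)).inter
    (isOpen_iInter_of_finite fun i => isOpen_lt ?_ ?_) <;> fun_prop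

lemma mem_whitneyRegion_of_mem {n : ℕ} {b : Amb n} (hb : b ∈ upper n) :
    b ∈ whitneyRegion ((3 / 2 * b.1, b.2) : Amb n) := by
  have hb' : 0 < b.1 := hb
  refine ⟨⟨?_, ?_⟩, fun i => ?_⟩
  · show 3 / 2 * b.1 / 2 < b.1
    linarith
  · show b.1 < 3 / 2 * b.1
    linarith
  · show |b.2 i - b.2 i| < 3 / 2 * b.1 / 2
    simp [hb']

section

variable {n : ℕ} {𝕜 : Type*} [RCLike 𝕜]

lemma whitneyAvg_congr (q : ℝ) {f g : Amb n → 𝕜} (h : f =ᵐ[mu n] g) :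
    whitneyAvg q f = whitneyAvg q g := by
  funext a
  simp only [whitneyAvg]
  rw [eLpNorm_congr_ae ((ac_of_subset (whitneyRegion_subset a)).ae_le h)]

lemma carlesonNorm_congr (p q : ℝ) {f g : Amb n → 𝕜} (h : f =ᵐ[mu n] g) :
    carlesonNorm p q f = carlesonNorm p q g := by
  simp only [carlesonNorm, whitneyAvg_congr q h]

lemma ntNorm_congr (α p q : ℝ) {f g : Amb n → 𝕜} (h : f =ᵐ[mu n] g) :
    ntNorm α p q f = ntNorm α p q g := by
  simp only [ntNorm, whitneyAvg_congr q h]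

lemma LocLq.congr {q : ℝ} {f g : Amb n → 𝕜} (hf : LocLq q f) (h : f =ᵐ[mu n] g) :
    LocLq q g := fun K hK hKu =>
  (memLp_congr_ae ((ac_of_subset hKu).ae_le h)).1 (hf K hK hKu)

lemma measurable_whitneyAvg {q : ℝ} (hq : 1 < q) {f : Amb n → 𝕜} (hf : StronglyMeasurable f) :
    Measurable (whitneyAvg q f) := by
  have hS := (isOpen_whitneyRel n).measurableSet
  have hq0 : ENNReal.ofReal q ≠ 0 := by simp; linarith
  have h1 : Measurable fun a : Amb n => volume (whitneyRegion a) :=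
    measurable_measure_prodMk_left hS
  have h2 : Measurable fun a : Amb n =>
      ∫⁻ b in whitneyRegion a, ‖f b‖ₑ ^ (ENNReal.ofReal q).toReal := by
    have : ∀ a : Amb n, ∫⁻ b in whitneyRegion a, ‖f b‖ₑ ^ (ENNReal.ofReal q).toReal =
        ∫⁻ b, {w : Amb n × Amb n | w.2 ∈ whitneyRegion w.1}.indicator
          (fun w => ‖f w.2‖ₑ ^ (ENNReal.ofReal q).toReal) (a, b) := by
      intro a
      rw [← lintegral_indicator (isOpen_whitneyRegion a).measurableSet]
      rfl
    simp_rw [this]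
    refine Measurable.lintegral_prod_right' (f := {w : Amb n × Amb n |
      w.2 ∈ whitneyRegion w.1}.indicator (fun w => ‖f w.2‖ₑ ^ (ENNReal.ofReal q).toReal)) ?_
    exact ((hf.enorm.comp measurable_snd).pow_const _).indicator hS
  unfold whitneyAvg
  simp_rw [eLpNorm_eq_lintegral_rpow_enorm_toReal hq0 ENNReal.ofReal_ne_top]
  exact (h1.pow_const _).mul (h2.pow_const _)

lemma whitneyAvg_add_le {q : ℝ} (hq : 1 < q) {f g : Amb n → 𝕜} (hf : StronglyMeasurable f)
    (hg : StronglyMeasurable g) (a : Amb n) :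
    whitneyAvg q (f + g) a ≤ whitneyAvg q f a + whitneyAvg q g a := by
  simp only [whitneyAvg]
  rw [← mul_add]
  gcongr
  exact eLpNorm_add_le hf.aestronglyMeasurable hg.aestronglyMeasurable (by simpa using hq.le)

lemma whitneyAvg_smul (q : ℝ) (c : 𝕜) (f : Amb n → 𝕜) (a : Amb n) :
    whitneyAvg q (c • f) a = ‖c‖ₑ * whitneyAvg q f a := by
  simp only [whitneyAvg]
  rw [eLpNorm_const_smul]
  ring

/-- A function whose Whitney averages vanish almost everywhere is zero. -/
lemma ae_eq_zero_of_whitneyAvg {q : ℝ} (hq : 1 < q) {f : Amb n → 𝕜} (hf : StronglyMeasurable f)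
    (h : ∀ᵐ a ∂(mu n), whitneyAvg q f a = 0) : f =ᵐ[mu n] 0 := by
  have hq0 : ENNReal.ofReal q ≠ 0 := by simp; linarith
  set A : Set (Amb n) := {a | a ∈ upper n ∧ whitneyAvg q f a = 0} with hA
  have hbad : volume (upper n \ A) = 0 := by
    rw [mu, ae_restrict_iff' (isOpen_upper n).measurableSet, ae_iff] at h
    refine measure_mono_null ?_ h
    rintro a ⟨ha, ha'⟩ hh
    exact ha' ⟨ha, hh ha⟩
  have hcov : upper n ⊆ ⋃ a ∈ A, whitneyRegion a := by
    intro b hb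
    have hU : IsOpen ({a : Amb n | b ∈ whitneyRegion a} ∩ upper n) :=
      ((isOpen_whitneyRel n).preimage (f := fun a : Amb n => (a, b)) (by fun_prop)).inter
        (isOpen_upper n)
    have hne : ({a : Amb n | b ∈ whitneyRegion a} ∩ upper n).Nonempty := by
      refine ⟨(3 / 2 * b.1, b.2), mem_whitneyRegion_of_mem hb, ?_⟩
      have hb' : 0 < b.1 := hb
      show 0 < 3 / 2 * b.1
      linarith
    have hpos := hU.measure_pos volume hne
    by_contra hcon
    refine hpos.ne' (measure_mono_null ?_ hbad)
    rintro a ⟨ha, hau⟩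
    refine ⟨hau, fun haA => hcon ?_⟩
    simp only [mem_iUnion]
    exact ⟨a, haA, ha⟩
  obtain ⟨T, hTA, hTc, hT⟩ := TopologicalSpace.isOpen_biUnion_countable A
    (fun a => whitneyRegion a) fun a _ => isOpen_whitneyRegion a
  have hz : ∀ a ∈ T, ∀ᵐ b ∂(volume.restrict (whitneyRegion a)), f b = 0 := by
    intro a ha
    have h0 : whitneyAvg q f a = 0 := (hTA ha).2
    have hfin : volume (whitneyRegion a) ≠ ∞ := by
      have : Bornology.IsBounded (whitneyRegion a) := by
        refine (Metric.isBounded_Ioo _ _).prod ?_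
        have hsub : cube a.2 a.1 ⊆ (MeasurableEquiv.toLp 2 (Fin n → ℝ)).symm ⁻¹'
            Metric.ball (a.2.ofLp) (a.1 / 2) := by
          intro y hy
          have hp : 0 < a.1 / 2 := by
            have : 0 < a.1 := (hTA ha).1
            linarith
          show y.ofLp ∈ Metric.ball (a.2.ofLp) (a.1 / 2)
          rw [mem_ball_iff_norm, pi_norm_lt_iff hp]
          intro i
          exact hy i
        refine Bornology.IsBounded.subset ?_ hsub
        have hb : Bornology.IsBounded (Metric.ball (a.2.ofLp) (a.1 / 2)) := Metric.isBounded_ball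
        exact ((PiLp.antilipschitzWith_ofLp 2 (fun _ : Fin n => ℝ)).isBounded_preimage hb)
      exact this.measure_lt_top.ne
    rw [whitneyAvg, mul_eq_zero] at h0
    rcases h0 with h0 | h0
    · exfalso
      rw [ENNReal.rpow_eq_zero_iff] at h0
      rcases h0 with ⟨-, h0⟩ | ⟨h0, -⟩
      · have : 0 < 1 / q := by positivity
        linarith
      · exact hfin h0
    · rwa [eLpNorm_eq_zero_iff hf.aestronglyMeasurable hq0] at h0
  have hall : ∀ᵐ b ∂(volume.restrict (⋃ a ∈ T, whitneyRegion a)), f b = 0 :=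
    (ae_restrict_biUnion_iff _ hTc _).2 hz
  exact ae_restrict_of_ae_restrict_of_subset (hcov.trans hT.ge) hall

/-! ### The Carleson functional -/

lemma measurable_carlesonFun (F : Amb n → ℝ≥0∞) : Measurable (carlesonFun F) := by
  refine LowerSemicontinuous.measurable ?_
  rw [lowerSemicontinuous_iff_isOpen_preimage]
  intro c
  have : carlesonFun F ⁻¹' Ioi c = ⋃ (z : Bdry n) (l : ℝ) (_ : 0 < l)
      (_ : c < (volume (cube z l))⁻¹ * ∫⁻ a in carlesonBox z l, F a), cube z l := by
    ext x
    simp only [carlesonFun, mem_preimage, mem_Ioi, lt_iSup_iff, mem_iUnion, exists_prop]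
    constructor
    · rintro ⟨z, l, hl, hx, h⟩
      exact ⟨z, l, hl, h, hx⟩
    · rintro ⟨z, l, hl, h, hx⟩
      exact ⟨z, l, hl, hx, h⟩
  rw [this]
  exact isOpen_iUnion fun z => isOpen_iUnion fun l => isOpen_iUnion fun _ =>
    isOpen_iUnion fun _ => isOpen_cube z l

lemma carlesonFun_add_le {F G : Amb n → ℝ≥0∞} (hF : Measurable F) (x : Bdry n) :
    carlesonFun (fun a => F a + G a) x ≤ carlesonFun F x + carlesonFun G x := by
  refine iSup_le fun z => iSup_le fun l => iSup_le fun hl => iSup_le fun hx => ?_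
  rw [lintegral_add_left hF, mul_add]
  refine add_le_add ?_ ?_
  · exact le_iSup_of_le z (le_iSup_of_le l (le_iSup_of_le hl (le_iSup_of_le hx le_rfl)))
  · exact le_iSup_of_le z (le_iSup_of_le l (le_iSup_of_le hl (le_iSup_of_le hx le_rfl)))

lemma carlesonFun_mono {F G : Amb n → ℝ≥0∞} (h : ∀ a, F a ≤ G a) (x : Bdry n) :
    carlesonFun F x ≤ carlesonFun G x := by
  unfold carlesonFun
  gcongr
  exact h _

lemma carlesonFun_const_mul_le (F : Amb n → ℝ≥0∞) {c : ℝ≥0∞} (hc : c ≠ ∞) (x : Bdry n) :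
    carlesonFun (fun a => c * F a) x ≤ c * carlesonFun F x := by
  refine iSup_le fun z => iSup_le fun l => iSup_le fun hl => iSup_le fun hx => ?_
  rw [lintegral_const_mul' _ _ hc, mul_left_comm]
  gcongr
  exact le_iSup_of_le z (le_iSup_of_le l (le_iSup_of_le hl (le_iSup_of_le hx le_rfl)))

lemma carlesonNorm_add_le {p q : ℝ} (hp : 1 < p) (hq : 1 < q) {f g : Amb n → 𝕜}
    (hf : StronglyMeasurable f) (hg : StronglyMeasurable g) :
    carlesonNorm p q (f + g) ≤ carlesonNorm p q f + carlesonNorm p q g := by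
  refine le_trans (eLpNorm_mono_enorm (g := carlesonFun (whitneyAvg q f) +
    carlesonFun (whitneyAvg q g)) fun x => ?_) (eLpNorm_add_le
      (measurable_carlesonFun _).aestronglyMeasurable
      (measurable_carlesonFun _).aestronglyMeasurable (by simpa using hp.le))
  exact (carlesonFun_mono (whitneyAvg_add_le hq hf hg) x).trans
    (carlesonFun_add_le (measurable_whitneyAvg hq hf) x)

lemma carlesonNorm_smul_le (p q : ℝ) (c : 𝕜) (f : Amb n → 𝕜) :
    carlesonNorm p q (c • f) ≤ ‖c‖ₑ * carlesonNorm p q f := by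
  refine eLpNorm_le_nnreal_smul_eLpNorm_of_ae_le_mul' (c := ‖c‖₊) (ae_of_all _ fun x => ?_) _
  show carlesonFun (whitneyAvg q (c • f)) x ≤ ‖c‖ₑ * carlesonFun (whitneyAvg q f) x
  rw [funext (whitneyAvg_smul q c f)]
  exact carlesonFun_const_mul_le _ enorm_ne_top x

lemma ae_eq_zero_of_carlesonNorm {p q : ℝ} (hp : 1 < p) (hq : 1 < q) {f : Amb n → 𝕜}
    (hf : StronglyMeasurable f) (h : carlesonNorm p q f = 0) : f =ᵐ[mu n] 0 := by
  have hp0 : ENNReal.ofReal p ≠ 0 := by simp; linarith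
  rw [carlesonNorm, eLpNorm_eq_zero_iff (measurable_carlesonFun _).aestronglyMeasurable hp0] at h
  obtain ⟨x, hx⟩ := h.exists
  refine ae_eq_zero_of_whitneyAvg hq hf ?_
  have hbox : ∀ k : ℕ, ∀ᵐ a ∂(volume.restrict (carlesonBox x (k + 1 : ℝ))),
      whitneyAvg q f a = 0 := by
    intro k
    have hk : (0 : ℝ) < k + 1 := by positivity
    have hxk : x ∈ cube x (k + 1 : ℝ) := fun i => by simp; positivity
    have hle : (volume (cube x (k + 1 : ℝ)))⁻¹ *
        ∫⁻ a in carlesonBox x (k + 1 : ℝ), whitneyAvg q f a ≤ 0 := by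
      rw [← show carlesonFun (whitneyAvg q f) x = 0 from hx]
      exact le_iSup_of_le x (le_iSup_of_le _ (le_iSup_of_le hk (le_iSup_of_le hxk le_rfl)))
    rw [nonpos_iff_eq_zero, mul_eq_zero] at hle
    rcases hle with h0 | h0
    · exfalso
      rw [ENNReal.inv_eq_zero] at h0
      have hsub : cube x (k + 1 : ℝ) ⊆ WithLp.ofLp ⁻¹'
          Metric.ball (x.ofLp) ((k + 1 : ℝ) / 2) := by
        intro y hy
        show y.ofLp ∈ Metric.ball (x.ofLp) ((k + 1 : ℝ) / 2)
        rw [mem_ball_iff_norm, pi_norm_lt_iff (by positivity)]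
        exact fun i => hy i
      have hb : Bornology.IsBounded (Metric.ball (x.ofLp) ((k + 1 : ℝ) / 2)) :=
        Metric.isBounded_ball
      exact ((((PiLp.antilipschitzWith_ofLp 2 (fun _ : Fin n => ℝ)).isBounded_preimage hb).subset
        hsub).measure_lt_top).ne h0
    · rwa [lintegral_eq_zero_iff (measurable_whitneyAvg hq hf)] at h0
  have hall := (ae_restrict_iUnion_iff (fun k : ℕ => carlesonBox x (k + 1 : ℝ)) _).2 hbox
  refine ae_restrict_of_ae_restrict_of_subset ?_ hall
  intro a ha
  obtain ⟨k, hk⟩ := exists_nat_gt (max a.1 (2 * ‖a.2 - x‖))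
  refine mem_iUnion.2 ⟨k, ⟨ha, ?_⟩, fun i => ?_⟩
  · linarith [le_max_left a.1 (2 * ‖a.2 - x‖)]
  · have h1 : |a.2 i - x i| ≤ ‖a.2 - x‖ := PiLp.norm_apply_le (a.2 - x) i
    linarith [le_max_right a.1 (2 * ‖a.2 - x‖)]

/-! ### The non-tangential maximal functional -/

lemma measurable_ntMax (α : ℝ) (F : Amb n → ℝ≥0∞) : Measurable (ntMax α F) := by
  refine LowerSemicontinuous.measurable ?_
  rw [lowerSemicontinuous_iff_isOpen_preimage]
  intro c
  rw [isOpen_iff_mem_nhds]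
  intro x hx
  set S : ℕ → Set (Amb n) := fun k => {a | 0 < a.1 ∧ ‖a.2 - x‖ < α * a.1 - 1 / (k + 1 : ℝ)}
  have hcov : cone α x ⊆ ⋃ k, S k := by
    rintro a ⟨ha, hax⟩
    obtain ⟨k, hk⟩ := exists_nat_one_div_lt (sub_pos.2 hax)
    exact mem_iUnion.2 ⟨k, ha, by linarith⟩
  have hk : ∃ k, c < essSup F (volume.restrict (S k)) := by
    by_contra! hcon
    have h1 : ∀ k, ∀ᵐ a ∂(volume.restrict (S k)), F a ≤ c := fun k =>
      (ENNReal.ae_le_essSup F).mono fun a ha => ha.trans (hcon k)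
    have h2 := ae_restrict_of_ae_restrict_of_subset hcov ((ae_restrict_iUnion_iff S _).2 h1)
    exact (not_lt.2 (essSup_le_of_ae_le c h2)) hx
  obtain ⟨k, hk⟩ := hk
  have hpos : (0 : ℝ) < 1 / (k + 1 : ℝ) := by positivity
  filter_upwards [Metric.ball_mem_nhds x hpos] with y hy
  refine lt_of_lt_of_le hk (essSup_mono_measure ?_)
  refine (Measure.restrict_mono ?_ le_rfl).absolutelyContinuous
  rintro a ⟨ha, hax⟩
  refine ⟨ha, ?_⟩
  have h1 : ‖a.2 - y‖ ≤ ‖a.2 - x‖ + ‖x - y‖ := norm_sub_le_norm_sub_add_norm_sub _ _ _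
  rw [mem_ball_iff_norm'] at hy
  linarith

lemma ntNorm_add_le {α p q : ℝ} (hp : 1 < p) (hq : 1 < q) {f g : Amb n → 𝕜}
    (hf : StronglyMeasurable f) (hg : StronglyMeasurable g) :
    ntNorm α p q (f + g) ≤ ntNorm α p q f + ntNorm α p q g := by
  refine le_trans (eLpNorm_mono_enorm (g := ntMax α (whitneyAvg q f) +
    ntMax α (whitneyAvg q g)) fun x => ?_) (eLpNorm_add_le
      (measurable_ntMax α _).aestronglyMeasurable
      (measurable_ntMax α _).aestronglyMeasurable (by simpa using hp.le))
  exact (essSup_mono_ae (ae_of_all _ (whitneyAvg_add_le hq hf hg))).trans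
    (ENNReal.essSup_add_le _ _)

lemma ntNorm_smul_le (α p q : ℝ) (c : 𝕜) (f : Amb n → 𝕜) :
    ntNorm α p q (c • f) ≤ ‖c‖ₑ * ntNorm α p q f := by
  refine eLpNorm_le_nnreal_smul_eLpNorm_of_ae_le_mul' (c := ‖c‖₊) (ae_of_all _ fun x => ?_) _
  show ntMax α (whitneyAvg q (c • f)) x ≤ ‖c‖ₑ * ntMax α (whitneyAvg q f) x
  rw [funext (whitneyAvg_smul q c f)]
  exact ENNReal.essSup_const_mul.le

lemma ae_eq_zero_of_ntNorm {α p q : ℝ} (hα : 0 < α) (hp : 1 < p) (hq : 1 < q) {f : Amb n → 𝕜}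
    (hf : StronglyMeasurable f) (h : ntNorm α p q f = 0) : f =ᵐ[mu n] 0 := by
  have hp0 : ENNReal.ofReal p ≠ 0 := by simp; linarith
  rw [ntNorm, eLpNorm_eq_zero_iff (measurable_ntMax α _).aestronglyMeasurable hp0] at h
  have hD : Dense {x : Bdry n | ntMax α (whitneyAvg q f) x = 0} := Measure.dense_of_ae h
  refine ae_eq_zero_of_whitneyAvg hq hf ?_
  obtain ⟨T, hTA, hTc, hT⟩ := TopologicalSpace.isOpen_biUnion_countable
    {x : Bdry n | ntMax α (whitneyAvg q f) x = 0} (fun x => cone α x) fun x _ => isOpen_cone α x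
  have hz : ∀ x ∈ T, ∀ᵐ a ∂(volume.restrict (cone α x)), whitneyAvg q f a = 0 := by
    intro x hx
    have h0 : essSup (whitneyAvg q f) (volume.restrict (cone α x)) = 0 := hTA hx
    filter_upwards [ENNReal.ae_le_essSup (μ := volume.restrict (cone α x)) (whitneyAvg q f)]
      with a ha
    rw [h0] at ha
    exact nonpos_iff_eq_zero.1 ha
  have hall := (ae_restrict_biUnion_iff (fun x => cone α x) hTc _).2 hz
  refine ae_restrict_of_ae_restrict_of_subset ?_ hall
  rw [hT]
  intro a ha
  have ha' : 0 < a.1 := ha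
  obtain ⟨x, hx, hxa⟩ := hD.exists_dist_lt a.2 (mul_pos hα ha')
  simp only [mem_iUnion]
  exact ⟨x, hx, ha, by rwa [dist_eq_norm] at hxa⟩

end

/-! ### The spaces `Z` and `X` -/

section

variable (𝕜 : Type*) [RCLike 𝕜] (n : ℕ)

/-- The space `Z` of (classes of a.e. equal) functions `f ∈ L_q^loc(ℝ^{1+n}_+)` with
`‖C (W_q f)‖_p < ∞`. -/
def ZSpace (p q : ℝ) [hp : Fact (1 < p)] [hq : Fact (1 < q)] :
    Submodule 𝕜 (Amb n →ₘ[mu n] 𝕜) where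
  carrier := {f | LocLq q (f : Amb n → 𝕜) ∧ carlesonNorm p q (f : Amb n → 𝕜) < ∞}
  zero_mem' := by
    have h0 := AEEqFun.coeFn_zero (α := Amb n) (μ := mu n) (β := 𝕜)
    refine ⟨LocLq.congr (fun K _ _ => MemLp.zero') h0.symm, ?_⟩
    rw [carlesonNorm_congr p q h0]
    refine lt_of_le_of_lt (b := 0) ?_ ENNReal.zero_lt_top
    simpa using carlesonNorm_smul_le p q (0 : 𝕜) (0 : Amb n → 𝕜)
  add_mem' := by
    rintro f g ⟨hf, hf'⟩ ⟨hg, hg'⟩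
    refine ⟨LocLq.congr (fun K hK hKu => (hf K hK hKu).add (hg K hK hKu))
      (AEEqFun.coeFn_add f g).symm, ?_⟩
    rw [carlesonNorm_congr p q (AEEqFun.coeFn_add f g)]
    exact (carlesonNorm_add_le hp.out hq.out f.stronglyMeasurable g.stronglyMeasurable).trans_lt
      (ENNReal.add_lt_top.2 ⟨hf', hg'⟩)
  smul_mem' := by
    rintro c f ⟨hf, hf'⟩
    refine ⟨LocLq.congr (fun K hK hKu => (hf K hK hKu).const_smul c)
      (AEEqFun.coeFn_smul c f).symm, ?_⟩
    rw [carlesonNorm_congr p q (AEEqFun.coeFn_smul c f)]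
    exact (carlesonNorm_smul_le p q c _).trans_lt (ENNReal.mul_lt_top enorm_lt_top hf')

/-- The space `X` of (classes of a.e. equal) functions `f ∈ L_q^loc(ℝ^{1+n}_+)` with
`‖N (W_q f)‖_p < ∞`, the functional `N` having aperture `α`. -/
def XSpace (α p q : ℝ) [hp : Fact (1 < p)] [hq : Fact (1 < q)] :
    Submodule 𝕜 (Amb n →ₘ[mu n] 𝕜) where
  carrier := {f | LocLq q (f : Amb n → 𝕜) ∧ ntNorm α p q (f : Amb n → 𝕜) < ∞}
  zero_mem' := by
    have h0 := AEEqFun.coeFn_zero (α := Amb n) (μ := mu n) (β := 𝕜)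
    refine ⟨LocLq.congr (fun K _ _ => MemLp.zero') h0.symm, ?_⟩
    rw [ntNorm_congr α p q h0]
    refine lt_of_le_of_lt (b := 0) ?_ ENNReal.zero_lt_top
    simpa using ntNorm_smul_le α p q (0 : 𝕜) (0 : Amb n → 𝕜)
  add_mem' := by
    rintro f g ⟨hf, hf'⟩ ⟨hg, hg'⟩
    refine ⟨LocLq.congr (fun K hK hKu => (hf K hK hKu).add (hg K hK hKu))
      (AEEqFun.coeFn_add f g).symm, ?_⟩
    rw [ntNorm_congr α p q (AEEqFun.coeFn_add f g)]
    exact (ntNorm_add_le hp.out hq.out f.stronglyMeasurable g.stronglyMeasurable).trans_lt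
      (ENNReal.add_lt_top.2 ⟨hf', hg'⟩)
  smul_mem' := by
    rintro c f ⟨hf, hf'⟩
    refine ⟨LocLq.congr (fun K hK hKu => (hf K hK hKu).const_smul c)
      (AEEqFun.coeFn_smul c f).symm, ?_⟩
    rw [ntNorm_congr α p q (AEEqFun.coeFn_smul c f)]
    exact (ntNorm_smul_le α p q c _).trans_lt (ENNReal.mul_lt_top enorm_lt_top hf')

variable {𝕜 n}

/-- The norm of `Z` is `‖C (W_q f)‖_p`. -/
noncomputable instance (p q : ℝ) [Fact (1 < p)] [Fact (1 < q)] : Norm (ZSpace 𝕜 n p q) where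
  norm f := (carlesonNorm p q ((f : Amb n →ₘ[mu n] 𝕜) : Amb n → 𝕜)).toReal

/-- The norm of `X` is `‖N (W_q f)‖_p`. -/
noncomputable instance (α p q : ℝ) [Fact (1 < p)] [Fact (1 < q)] : Norm (XSpace 𝕜 n α p q) where
  norm f := (ntNorm α p q ((f : Amb n →ₘ[mu n] 𝕜) : Amb n → 𝕜)).toReal

lemma ZSpace.norm_smul_le' {p q : ℝ} [Fact (1 < p)] [Fact (1 < q)] (c : 𝕜)
    (f : ZSpace 𝕜 n p q) : ‖c • f‖ ≤ ‖c‖ * ‖f‖ := by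
  show (carlesonNorm p q _).toReal ≤ ‖c‖ * (carlesonNorm p q _).toReal
  rw [← toReal_enorm c, ← ENNReal.toReal_mul]
  have e := carlesonNorm_congr p q (AEEqFun.coeFn_smul c (f : Amb n →ₘ[mu n] 𝕜))
  refine (congrArg ENNReal.toReal e).trans_le ?_
  exact ENNReal.toReal_mono (ENNReal.mul_ne_top enorm_ne_top f.2.2.ne)
    (carlesonNorm_smul_le p q c _)

lemma XSpace.norm_smul_le' {α p q : ℝ} [Fact (1 < p)] [Fact (1 < q)] (c : 𝕜)
    (f : XSpace 𝕜 n α p q) : ‖c • f‖ ≤ ‖c‖ * ‖f‖ := by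
  show (ntNorm α p q _).toReal ≤ ‖c‖ * (ntNorm α p q _).toReal
  rw [← toReal_enorm c, ← ENNReal.toReal_mul]
  have e := ntNorm_congr α p q (AEEqFun.coeFn_smul c (f : Amb n →ₘ[mu n] 𝕜))
  refine (congrArg ENNReal.toReal e).trans_le ?_
  exact ENNReal.toReal_mono (ENNReal.mul_ne_top enorm_ne_top f.2.2.ne)
    (ntNorm_smul_le α p q c _)

noncomputable instance (p q : ℝ) [hp : Fact (1 < p)] [hq : Fact (1 < q)] :
    NormedAddCommGroup (ZSpace 𝕜 n p q) :=
  AddGroupNorm.toNormedAddCommGroup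
    { toFun := norm
      map_zero' := by
        refine le_antisymm ?_ ENNReal.toReal_nonneg
        simpa using ZSpace.norm_smul_le' (0 : 𝕜) (0 : ZSpace 𝕜 n p q)
      add_le' := fun f g => by
        show (carlesonNorm p q _).toReal ≤ (carlesonNorm p q _).toReal + (carlesonNorm p q _).toReal
        rw [← ENNReal.toReal_add f.2.2.ne g.2.2.ne]
        have e := carlesonNorm_congr p q
          (AEEqFun.coeFn_add (f : Amb n →ₘ[mu n] 𝕜) (g : Amb n →ₘ[mu n] 𝕜))
        refine (congrArg ENNReal.toReal e).trans_le ?_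
        exact ENNReal.toReal_mono (ENNReal.add_ne_top.2 ⟨f.2.2.ne, g.2.2.ne⟩)
          (carlesonNorm_add_le hp.out hq.out f.1.stronglyMeasurable g.1.stronglyMeasurable)
      neg' := fun f => by
        have h : ∀ g : ZSpace 𝕜 n p q, ‖-g‖ ≤ ‖g‖ := fun g => by
          have e := ZSpace.norm_smul_le' (-1 : 𝕜) g
          rw [norm_neg, norm_one, one_mul] at e
          exact (congrArg norm (neg_one_smul 𝕜 g).symm).trans_le e
        exact le_antisymm (h f) ((congrArg norm (neg_neg f).symm).trans_le (h (-f)))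
      eq_zero_of_map_eq_zero' := fun f hf => by
        have h0 : carlesonNorm p q ((f : Amb n →ₘ[mu n] 𝕜) : Amb n → 𝕜) = 0 :=
          ((ENNReal.toReal_eq_zero_iff _).1 hf).resolve_right f.2.2.ne
        refine Subtype.ext (AEEqFun.ext ?_)
        exact (ae_eq_zero_of_carlesonNorm hp.out hq.out f.1.stronglyMeasurable h0).trans
          AEEqFun.coeFn_zero.symm }

noncomputable instance (α p q : ℝ) [hα : Fact (0 < α)] [hp : Fact (1 < p)] [hq : Fact (1 < q)] :
    NormedAddCommGroup (XSpace 𝕜 n α p q) :=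
  AddGroupNorm.toNormedAddCommGroup
    { toFun := norm
      map_zero' := by
        refine le_antisymm ?_ ENNReal.toReal_nonneg
        simpa using XSpace.norm_smul_le' (0 : 𝕜) (0 : XSpace 𝕜 n α p q)
      add_le' := fun f g => by
        show (ntNorm α p q _).toReal ≤ (ntNorm α p q _).toReal + (ntNorm α p q _).toReal
        rw [← ENNReal.toReal_add f.2.2.ne g.2.2.ne]
        have e := ntNorm_congr α p q
          (AEEqFun.coeFn_add (f : Amb n →ₘ[mu n] 𝕜) (g : Amb n →ₘ[mu n] 𝕜))
        refine (congrArg ENNReal.toReal e).trans_le ?_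
        exact ENNReal.toReal_mono (ENNReal.add_ne_top.2 ⟨f.2.2.ne, g.2.2.ne⟩)
          (ntNorm_add_le hp.out hq.out f.1.stronglyMeasurable g.1.stronglyMeasurable)
      neg' := fun f => by
        have h : ∀ g : XSpace 𝕜 n α p q, ‖-g‖ ≤ ‖g‖ := fun g => by
          have e := XSpace.norm_smul_le' (-1 : 𝕜) g
          rw [norm_neg, norm_one, one_mul] at e
          exact (congrArg norm (neg_one_smul 𝕜 g).symm).trans_le e
        exact le_antisymm (h f) ((congrArg norm (neg_neg f).symm).trans_le (h (-f)))
      eq_zero_of_map_eq_zero' := fun f hf => by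
        have h0 : ntNorm α p q ((f : Amb n →ₘ[mu n] 𝕜) : Amb n → 𝕜) = 0 :=
          ((ENNReal.toReal_eq_zero_iff _).1 hf).resolve_right f.2.2.ne
        refine Subtype.ext (AEEqFun.ext ?_)
        exact (ae_eq_zero_of_ntNorm hα.out hp.out hq.out f.1.stronglyMeasurable h0).trans
          AEEqFun.coeFn_zero.symm }

noncomputable instance (p q : ℝ) [Fact (1 < p)] [Fact (1 < q)] :
    NormedSpace 𝕜 (ZSpace 𝕜 n p q) where
  norm_smul_le := ZSpace.norm_smul_le'

noncomputable instance (α p q : ℝ) [Fact (0 < α)] [Fact (1 < p)] [Fact (1 < q)] :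
    NormedSpace 𝕜 (XSpace 𝕜 n α p q) where
  norm_smul_le := XSpace.norm_smul_le'

lemma ZSpace.norm_def {p q : ℝ} [Fact (1 < p)] [Fact (1 < q)] (f : ZSpace 𝕜 n p q) :
    ‖f‖ = (carlesonNorm p q ((f : Amb n →ₘ[mu n] 𝕜) : Amb n → 𝕜)).toReal := rfl

lemma XSpace.norm_def {α p q : ℝ} [Fact (0 < α)] [Fact (1 < p)] [Fact (1 < q)]
    (f : XSpace 𝕜 n α p q) :
    ‖f‖ = (ntNorm α p q ((f : Amb n →ₘ[mu n] 𝕜) : Amb n → 𝕜)).toReal := rfl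

/-- `f` has bounded support: it vanishes a.e. outside some bounded set. -/
def BddSupport (f : Amb n → 𝕜) : Prop :=
  ∃ B : Set (Amb n), Bornology.IsBounded B ∧ ∀ᵐ a ∂(mu n), a ∉ B → f a = 0

variable (𝕜 n)

/-- `Z₀`: the functions in `L_q(ℝ^{1+n}_+) ∩ Z` with bounded support. -/
def ZZero (p q : ℝ) [Fact (1 < p)] [Fact (1 < q)] : Set (ZSpace 𝕜 n p q) :=
  {f | MemLp ((f : Amb n →ₘ[mu n] 𝕜) : Amb n → 𝕜) (ENNReal.ofReal q) (mu n) ∧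
    BddSupport ((f : Amb n →ₘ[mu n] 𝕜) : Amb n → 𝕜)}

/-- `X₀`: the functions in `L_q(ℝ^{1+n}_+) ∩ X` with bounded support. -/
def XZero (α p q : ℝ) [Fact (1 < p)] [Fact (1 < q)] : Set (XSpace 𝕜 n α p q) :=
  {f | MemLp ((f : Amb n →ₘ[mu n] 𝕜) : Amb n → 𝕜) (ENNReal.ofReal q) (mu n) ∧
    BddSupport ((f : Amb n →ₘ[mu n] 𝕜) : Amb n → 𝕜)}

end

end HalfSpace

/-! The half space is the disjoint union of the dyadic Whitney boxes `box Q` = [2ℓ(Q), 4ℓ(Q)) × Q.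
If `coef q f Q` denotes the normalized L_q norm of f over `box Q`, the two spaces become spaces of
sequences: the norm of Z is comparable to the L_p norm of ∑_{Q ∋ x} ℓ(Q) coef(Q) (`zNorm`), and the
norm of X to the L_{p'} norm of sup_{Q ∋ x} coef(Q) (`xNorm`). So Z resembles L_p(ℓ_1), X resembles
L_{p'}(ℓ_∞), and the duality between them is the expected one.

Comparison of norms. Three of the four inequalities bound one functional pointwise by the
Hardy–Littlewood maximal function of the other (`exists_carlesonFun_le`, `exists_ntMax_le`,
`exists_supFun_le`). The fourth, `exists_zNorm_le_carlesonNorm`, is the deep one. Geometry only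
bounds the dyadic Carleson functional `carFun` by C(W_q f); it remains to prove ‖`sumFun`‖_p ≲
‖`carFun`‖_p (`exists_eLpNorm_sumFun_le`). For a finite partial sum A, write ∫ A^p as a pairing of A
with A^{p-1}; the Carleson embedding (`sum_mul_le_lintegral_carFun`) bounds it by the integral of
`carFun` times the maximal function of A^{p-1}, and the maximal theorem on L_{p'} closes the
estimate after division by a power of the finite number ∫ A^p.

Duality. Hölder on each box and a_Q b_Q ≤ a_Q sup_{R ∋ x} b_R on Q bound the pairing. Conversely, a
functional on Z restricts to L_q of every box, where the Riesz representation theorem gives a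
density; the densities are glued to a function g. Testing with multiples of ḡ|g|^{q'-2} on finitely
many boxes and linearizing the supremum (`exists_eLpNorm_supFun_le`) gives `xNorm` g ≲ the norm of
the functional. Density of functions carried by finitely many boxes then extends the representation
to all of Z.

The rest. Z is complete because its dyadic norm is countably subadditive; X is complete as an
isomorphic copy of a dual space. Density of Z₀ and X₀ is dominated convergence on the boundary. For
non-reflexivity, the functions e_k equal to 2^k on the layer of generation -k over the unit cube are
bounded in Z, and the indicators g_m of the part below generation -m satisfy ⟨e_k, g_m⟩ = 2 for k ≥
m, while ⟨f, g_m⟩ → 0 for every f in Z. A weak limit point of (e_k) in Z would contradict this. -/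

namespace HalfSpace

set_option linter.unusedSectionVars false

open Metric Filter Topology Module

/-! ### The Hardy–Littlewood maximal function -/

section Maximal

variable {E : Type*} [NormedAddCommGroup E] [NormedSpace ℝ E] [FiniteDimensional ℝ E]
  [MeasurableSpace E] [BorelSpace E] (μ : Measure E) [μ.IsAddHaarMeasure]

/-- The uncentered Hardy–Littlewood maximal function over balls. -/
noncomputable def hlMax (h : E → ℝ≥0∞) (x : E) : ℝ≥0∞ :=
  ⨆ (z : E) (r : ℝ) (_ : 0 < r) (_ : x ∈ ball z r), (μ (ball z r))⁻¹ * ∫⁻ y in ball z r, h y ∂μ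

lemma lt_hlMax_iff {h : E → ℝ≥0∞} {c : ℝ≥0∞} {x : E} : c < hlMax μ h x ↔
    ∃ z r, 0 < r ∧ x ∈ ball z r ∧ c < (μ (ball z r))⁻¹ * ∫⁻ y in ball z r, h y ∂μ := by
  simp only [hlMax, lt_iSup_iff, exists_prop]

lemma measurable_hlMax (h : E → ℝ≥0∞) : Measurable (hlMax μ h) := by
  refine measurable_of_Ioi fun c => ?_
  have : hlMax μ h ⁻¹' Ioi c = ⋃ (z : E) (r : ℝ) (_ : 0 < r)
      (_ : c < (μ (ball z r))⁻¹ * ∫⁻ y in ball z r, h y ∂μ), ball z r := by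
    ext x
    simp only [mem_preimage, mem_Ioi, lt_hlMax_iff, mem_iUnion, exists_prop]
    grind
  rw [this]
  exact (isOpen_iUnion fun z => isOpen_iUnion fun r => isOpen_iUnion fun _ =>
    isOpen_iUnion fun _ => isOpen_ball).measurableSet

lemma lintegral_le_hlMax (h : E → ℝ≥0∞) {S : Set E} {x z : E} {r : ℝ} (hS : S ⊆ ball z r)
    (hx : x ∈ ball z r) : ∫⁻ y in S, h y ∂μ ≤ μ (ball z r) * hlMax μ h x := by
  have hr : 0 < r := pos_of_mem_ball hx
  have h1 : (μ (ball z r))⁻¹ * ∫⁻ y in ball z r, h y ∂μ ≤ hlMax μ h x :=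
    le_iSup_of_le z (le_iSup_of_le r (le_iSup_of_le hr (le_iSup_of_le hx le_rfl)))
  have h2 : ∫⁻ y in ball z r, h y ∂μ ≤ μ (ball z r) * hlMax μ h x := by
    rw [mul_comm] at h1
    rw [mul_comm]
    exact (ENNReal.div_le_iff_le_mul (Or.inl (measure_ball_pos μ z hr).ne')
      (Or.inl measure_ball_lt_top.ne)).1 h1
  exact (lintegral_mono_set hS).trans h2

/-- The weak type `(1, 1)` inequality. -/
lemma mul_measure_hlMax_gt_le (h : E → ℝ≥0∞) (c : ℝ≥0∞) :
    c * μ {x | c < hlMax μ h x} ≤ ENNReal.ofReal (4 ^ finrank ℝ E) * ∫⁻ x, h x ∂μ := by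
  -- The Vitali covering lemma needs bounded radii, so the superlevel set is exhausted by balls of
  -- radius at most N; the estimate is uniform in N.
  set t : ℕ → Set (E × ℝ) := fun N => {a | 0 < a.2 ∧ a.2 ≤ N ∧
    c < (μ (ball a.1 a.2))⁻¹ * ∫⁻ y in ball a.1 a.2, h y ∂μ} with ht
  have hU : {x | c < hlMax μ h x} = ⋃ N, ⋃ a ∈ t N, ball a.1 a.2 := by
    ext x
    simp only [mem_ofPred_eq, lt_hlMax_iff, mem_iUnion, exists_prop, ht, Prod.exists]
    constructor
    · rintro ⟨z, r, hr, hx, hc⟩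
      obtain ⟨N, hN⟩ := exists_nat_ge r
      exact ⟨N, z, r, ⟨hr, hN, hc⟩, hx⟩
    · rintro ⟨N, z, r, ⟨hr, hN, hc⟩, hx⟩
      exact ⟨z, r, hr, hx, hc⟩
  have hmono : Monotone fun N => ⋃ a ∈ t N, ball a.1 a.2 := by
    intro N M hNM
    refine biUnion_subset_biUnion_left fun a ha => ⟨ha.1, ha.2.1.trans ?_, ha.2.2⟩
    exact_mod_cast hNM
  rw [hU, hmono.measure_iUnion, ENNReal.mul_iSup]
  refine iSup_le fun N => ?_
  -- Enlarging the selected disjoint balls by the factor 4 covers all the others; this is where `4 ^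
  -- finrank ℝ E` comes from.
  obtain ⟨u, hut, hdisj, hcov⟩ := Vitali.exists_disjoint_subfamily_covering_enlargement_ball
    (t N) (fun a => a.1) (fun a => a.2) N (fun a ha => ha.2.1) 4 (by norm_num)
  have hucount : u.Countable := hdisj.countable_of_isOpen (fun a _ => isOpen_ball)
    fun a ha => nonempty_ball.2 (hut ha).1
  have hone : ∀ a ∈ u, c * μ (ball a.1 (4 * a.2)) ≤
      ENNReal.ofReal (4 ^ finrank ℝ E) * ∫⁻ y in ball a.1 a.2, h y ∂μ := by
    intro a ha
    have hlt := (hut ha).2.2.le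
    rw [μ.addHaar_ball_mul_of_pos a.1 (by norm_num : (0 : ℝ) < 4), mul_left_comm,
      ← μ.addHaar_ball_center a.1]
    gcongr
    rw [mul_comm] at hlt
    exact ENNReal.mul_le_of_le_div hlt
  calc c * μ (⋃ a ∈ t N, ball a.1 a.2) ≤ c * μ (⋃ a ∈ u, ball a.1 (4 * a.2)) := by
        refine mul_le_mul_right (measure_mono ?_) _
        refine iUnion₂_subset fun a ha => ?_
        obtain ⟨b, hb, hab⟩ := hcov a ha
        exact hab.trans (subset_biUnion_of_mem (u := fun b : E × ℝ => ball b.1 (4 * b.2)) hb)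
    _ ≤ c * ∑' a : u, μ (ball a.1.1 (4 * a.1.2)) := by
        gcongr
        exact measure_biUnion_le μ hucount _
    _ = ∑' a : u, c * μ (ball a.1.1 (4 * a.1.2)) := ENNReal.tsum_mul_left.symm
    _ ≤ ∑' a : u, ENNReal.ofReal (4 ^ finrank ℝ E) * ∫⁻ y in ball a.1.1 a.1.2, h y ∂μ :=
        ENNReal.tsum_le_tsum fun a => hone a a.2
    _ = ENNReal.ofReal (4 ^ finrank ℝ E) * ∫⁻ y in ⋃ a ∈ u, ball a.1 a.2, h y ∂μ := by
        rw [ENNReal.tsum_mul_left, lintegral_biUnion hucount (fun a _ => measurableSet_ball) hdisj]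
    _ ≤ _ := by
        exact mul_le_mul_right (setLIntegral_le_lintegral _ _) _

end Maximal

/-- The layer cake formula for a power of an extended nonnegative number. -/
lemma lintegral_layer {r : ℝ} (hr : 0 < r) (y : ℝ≥0∞) :
    ∫⁻ s in {s : ℝ | 0 < s ∧ ENNReal.ofReal s < y}, ENNReal.ofReal (s ^ (r - 1)) =
      y ^ r / ENNReal.ofReal r := by
  have hfin : ∀ b : ℝ, 0 ≤ b → ∫⁻ s in Ioo 0 b, ENNReal.ofReal (s ^ (r - 1)) =
      ENNReal.ofReal (b ^ r / r) := by
    intro b hb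
    have hint : IntervalIntegrable (fun s : ℝ => s ^ (r - 1)) volume 0 b :=
      intervalIntegral.intervalIntegrable_rpow' (by linarith)
    rw [← restrict_Ioo_eq_restrict_Ioc.symm.trans rfl, ← ofReal_integral_eq_lintegral_ofReal]
    · rw [← intervalIntegral.integral_of_le hb, integral_rpow (Or.inl (by linarith))]
      simp [hr.ne']
    · exact (intervalIntegrable_iff_integrableOn_Ioc_of_le hb).1 hint
    · filter_upwards [self_mem_ae_restrict measurableSet_Ioc] with s hs
      exact Real.rpow_nonneg hs.1.le _
  rcases eq_or_ne y ∞ with rfl | hy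
  · rw [ENNReal.top_rpow_of_pos hr, ENNReal.top_div_of_ne_top ENNReal.ofReal_ne_top]
    refine ENNReal.eq_top_of_forall_nnreal_le fun c => ?_
    -- For y = ∞ the integral has to exceed every c; the witness solves b^r / r = c.
    obtain ⟨b, hb, hbc⟩ : ∃ b : ℝ, 0 ≤ b ∧ (c : ℝ) ≤ b ^ r / r := by
      refine ⟨(c * r) ^ (1 / r), by positivity, ?_⟩
      rw [← Real.rpow_mul (by positivity), one_div_mul_cancel hr.ne', Real.rpow_one]
      field_simp
      exact le_rfl
    calc (c : ℝ≥0∞) = ENNReal.ofReal c := by simp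
      _ ≤ ENNReal.ofReal (b ^ r / r) := ENNReal.ofReal_le_ofReal hbc
      _ = _ := (hfin b hb).symm
      _ ≤ _ := lintegral_mono_set (show Ioo 0 b ⊆ {s : ℝ | 0 < s ∧ ENNReal.ofReal s < ∞} from
          fun s hs => ⟨hs.1, ENNReal.ofReal_lt_top⟩)
  · lift y to NNReal using hy
    have : {s : ℝ | 0 < s ∧ ENNReal.ofReal s < y} = Ioo 0 (y : ℝ) := by
      ext s
      simp only [mem_ofPred_eq, mem_Ioo, and_congr_right_iff]
      intro hs
      rw [← ENNReal.ofReal_coe_nnreal, ENNReal.ofReal_lt_ofReal_iff_of_nonneg hs.le]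
    rw [this, hfin y y.2, ENNReal.ofReal_div_of_pos hr, ← ENNReal.ofReal_rpow_of_nonneg y.coe_nonneg hr.le]
    simp

lemma measurableSet_layer {α : Type*} [MeasurableSpace α] {F : α → ℝ≥0∞} (hF : Measurable F) :
    MeasurableSet {w : α × ℝ | 0 < w.2 ∧ ENNReal.ofReal w.2 < F w.1} :=
  (measurableSet_lt measurable_const measurable_snd).inter
    (measurableSet_lt (ENNReal.measurable_ofReal.comp measurable_snd) (hF.comp measurable_fst))

/-- The layer cake formula for the integral of a power times a weight. -/
lemma lintegral_mul_rpow_layer {α : Type*} [MeasurableSpace α] (μ : Measure α) [SFinite μ]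
    {r : ℝ} (hr : 0 < r) {F G : α → ℝ≥0∞} (hF : Measurable F) (hG : Measurable G) :
    ∫⁻ x, G x * (F x ^ r / ENNReal.ofReal r) ∂μ =
      ∫⁻ s in Ioi (0 : ℝ), ENNReal.ofReal (s ^ (r - 1)) *
        ∫⁻ x in {x | ENNReal.ofReal s < F x}, G x ∂μ := by
  have hw : Measurable fun s : ℝ => ENNReal.ofReal (s ^ (r - 1)) := by fun_prop
  -- Tonelli is applied to the kernel G(x) s^{r-1} restricted to 0 < s < F(x).
  set k : α → ℝ → ℝ≥0∞ := fun x s => {w : α × ℝ | 0 < w.2 ∧ ENNReal.ofReal w.2 < F w.1}.indicator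
    (fun w => G w.1 * ENNReal.ofReal (w.2 ^ (r - 1))) (x, s) with hk
  have hkm : Measurable (Function.uncurry k) :=
    ((hG.comp measurable_fst).mul (hw.comp measurable_snd)).indicator (measurableSet_layer hF)
  have h1 : ∀ x, G x * (F x ^ r / ENNReal.ofReal r) = ∫⁻ s, k x s := by
    intro x
    have hms : MeasurableSet {s : ℝ | 0 < s ∧ ENNReal.ofReal s < F x} :=
      measurable_prodMk_left (measurableSet_layer hF)
    rw [← lintegral_layer hr, ← lintegral_const_mul _ hw, ← lintegral_indicator hms]
    rfl
  have h2 : ∀ s, ∫⁻ x, k x s ∂μ = (Ioi (0 : ℝ)).indicator (fun s => ENNReal.ofReal (s ^ (r - 1)) *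
        ∫⁻ x in {x | ENNReal.ofReal s < F x}, G x ∂μ) s := by
    intro s
    by_cases hs : 0 < s
    · rw [indicator_of_mem (show s ∈ Ioi 0 from hs), ← lintegral_const_mul _ hG,
        ← lintegral_indicator (measurableSet_lt measurable_const hF)]
      refine lintegral_congr fun x => ?_
      simp only [hk, indicator, mem_ofPred_eq, hs, true_and]
      split_ifs <;> ring
    · rw [indicator_of_notMem (show s ∉ Ioi 0 from hs)]
      simp [hk, indicator, hs]
  rw [lintegral_congr h1, lintegral_lintegral_swap hkm.aemeasurable, lintegral_congr h2,
    lintegral_indicator measurableSet_Ioi]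

/-! ### The strong type maximal inequality -/

section Maximal

variable {E : Type*} [NormedAddCommGroup E] [NormedSpace ℝ E] [FiniteDimensional ℝ E]
  [MeasurableSpace E] [BorelSpace E] (μ : Measure E) [μ.IsAddHaarMeasure]

/-- The values of h below height c contribute at most c to any average. This is the truncation in
the Marcinkiewicz interpolation argument. -/
lemma hlMax_le_add (h : E → ℝ≥0∞) (c : ℝ≥0∞) (x : E) :
    hlMax μ h x ≤ hlMax μ ({y | c < h y}.indicator h) x + c := by
  have hpt : ∀ y, h y ≤ {y | c < h y}.indicator h y + c := by
    intro y
    by_cases hy : c < h y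
    · simp [indicator, hy]
    · simp [indicator, hy, not_lt.1 hy]
  refine iSup_le fun z => iSup_le fun r => iSup_le fun hr => iSup_le fun hx => ?_
  calc (μ (ball z r))⁻¹ * ∫⁻ y in ball z r, h y ∂μ
      ≤ (μ (ball z r))⁻¹ * ∫⁻ y in ball z r, ({y | c < h y}.indicator h y + c) ∂μ := by
        gcongr; exact hpt _
    _ = (μ (ball z r))⁻¹ * ∫⁻ y in ball z r, {y | c < h y}.indicator h y ∂μ + c := by
        rw [lintegral_add_right _ measurable_const, mul_add, setLIntegral_const, mul_left_comm,
          ENNReal.inv_mul_cancel (measure_ball_pos μ z hr).ne' measure_ball_lt_top.ne, mul_one]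
    _ ≤ _ := by
        gcongr
        exact le_iSup_of_le z (le_iSup_of_le r (le_iSup_of_le hr (le_iSup_of_le hx le_rfl)))

/-- The Hardy–Littlewood maximal theorem, in integral form. -/
lemma lintegral_hlMax_rpow_le {p : ℝ} (hp : 1 < p) : ∃ C : ℝ≥0∞, C ≠ ∞ ∧
    ∀ h : E → ℝ≥0∞, Measurable h → ∫⁻ x, hlMax μ h x ^ p ∂μ ≤ C * ∫⁻ x, h x ^ p ∂μ := by
  have hp0 : 0 < p := by linarith
  have hp1 : 0 < p - 1 := by linarith
  set K : ℝ≥0∞ := ENNReal.ofReal (4 ^ finrank ℝ E) with hK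
  refine ⟨ENNReal.ofReal p * (K * 2 * (2 ^ (p - 1) / ENNReal.ofReal (p - 1))), ?_, ?_⟩
  · refine ENNReal.mul_ne_top ENNReal.ofReal_ne_top (ENNReal.mul_ne_top
      (ENNReal.mul_ne_top ENNReal.ofReal_ne_top (by simp)) ?_)
    exact ENNReal.div_ne_top (ENNReal.rpow_ne_top_of_nonneg hp1.le (by simp)) (by simpa using hp)
  intro h hh
  have hM := measurable_hlMax μ h
  -- Truncation at height s/2: the lower part of h accounts for at most s/2 of the maximal function,
  -- so the weak type bound at level s/2 is only charged for the part where 2h > s.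
  have hweak : ∀ s : ℝ, 0 < s → μ {x | ENNReal.ofReal s < hlMax μ h x} ≤
      K * 2 * (ENNReal.ofReal s)⁻¹ * ∫⁻ x in {x | ENNReal.ofReal s < 2 * h x}, h x ∂μ := by
    intro s hs
    have hs2 : ENNReal.ofReal (s / 2) ≠ 0 := by simpa using hs
    have hset : {x | ENNReal.ofReal (s / 2) < h x} = {x | ENNReal.ofReal s < 2 * h x} := by
      ext x
      have : ENNReal.ofReal s = 2 * ENNReal.ofReal (s / 2) := by
        rw [← ENNReal.ofReal_ofNat, ← ENNReal.ofReal_mul (by norm_num)]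
        congr 1; ring
      simp only [mem_ofPred_eq, this]
      exact (ENNReal.mul_lt_mul_iff_right (by simp) (by simp)).symm
    have h1 := mul_measure_hlMax_gt_le μ ({x | ENNReal.ofReal (s / 2) < h x}.indicator h)
      (ENNReal.ofReal (s / 2))
    rw [lintegral_indicator (measurableSet_lt measurable_const hh), hset] at h1
    have hsub : {x | ENNReal.ofReal s < hlMax μ h x} ⊆ {x | ENNReal.ofReal (s / 2) <
        hlMax μ ({x | ENNReal.ofReal s < 2 * h x}.indicator h) x} := by
      intro x hx
      by_contra hcon
      simp only [mem_ofPred_eq, not_lt] at hcon hx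
      have h2 := hlMax_le_add μ h (ENNReal.ofReal (s / 2)) x
      rw [hset] at h2
      have h3 := h2.trans (add_le_add_left hcon _)
      rw [← ENNReal.ofReal_add (by linarith) (by linarith), add_halves] at h3
      exact absurd hx (not_lt.2 h3)
    have hinv : (ENNReal.ofReal (s / 2))⁻¹ = 2 * (ENNReal.ofReal s)⁻¹ := by
      rw [ENNReal.ofReal_div_of_pos (by norm_num), ENNReal.ofReal_ofNat,
        ENNReal.inv_div (by simp) (by simp), div_eq_mul_inv]
    calc μ {x | ENNReal.ofReal s < hlMax μ h x} ≤ _ := measure_mono hsub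
      _ ≤ (K * ∫⁻ x in {x | ENNReal.ofReal s < 2 * h x}, h x ∂μ) / ENNReal.ofReal (s / 2) := by
        rw [ENNReal.le_div_iff_mul_le (Or.inl hs2) (Or.inl ENNReal.ofReal_ne_top), mul_comm]
        exact h1
      _ = _ := by rw [div_eq_mul_inv, hinv]; ring
  -- The layer cake formula is used twice: with exponent p and weight 1 for the maximal function,
  -- and with exponent p - 1 and weight h for 2h. The factor 1/s in the weak type bound lowers the
  -- exponent from p to p - 1.
  have hlay := lintegral_mul_rpow_layer μ hp0 hM (measurable_const (a := (1 : ℝ≥0∞)))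
  have hlay2 := lintegral_mul_rpow_layer μ hp1 (hh.const_mul 2) hh
  have hpz : ENNReal.ofReal p ≠ 0 := by simpa using hp0
  have hpow : ∀ x, h x * ((2 * h x) ^ (p - 1) / ENNReal.ofReal (p - 1)) =
      2 ^ (p - 1) / ENNReal.ofReal (p - 1) * h x ^ p := by
    intro x
    have : h x ^ p = h x * h x ^ (p - 1) := by
      conv_lhs => rw [show p = 1 + (p - 1) by ring,
        ENNReal.rpow_add_of_nonneg _ _ zero_le_one hp1.le, ENNReal.rpow_one]
    rw [ENNReal.mul_rpow_of_nonneg _ _ hp1.le, this, div_eq_mul_inv, div_eq_mul_inv]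
    ring
  calc ∫⁻ x, hlMax μ h x ^ p ∂μ
      = ENNReal.ofReal p * ∫⁻ x, 1 * (hlMax μ h x ^ p / ENNReal.ofReal p) ∂μ := by
        rw [← lintegral_const_mul _ (by fun_prop)]
        refine lintegral_congr fun x => ?_
        rw [one_mul, ENNReal.mul_div_cancel hpz ENNReal.ofReal_ne_top]
    _ = ENNReal.ofReal p * ∫⁻ s in Ioi (0 : ℝ), ENNReal.ofReal (s ^ (p - 1)) *
          μ {x | ENNReal.ofReal s < hlMax μ h x} := by
        rw [hlay]; simp
    _ ≤ ENNReal.ofReal p * ∫⁻ s in Ioi (0 : ℝ), K * 2 * (ENNReal.ofReal (s ^ (p - 1 - 1)) *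
          ∫⁻ x in {x | ENNReal.ofReal s < 2 * h x}, h x ∂μ) := by
        gcongr ENNReal.ofReal p * ?_
        refine setLIntegral_mono' measurableSet_Ioi fun s hs => ?_
        have hs0 : 0 < s := hs
        refine (mul_le_mul_right (hweak s hs) _).trans_eq ?_
        have : ENNReal.ofReal (s ^ (p - 1)) * (ENNReal.ofReal s)⁻¹ =
            ENNReal.ofReal (s ^ (p - 1 - 1)) := by
          rw [← ENNReal.ofReal_inv_of_pos hs0, ← ENNReal.ofReal_mul (by positivity),
            Real.rpow_sub_one hs0.ne' (p - 1), div_eq_mul_inv]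
        rw [← this]; ring
    _ = ENNReal.ofReal p * (K * 2 * ∫⁻ x, h x * ((2 * h x) ^ (p - 1) / ENNReal.ofReal (p - 1)) ∂μ) := by
        rw [hlay2, lintegral_const_mul' _ _ (ENNReal.mul_ne_top ENNReal.ofReal_ne_top (by simp))]
    _ = _ := by
        rw [lintegral_congr hpow, lintegral_const_mul _ (by fun_prop)]
        ring

end Maximal

/-- The `L_p` norm of a function with values in `ℝ≥0∞`. -/
lemma eLpNorm_ennreal {α : Type*} [MeasurableSpace α] (μ : Measure α) {p : ℝ} (hp : 0 < p)
    (h : α → ℝ≥0∞) : eLpNorm h (ENNReal.ofReal p) μ = (∫⁻ x, h x ^ p ∂μ) ^ (1 / p) := by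
  rw [eLpNorm_eq_lintegral_rpow_enorm_toReal (by simpa using hp) ENNReal.ofReal_ne_top,
    ENNReal.toReal_ofReal hp.le]
  rfl

/-- The Hardy–Littlewood maximal theorem. -/
lemma eLpNorm_hlMax_le {E : Type*} [NormedAddCommGroup E] [NormedSpace ℝ E]
    [FiniteDimensional ℝ E] [MeasurableSpace E] [BorelSpace E] (μ : Measure E)
    [μ.IsAddHaarMeasure] {p : ℝ} (hp : 1 < p) : ∃ C : ℝ≥0∞, C ≠ ∞ ∧ ∀ h : E → ℝ≥0∞,
    Measurable h → eLpNorm (hlMax μ h) (ENNReal.ofReal p) μ ≤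
      C * eLpNorm h (ENNReal.ofReal p) μ := by
  have hp0 : 0 < p := by linarith
  obtain ⟨C, hC, H⟩ := lintegral_hlMax_rpow_le μ hp
  refine ⟨C ^ (1 / p), ENNReal.rpow_ne_top_of_nonneg (by positivity) hC, fun h hh => ?_⟩
  rw [eLpNorm_ennreal μ hp0, eLpNorm_ennreal μ hp0, ← ENNReal.mul_rpow_of_nonneg _ _ (by positivity)]
  exact ENNReal.rpow_le_rpow (H h hh) (by positivity)

/-! ### Dyadic cubes -/

/-- Indices of dyadic cubes: generation and position. -/
abbrev DIdx (n : ℕ) : Type := ℤ × (Fin n → ℤ)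

/-- The sidelength of a dyadic cube. -/
noncomputable def side {n : ℕ} (Q : DIdx n) : ℝ := 2 ^ Q.1

/-- The half-open dyadic cube with a given index. -/
def dcube {n : ℕ} (Q : DIdx n) : Set (Bdry n) := {y | ∀ i, ⌊y i / side Q⌋ = Q.2 i}

section

variable {n : ℕ}

lemma side_pos (Q : DIdx n) : 0 < side Q := by unfold side; positivity

lemma mem_dcube_iff {Q : DIdx n} {y : Bdry n} : y ∈ dcube Q ↔
    ∀ i, y i ∈ Ico (Q.2 i * side Q) ((Q.2 i + 1) * side Q) := by
  refine forall_congr' fun i => ?_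
  rw [Int.floor_eq_iff, le_div_iff₀ (side_pos Q), div_lt_iff₀ (side_pos Q)]
  rfl

lemma mem_dcube_floor (k : ℤ) (y : Bdry n) :
    y ∈ dcube ((k, fun i => ⌊y i / 2 ^ k⌋) : DIdx n) := fun _ => rfl

lemma dcube_eq_of_mem {Q R : DIdx n} {y : Bdry n} (hQ : y ∈ dcube Q) (hR : y ∈ dcube R)
    (h : Q.1 = R.1) : Q = R := by
  refine Prod.ext h (funext fun i => ?_)
  rw [← hQ i, ← hR i, side, side, h]

/-- The side of R is a natural multiple N of the side of Q, and ⌊u/N⌋ depends only on ⌊u⌋; so the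
index of a point at the coarse scale is determined by its index at the fine one. -/
lemma dcube_subset_of_mem {Q R : DIdx n} {y : Bdry n} (hQ : y ∈ dcube Q) (hR : y ∈ dcube R)
    (h : Q.1 ≤ R.1) : dcube Q ⊆ dcube R := by
  have hs : side R = side Q * ((2 ^ (R.1 - Q.1).toNat : ℕ) : ℝ) := by
    rw [side, side, Nat.cast_pow, Nat.cast_ofNat, ← zpow_natCast, Int.toNat_of_nonneg (by linarith),
      ← zpow_add₀ (by norm_num)]
    congr 1; ring
  intro z hz i
  rw [← hR i, hs, ← div_div, ← div_div, Int.floor_div_natCast, Int.floor_div_natCast, hQ i, hz i]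

lemma measure_preimage_pi (s : Fin n → Set ℝ) (hs : ∀ i, MeasurableSet (s i)) :
    volume {y : Bdry n | ∀ i, y i ∈ s i} = ∏ i, volume (s i) := by
  have : {y : Bdry n | ∀ i, y i ∈ s i} = (WithLp.ofLp : Bdry n → Fin n → ℝ) ⁻¹' (univ.pi s) := by
    ext y; simp
  rw [this, (PiLp.volume_preserving_ofLp (Fin n)).measure_preimage
    (MeasurableSet.univ_pi hs).nullMeasurableSet, volume_pi_pi]

lemma measurableSet_dcube (Q : DIdx n) : MeasurableSet (dcube Q) := by
  have : dcube Q = ⋂ i, {y : Bdry n | y i ∈ Ico (Q.2 i * side Q) ((Q.2 i + 1) * side Q)} := by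
    ext y; simp only [mem_dcube_iff, mem_iInter, mem_ofPred_eq]
  rw [this]
  refine MeasurableSet.iInter fun i => ?_
  exact measurableSet_Ico.preimage (f := fun y : Bdry n => y i) (by fun_prop)

lemma volume_dcube (Q : DIdx n) : volume (dcube Q) = ENNReal.ofReal (side Q) ^ n := by
  have : dcube Q = {y : Bdry n | ∀ i, y i ∈ Ico (Q.2 i * side Q) ((Q.2 i + 1) * side Q)} := by
    ext y; simp only [mem_dcube_iff, mem_ofPred_eq]
  rw [this, measure_preimage_pi _ fun i => measurableSet_Ico]
  simp only [Real.volume_Ico, ← sub_mul, add_sub_cancel_left, one_mul, Finset.prod_const,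
    Finset.card_univ, Fintype.card_fin]

lemma volume_cube (z : Bdry n) (l : ℝ) : volume (cube z l) = ENNReal.ofReal l ^ n := by
  have : cube z l = {y : Bdry n | ∀ i, y i ∈ Ioo (z i - l / 2) (z i + l / 2)} := by
    ext y
    refine forall_congr' fun i => ?_
    rw [abs_sub_lt_iff, mem_Ioo]
    constructor <;> rintro ⟨h1, h2⟩ <;> constructor <;> linarith
  rw [this, measure_preimage_pi _ fun i => measurableSet_Ioo]
  have hl : ∀ i, z i + l / 2 - (z i - l / 2) = l := fun i => by ring
  simp only [Real.volume_Ioo, hl, Finset.prod_const, Finset.card_univ, Fintype.card_fin]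

lemma volume_dcube_ne_zero (Q : DIdx n) : volume (dcube Q) ≠ 0 := by
  rw [volume_dcube]
  exact pow_ne_zero _ (by simpa using side_pos Q)

lemma volume_dcube_ne_top (Q : DIdx n) : volume (dcube Q) ≠ ∞ := by
  rw [volume_dcube]
  exact ENNReal.pow_ne_top ENNReal.ofReal_ne_top

lemma abs_sub_lt_side {Q : DIdx n} {x y : Bdry n} (hx : x ∈ dcube Q) (hy : y ∈ dcube Q)
    (i : Fin n) : |x i - y i| < side Q := by
  have h1 := mem_dcube_iff.1 hx i
  have h2 := mem_dcube_iff.1 hy i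
  rw [abs_sub_lt_iff]
  constructor <;> linarith [h1.1, h1.2, h2.1, h2.2]

lemma norm_le_of_abs_le {v : Bdry n} {b : ℝ} (h : ∀ i, |v i| ≤ b) : ‖v‖ ≤ n * b := by
  have h1 : ‖v‖ ≤ ∑ i, |v i| := by
    rw [EuclideanSpace.norm_eq]
    refine Real.sqrt_le_iff.2 ⟨by positivity, ?_⟩
    exact Finset.sum_sq_le_sq_sum_of_nonneg fun i _ => norm_nonneg (v i)
  refine h1.trans ((Finset.sum_le_sum fun i _ => h i).trans_eq ?_)
  simp

/-- The factor n + 1 instead of n makes the inequality strict and keeps the radius positive even for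
n = 0. -/
lemma mem_ball_of_abs_le {x y : Bdry n} {b : ℝ} (hb : 0 < b) (h : ∀ i, |y i - x i| ≤ b) :
    y ∈ ball x ((n + 1) * b) := by
  rw [mem_ball_iff_norm]
  have := norm_le_of_abs_le (v := y - x) h
  linarith

lemma volume_ball_bdry (z : Bdry n) {r : ℝ} (hr : 0 < r) :
    volume (ball z r) = ENNReal.ofReal r ^ n * volume (ball (0 : Bdry n) 1) := by
  have h := Measure.addHaar_ball_mul_of_pos volume z hr 1
  rw [mul_one] at h
  rw [h, finrank_euclideanSpace, Fintype.card_fin, ENNReal.ofReal_pow hr.le]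

/-- The integral over a set of diameter comparable to `b` is controlled by the maximal function. -/
lemma exists_lintegral_le_hlMax (n : ℕ) (c : ℝ) (hc : 0 < c) : ∃ C : ℝ≥0∞, C ≠ ∞ ∧
    ∀ (h : Bdry n → ℝ≥0∞) (S : Set (Bdry n)) (z x : Bdry n) (b : ℝ), 0 < b →
      (∀ y ∈ S, ∀ i, |y i - z i| ≤ c * b) → (∀ i, |x i - z i| ≤ c * b) →
      ∫⁻ y in S, h y ≤ C * ENNReal.ofReal b ^ n * hlMax volume h x := by
  refine ⟨ENNReal.ofReal ((n + 1) * c) ^ n * volume (ball (0 : Bdry n) 1),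
    ENNReal.mul_ne_top (ENNReal.pow_ne_top ENNReal.ofReal_ne_top) measure_ball_lt_top.ne, ?_⟩
  intro h S z x b hb hS hx
  have hcb : 0 < c * b := by positivity
  refine (lintegral_le_hlMax volume h (z := z) (r := (n + 1) * (c * b))
    (fun y hy => mem_ball_of_abs_le hcb (hS y hy)) (mem_ball_of_abs_le hcb hx)).trans_eq ?_
  rw [volume_ball_bdry z (by positivity), ← mul_assoc, ENNReal.ofReal_mul (by positivity), mul_pow]
  ring

lemma exists_lintegral_dcube_le (n : ℕ) : ∃ C : ℝ≥0∞, C ≠ ∞ ∧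
    ∀ (h : Bdry n → ℝ≥0∞) (Q : DIdx n) (x : Bdry n), x ∈ dcube Q →
      ∫⁻ y in dcube Q, h y ≤ C * volume (dcube Q) * hlMax volume h x := by
  obtain ⟨C, hC, H⟩ := exists_lintegral_le_hlMax n 1 one_pos
  refine ⟨C, hC, fun h Q x hx => ?_⟩
  rw [volume_dcube]
  refine H h _ x x (side Q) (side_pos Q) (fun y hy i => ?_) fun i => ?_
  · rw [one_mul]; exact (abs_sub_lt_side hy hx i).le
  · simpa using (side_pos Q).le

end

/-! ### Discrete Carleson and maximal functionals -/

section

variable {n : ℕ}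

/-- `∑_{Q ∋ x} a_Q`. -/
noncomputable def sumFun (a : DIdx n → ℝ≥0∞) (x : Bdry n) : ℝ≥0∞ :=
  ∑' Q, (dcube Q).indicator (fun _ => a Q) x

/-- `sup_{Q ∋ x} b_Q`. -/
noncomputable def supFun (b : DIdx n → ℝ≥0∞) (x : Bdry n) : ℝ≥0∞ :=
  ⨆ Q, (dcube Q).indicator (fun _ => b Q) x

open Classical in
/-- The discrete Carleson functional `sup_{Q ∋ x} |Q|⁻¹ ∑_{R ⊆ Q} a_R |R|`. -/
noncomputable def carFun (a : DIdx n → ℝ≥0∞) : Bdry n → ℝ≥0∞ :=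
  supFun fun Q => (volume (dcube Q))⁻¹ *
    ∑' R, if dcube R ⊆ dcube Q then a R * volume (dcube R) else 0

lemma measurable_indicator_dcube (Q : DIdx n) (c : ℝ≥0∞) :
    Measurable ((dcube Q).indicator fun _ => c) :=
  measurable_const.indicator (measurableSet_dcube Q)

lemma measurable_sumFun (a : DIdx n → ℝ≥0∞) : Measurable (sumFun a) :=
  Measurable.tsum fun Q => measurable_indicator_dcube Q (a Q)

lemma measurable_supFun (b : DIdx n → ℝ≥0∞) : Measurable (supFun b) :=
  Measurable.iSup fun Q => measurable_indicator_dcube Q (b Q)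

lemma measurable_carFun (a : DIdx n → ℝ≥0∞) : Measurable (carFun a) := measurable_supFun _

lemma le_supFun (b : DIdx n → ℝ≥0∞) {Q : DIdx n} {x : Bdry n} (hx : x ∈ dcube Q) :
    b Q ≤ supFun b x :=
  le_iSup_of_le Q (by rw [indicator_of_mem hx])

lemma supFun_le {b : DIdx n → ℝ≥0∞} {x : Bdry n} {c : ℝ≥0∞} (h : ∀ Q, x ∈ dcube Q → b Q ≤ c) :
    supFun b x ≤ c := by
  refine iSup_le fun Q => ?_
  by_cases hx : x ∈ dcube Q
  · rw [indicator_of_mem hx]; exact h Q hx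
  · simp [hx]

lemma lintegral_mul_indicator_dcube {F : Bdry n → ℝ≥0∞} (hF : Measurable F) (Q : DIdx n)
    (c : ℝ≥0∞) : ∫⁻ x, (dcube Q).indicator (fun _ => c) x * F x = c * ∫⁻ x in dcube Q, F x := by
  rw [← lintegral_const_mul _ hF, ← lintegral_indicator (measurableSet_dcube Q)]
  refine lintegral_congr fun x => ?_
  simp only [indicator]
  split_ifs <;> simp

lemma lintegral_sumFun_mul (a : DIdx n → ℝ≥0∞) {F : Bdry n → ℝ≥0∞} (hF : Measurable F) :
    ∫⁻ x, sumFun a x * F x = ∑' Q, a Q * ∫⁻ x in dcube Q, F x := by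
  simp only [sumFun, ← ENNReal.tsum_mul_right]
  rw [lintegral_tsum (f := fun Q x => (dcube Q).indicator (fun _ => a Q) x * F x)
    fun Q => ((measurable_indicator_dcube Q _).mul hF).aemeasurable]
  simp only [lintegral_mul_indicator_dcube hF]

lemma setLIntegral_sumFun (a : DIdx n → ℝ≥0∞) (S : Set (Bdry n)) :
    ∫⁻ x in S, sumFun a x = ∑' Q, a Q * volume (dcube Q ∩ S) := by
  simp only [sumFun]
  rw [lintegral_tsum fun Q => (measurable_indicator_dcube Q _).aemeasurable]
  refine tsum_congr fun Q => ?_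
  rw [lintegral_indicator_const (measurableSet_dcube Q),
    Measure.restrict_apply (measurableSet_dcube Q)]

/-- Duality between the sum and the supremum functional. -/
lemma tsum_mul_le_lintegral (a b : DIdx n → ℝ≥0∞) :
    ∑' Q, a Q * volume (dcube Q) * b Q ≤ ∫⁻ x, sumFun a x * supFun b x := by
  rw [lintegral_sumFun_mul a (measurable_supFun b)]
  refine ENNReal.tsum_le_tsum fun Q => ?_
  rw [mul_assoc]
  gcongr
  rw [mul_comm, ← setLIntegral_const]
  exact setLIntegral_mono' (measurableSet_dcube Q) fun x hx => le_supFun b hx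

/-- Hölder's inequality for the extended norms. -/
lemma lintegral_mul_le_eLpNorm_mul {α : Type*} [MeasurableSpace α] (μ : Measure α) {p p' : ℝ}
    (hp : p.HolderConjugate p') {F G : α → ℝ≥0∞} (hF : Measurable F) (hG : Measurable G) :
    ∫⁻ x, F x * G x ∂μ ≤ eLpNorm F (ENNReal.ofReal p) μ * eLpNorm G (ENNReal.ofReal p') μ := by
  rw [eLpNorm_ennreal μ hp.pos, eLpNorm_ennreal μ hp.symm.pos]
  exact ENNReal.lintegral_mul_le_Lp_mul_Lq μ hp hF.aemeasurable hG.aemeasurable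

/-- Passage to the limit in the norm along a directed family. -/
lemma eLpNorm_iSup_le {α ι : Type*} [MeasurableSpace α] (μ : Measure α) [Countable ι] {p : ℝ}
    (hp : 0 < p) {F : ι → α → ℝ≥0∞} (hF : ∀ i, Measurable (F i)) (hd : Directed (· ≤ ·) F)
    {K : ℝ≥0∞} (hK : ∀ i, eLpNorm (F i) (ENNReal.ofReal p) μ ≤ K) :
    eLpNorm (fun x => ⨆ i, F i x) (ENNReal.ofReal p) μ ≤ K := by
  have hp1 : 0 < 1 / p := by positivity
  have key : ∀ G : α → ℝ≥0∞, eLpNorm G (ENNReal.ofReal p) μ ≤ K ↔ ∫⁻ x, G x ^ p ∂μ ≤ K ^ p := by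
    intro G
    rw [eLpNorm_ennreal μ hp, ← ENNReal.rpow_le_rpow_iff hp, ← ENNReal.rpow_mul,
      one_div_mul_cancel hp.ne', ENNReal.rpow_one]
  rw [key]
  have h1 : ∀ x, (⨆ i, F i x) ^ p = ⨆ i, F i x ^ p := fun x =>
    (ENNReal.orderIsoRpow p hp).map_iSup _
  simp only [h1]
  rw [lintegral_iSup_directed (fun i => ((hF i).pow_const p).aemeasurable)]
  · exact iSup_le fun i => (key _).1 (hK i)
  · intro i j
    obtain ⟨k, hik, hjk⟩ := hd i j
    exact ⟨k, fun x => ENNReal.rpow_le_rpow (hik x) hp.le,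
      fun x => ENNReal.rpow_le_rpow (hjk x) hp.le⟩

/-- Division by I^{1/p'}, which is legitimate only because I is finite. This is the absorption step
of every duality argument below, and the reason why finite families of cubes are treated first. -/
lemma rpow_le_of_le_mul_rpow {p p' : ℝ} (hp : p.HolderConjugate p') {I K : ℝ≥0∞} (hI : I ≠ ∞)
    (h : I ≤ K * I ^ (1 / p')) : I ^ (1 / p) ≤ K := by
  have hp1 : 0 < 1 / p := one_div_pos.2 hp.pos
  have hp2 : 0 < 1 / p' := one_div_pos.2 hp.symm.pos
  rcases eq_or_ne I 0 with rfl | h0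
  · rw [ENNReal.zero_rpow_of_pos hp1]; exact zero_le
  have h3 : I = I ^ (1 / p) * I ^ (1 / p') := by
    rw [← ENNReal.rpow_add _ _ h0 hI, one_div, one_div, hp.inv_add_inv_eq_one, ENNReal.rpow_one]
  have h4 : I ^ (1 / p') ≠ 0 := by simp [ENNReal.rpow_eq_zero_iff, h0, hI]
  have h5 : I ^ (1 / p') ≠ ∞ := ENNReal.rpow_ne_top_of_nonneg hp2.le hI
  refine (ENNReal.mul_le_mul_iff_left h4 h5).1 ?_
  rwa [← h3]

/-- A function is controlled by `u` in `L_p` if it is so when tested against the maximal function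
of its own power. -/
lemma exists_eLpNorm_le_of_test (n : ℕ) {p p' : ℝ} (hp : p.HolderConjugate p') :
    ∃ C : ℝ≥0∞, C ≠ ∞ ∧ ∀ A u : Bdry n → ℝ≥0∞, Measurable A → Measurable u →
      eLpNorm A (ENNReal.ofReal p) volume ≠ ∞ →
      ∫⁻ x, A x * A x ^ (p - 1) ≤ ∫⁻ x, u x * hlMax volume (fun y => A y ^ (p - 1)) x →
      eLpNorm A (ENNReal.ofReal p) volume ≤ C * eLpNorm u (ENNReal.ofReal p) volume := by
  obtain ⟨C, hC, H⟩ := eLpNorm_hlMax_le (volume : Measure (Bdry n)) hp.symm.lt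
  refine ⟨C, hC, fun A u hA hu hfin htest => ?_⟩
  have hp1 : 0 < p - 1 := by linarith [hp.lt]
  have hpow : ∀ x, A x * A x ^ (p - 1) = A x ^ p := fun x => by
    conv_rhs => rw [show p = 1 + (p - 1) by ring,
      ENNReal.rpow_add_of_nonneg _ _ zero_le_one hp1.le, ENNReal.rpow_one]
  simp only [hpow] at htest
  have hAp : Measurable fun y => A y ^ (p - 1) := hA.pow_const _
  -- Since (p - 1)p' = p, the test function A^{p-1} has L_{p'} norm (∫ A^p)^{1/p'}.
  have h1 : eLpNorm (fun y => A y ^ (p - 1)) (ENNReal.ofReal p') volume =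
      (∫⁻ x, A x ^ p) ^ (1 / p') := by
    rw [eLpNorm_ennreal _ hp.symm.pos]
    simp only [← ENNReal.rpow_mul]
    rw [hp.sub_one_mul_conj]
  have hI : ∫⁻ x, A x ^ p ≠ ∞ := by
    intro h
    rw [eLpNorm_ennreal _ hp.pos, h] at hfin
    exact hfin (ENNReal.top_rpow_of_pos (one_div_pos.2 hp.pos))
  rw [eLpNorm_ennreal volume hp.pos A]
  refine rpow_le_of_le_mul_rpow hp hI (htest.trans ?_)
  refine (lintegral_mul_le_eLpNorm_mul volume hp hu (measurable_hlMax _ _)).trans ?_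
  rw [mul_comm C, mul_assoc]
  gcongr
  rw [← h1]
  exact H _ hAp

/-- Sums over a finite family of cubes are controlled by the Carleson functional over the union. -/
lemma sum_le_lintegral_carFun (a : DIdx n → ℝ≥0∞) (T : Finset (DIdx n)) :
    ∑ Q ∈ T, a Q * volume (dcube Q) ≤ ∫⁻ x in ⋃ Q ∈ T, dcube Q, carFun a x := by
  classical
  induction T using Finset.strongInduction with
  | H T ih =>
    rcases T.eq_empty_or_nonempty with rfl | hT
    · simp
    -- A cube of largest generation: by nesting, every other cube of T lies inside it or is disjoint
    -- from it. The cubes inside are paid for by the average at `Q₀` in the definition of `carFun`,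
    -- the others by induction.
    obtain ⟨Q₀, hQ₀, hmax⟩ := T.exists_max_image (fun Q => Q.1) hT
    set T' := T.filter fun Q => ¬ dcube Q ⊆ dcube Q₀ with hT'
    have hss : T' ⊂ T := Finset.filter_ssubset.2 ⟨Q₀, hQ₀, by simp⟩
    have hdisj : Disjoint (dcube Q₀) (⋃ Q ∈ T', dcube Q) := by
      rw [disjoint_iUnion₂_right]
      intro Q hQ
      rw [hT', Finset.mem_filter] at hQ
      rw [Set.disjoint_left]
      intro x hx hxQ
      exact hQ.2 (dcube_subset_of_mem hxQ hx (hmax Q hQ.1))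
    have h1 : ∑ Q ∈ T with dcube Q ⊆ dcube Q₀, a Q * volume (dcube Q) ≤
        ∫⁻ x in dcube Q₀, carFun a x := by
      calc ∑ Q ∈ T with dcube Q ⊆ dcube Q₀, a Q * volume (dcube Q)
          = ∑ Q ∈ T, if dcube Q ⊆ dcube Q₀ then a Q * volume (dcube Q) else 0 :=
            Finset.sum_filter _ _
        _ ≤ ∑' R, if dcube R ⊆ dcube Q₀ then a R * volume (dcube R) else 0 :=
            ENNReal.sum_le_tsum _
        _ = ∫⁻ _ in dcube Q₀, ((volume (dcube Q₀))⁻¹ *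
              ∑' R, if dcube R ⊆ dcube Q₀ then a R * volume (dcube R) else 0) := by
            rw [setLIntegral_const, mul_comm, ← mul_assoc,
              ENNReal.mul_inv_cancel (volume_dcube_ne_zero _) (volume_dcube_ne_top _), one_mul]
        _ ≤ _ := by
            refine setLIntegral_mono' (measurableSet_dcube _) fun x hx => ?_
            refine (le_supFun (fun Q => (volume (dcube Q))⁻¹ *
              ∑' R, if dcube R ⊆ dcube Q then a R * volume (dcube R) else 0) hx).trans_eq ?_
            rfl
    rw [← Finset.sum_filter_add_sum_filter_not T (fun Q => dcube Q ⊆ dcube Q₀)]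
    calc _ ≤ (∫⁻ x in dcube Q₀, carFun a x) + ∫⁻ x in ⋃ Q ∈ T', dcube Q, carFun a x :=
          add_le_add h1 (ih T' hss)
      _ = ∫⁻ x in dcube Q₀ ∪ ⋃ Q ∈ T', dcube Q, carFun a x := by
          rw [lintegral_union (Finset.measurableSet_biUnion _ fun Q _ => measurableSet_dcube Q) hdisj]
      _ ≤ _ := by
          refine lintegral_mono_set (union_subset (subset_biUnion_of_mem hQ₀) ?_)
          exact biUnion_subset_biUnion_left (Finset.filter_subset _ _)

/-- The Carleson embedding inequality. -/
lemma sum_mul_le_lintegral_carFun (a u : DIdx n → ℝ≥0∞) (S : Finset (DIdx n))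
    {U : Bdry n → ℝ≥0∞} (hU : Measurable U) (hu : ∀ Q, ∀ x ∈ dcube Q, u Q ≤ U x) :
    ∑ Q ∈ S, a Q * volume (dcube Q) * u Q ≤ ∫⁻ x, carFun a x * U x := by
  classical
  set G : S → ℝ≥0∞ := fun Q => a Q * volume (dcube Q.1) with hG
  -- The layer cake formula with exponent 1 on both sides, for counting measure on S and for
  -- Lebesgue measure, reduces the claim to one level s. There the cubes with u_Q > s are all
  -- contained in {U > s}, so the preceding inequality for unions applies.
  have h1 := lintegral_mul_rpow_layer (Measure.count : Measure S) one_pos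
    (measurable_of_countable fun Q : S => u Q) (measurable_of_countable G)
  have h2 := lintegral_mul_rpow_layer (volume : Measure (Bdry n)) one_pos hU (measurable_carFun a)
  simp only [ENNReal.rpow_one, ENNReal.ofReal_one, div_one] at h1 h2
  rw [h2]
  have h3 : ∑ Q ∈ S, a Q * volume (dcube Q) * u Q = ∫⁻ Q : S, G Q * u Q ∂Measure.count := by
    rw [lintegral_count, tsum_fintype, ← Finset.sum_coe_sort S]
  rw [h3, h1]
  refine lintegral_mono fun s => mul_le_mul_right ?_ _
  rw [← lintegral_indicator (measurableSet_lt measurable_const (measurable_of_countable _)),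
    lintegral_count, tsum_fintype]
  have h4 : ∑ Q : S, {Q : S | ENNReal.ofReal s < u Q}.indicator G Q =
      ∑ Q ∈ S with ENNReal.ofReal s < u Q, a Q * volume (dcube Q) := by
    rw [Finset.sum_filter, ← Finset.sum_coe_sort S]
    refine Finset.sum_congr rfl fun Q _ => ?_
    simp only [indicator, mem_ofPred_eq, hG]
  rw [h4]
  refine (sum_le_lintegral_carFun a _).trans (lintegral_mono_set ?_)
  refine iUnion₂_subset fun Q hQ x hx => ?_
  exact (Finset.mem_filter.1 hQ).2.trans_le (hu Q x hx)

/-- A finite sum `∑_{Q ∈ S, Q ∋ x} a_Q`. -/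
noncomputable def finSum (S : Finset (DIdx n)) (a : DIdx n → ℝ≥0∞) (x : Bdry n) : ℝ≥0∞ :=
  ∑ Q ∈ S, (dcube Q).indicator (fun _ => a Q) x

lemma measurable_finSum (S : Finset (DIdx n)) (a : DIdx n → ℝ≥0∞) : Measurable (finSum S a) :=
  Finset.measurable_fun_sum _ fun Q _ => measurable_indicator_dcube Q _

/-- The a priori finiteness that absorption requires; it is what the reduction to finite families
provides. -/
lemma eLpNorm_finSum_ne_top {p : ℝ} (hp : 1 < p) (S : Finset (DIdx n)) {a : DIdx n → ℝ≥0∞}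
    (ha : ∀ Q, a Q ≠ ∞) : eLpNorm (finSum S a) (ENNReal.ofReal p) volume ≠ ∞ := by
  have h1 : finSum S a = ∑ Q ∈ S, (dcube Q).indicator fun _ => a Q := by
    ext x; simp [finSum]
  rw [h1]
  refine ne_top_of_le_ne_top ?_ (eLpNorm_sum_le
    (fun Q _ => (measurable_indicator_dcube Q (a Q)).aestronglyMeasurable) (by simpa using hp.le))
  refine ENNReal.sum_ne_top.2 fun Q _ => ne_top_of_le_ne_top ?_ (eLpNorm_indicator_const_le _ _)
  exact ENNReal.mul_ne_top (ha Q) (ENNReal.rpow_ne_top_of_nonneg (by positivity)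
    (volume_dcube_ne_top Q))

lemma lintegral_finSum_mul (S : Finset (DIdx n)) (a : DIdx n → ℝ≥0∞) {F : Bdry n → ℝ≥0∞}
    (hF : Measurable F) : ∫⁻ x, finSum S a x * F x = ∑ Q ∈ S, a Q * ∫⁻ x in dcube Q, F x := by
  simp only [finSum, Finset.sum_mul]
  rw [lintegral_finsetSum (f := fun Q x => (dcube Q).indicator (fun _ => a Q) x * F x)
    _ fun Q _ => (measurable_indicator_dcube Q _).mul hF]
  simp only [lintegral_mul_indicator_dcube hF]

/-- The sum functional is controlled by the Carleson functional. -/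
lemma exists_eLpNorm_sumFun_le (n : ℕ) {p p' : ℝ} (hp : p.HolderConjugate p') :
    ∃ C : ℝ≥0∞, C ≠ ∞ ∧ ∀ a : DIdx n → ℝ≥0∞, (∀ Q, a Q ≠ ∞) →
      eLpNorm (sumFun a) (ENNReal.ofReal p) volume ≤
        C * eLpNorm (carFun a) (ENNReal.ofReal p) volume := by
  obtain ⟨c₀, hc₀, H₀⟩ := exists_lintegral_dcube_le n
  obtain ⟨C, hC, H⟩ := exists_eLpNorm_le_of_test n hp
  refine ⟨C * c₀, ENNReal.mul_ne_top hC hc₀, fun a ha => ?_⟩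
  have hsum : sumFun a = fun x => ⨆ S : Finset (DIdx n), finSum S a x := by
    ext x
    exact ENNReal.tsum_eq_iSup_sum
  rw [hsum]
  refine eLpNorm_iSup_le volume hp.pos (fun S => measurable_finSum S a) ?_ fun S => ?_
  · exact Monotone.directed_le fun S T hST x => Finset.sum_le_sum_of_subset hST
  have hA := measurable_finSum S a
  have hu : Measurable fun x => c₀ * carFun a x := (measurable_carFun a).const_mul _
  refine (H (finSum S a) (fun x => c₀ * carFun a x) hA hu
    (eLpNorm_finSum_ne_top hp.lt S ha) ?_).trans ?_
  · rw [lintegral_finSum_mul S a (hA.pow_const _)]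
    -- The average of A^{p-1} over Q is at most a constant times its maximal function at each point
    -- of Q, so the Carleson embedding applies with this maximal function as majorant.
    set u : DIdx n → ℝ≥0∞ := fun Q => (volume (dcube Q))⁻¹ *
      ∫⁻ x in dcube Q, finSum S a x ^ (p - 1) with hu
    have hM := measurable_hlMax (volume : Measure (Bdry n)) fun y => finSum S a y ^ (p - 1)
    calc ∑ Q ∈ S, a Q * ∫⁻ x in dcube Q, finSum S a x ^ (p - 1)
        = ∑ Q ∈ S, a Q * volume (dcube Q) * u Q := by
          refine Finset.sum_congr rfl fun Q _ => ?_
          rw [hu, mul_assoc, ← mul_assoc (volume (dcube Q)),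
            ENNReal.mul_inv_cancel (volume_dcube_ne_zero _) (volume_dcube_ne_top _), one_mul]
      _ ≤ ∫⁻ x, carFun a x * (c₀ * hlMax volume (fun y => finSum S a y ^ (p - 1)) x) := by
          refine sum_mul_le_lintegral_carFun a u S (hM.const_mul _) fun Q x hx => ?_
          rw [hu]
          have h1 := H₀ (fun y => finSum S a y ^ (p - 1)) Q x hx
          calc (volume (dcube Q))⁻¹ * ∫⁻ x in dcube Q, finSum S a x ^ (p - 1)
              ≤ (volume (dcube Q))⁻¹ * (c₀ * volume (dcube Q) *
                hlMax volume (fun y => finSum S a y ^ (p - 1)) x) := by gcongr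
            _ = (volume (dcube Q))⁻¹ * volume (dcube Q) *
                (c₀ * hlMax volume (fun y => finSum S a y ^ (p - 1)) x) := by ring
            _ = _ := by
                rw [ENNReal.inv_mul_cancel (volume_dcube_ne_zero _) (volume_dcube_ne_top _),
                  one_mul]
      _ = _ := lintegral_congr fun x => by ring
  · rw [mul_assoc]
    gcongr
    rw [eLpNorm_ennreal _ hp.pos, eLpNorm_ennreal _ hp.pos]
    simp only [ENNReal.mul_rpow_of_nonneg _ _ hp.pos.le]
    rw [lintegral_const_mul _ ((measurable_carFun a).pow_const _),
      ENNReal.mul_rpow_of_nonneg _ _ (one_div_nonneg.2 hp.pos.le), ← ENNReal.rpow_mul,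
      mul_one_div_cancel hp.pos.ne', ENNReal.rpow_one]

/-- A finite supremum `sup_{Q ∈ S, Q ∋ x} b_Q`. -/
noncomputable def finSup (S : Finset (DIdx n)) (b : DIdx n → ℝ≥0∞) (x : Bdry n) : ℝ≥0∞ :=
  S.sup fun Q => (dcube Q).indicator (fun _ => b Q) x

lemma measurable_finSup (S : Finset (DIdx n)) (b : DIdx n → ℝ≥0∞) : Measurable (finSup S b) := by
  have : finSup S b = fun x => ⨆ Q ∈ S, (dcube Q).indicator (fun _ => b Q) x := by
    ext x; simp only [finSup, Finset.sup_eq_iSup]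
  rw [this]
  exact Measurable.biSup _ S.countable_toSet fun Q _ => measurable_indicator_dcube Q _

/-- Linearization of a finite supremum. -/
lemma exists_finSup_eq_sum (S : Finset (DIdx n)) (b : DIdx n → ℝ≥0∞) :
    ∃ E : DIdx n → Set (Bdry n), (∀ Q, MeasurableSet (E Q)) ∧ (∀ Q, E Q ⊆ dcube Q) ∧
      (S : Set (DIdx n)).PairwiseDisjoint E ∧
      ∀ x, finSup S b x = ∑ Q ∈ S, (E Q).indicator (fun _ => b Q) x := by
  classical
  induction S using Finset.induction_on with
  | empty => exact ⟨fun _ => ∅, by simp, by simp, by simp, by simp [finSup]⟩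
  | insert Q₀ S hQ₀ ih =>
    obtain ⟨E, hE, hEQ, hdisj, hsup⟩ := ih
    -- The part of the new cube on which its value beats the old supremum; it is given to the new
    -- cube and removed from all the old sets.
    set B : Set (Bdry n) := dcube Q₀ ∩ {x | finSup S b x < b Q₀} with hB
    have hBm : MeasurableSet B :=
      (measurableSet_dcube Q₀).inter (measurableSet_lt (measurable_finSup S b) measurable_const)
    have hne : ∀ Q ∈ S, Q ≠ Q₀ := fun Q hQ h => hQ₀ (h ▸ hQ)
    refine ⟨fun Q => if Q = Q₀ then B else E Q \ B, ?_, ?_, ?_, ?_⟩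
    · intro Q
      dsimp only
      split_ifs
      exacts [hBm, (hE Q).diff hBm]
    · intro Q
      dsimp only
      split_ifs with h
      · rw [h]; exact inter_subset_left
      · exact sdiff_subset.trans (hEQ Q)
    · rw [Finset.coe_insert, pairwiseDisjoint_insert]
      refine ⟨?_, fun Q hQ hQ' => ?_⟩
      · intro Q hQ R hR hQR
        simp only [Function.onFun, if_neg (hne Q hQ), if_neg (hne R hR)]
        exact (hdisj hQ hR hQR).mono sdiff_subset sdiff_subset
      · simp only [if_true, if_neg (hne Q hQ)]
        exact disjoint_sdiff_right
    · intro x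
      rw [Finset.sum_insert hQ₀]
      simp only [if_true]
      have h1 : ∀ Q ∈ S, (if Q = Q₀ then B else E Q \ B).indicator (fun _ => b Q) x =
          if x ∈ B then 0 else (E Q).indicator (fun _ => b Q) x := by
        intro Q hQ
        rw [if_neg (hne Q hQ)]
        by_cases hx : x ∈ B <;> simp [indicator, hx]
      rw [Finset.sum_congr rfl h1]
      have h2 : finSup (insert Q₀ S) b x =
          (dcube Q₀).indicator (fun _ => b Q₀) x ⊔ finSup S b x := Finset.sup_insert
      rw [h2]
      by_cases hx : x ∈ B
      · simp only [hx, if_true, Finset.sum_const_zero, add_zero, indicator_of_mem hx.1,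
          indicator_of_mem hx]
        exact sup_eq_left.2 hx.2.le
      · simp only [hx, if_false, ← hsup x, indicator_of_notMem hx, zero_add]
        refine sup_eq_right.2 ?_
        by_cases hx1 : x ∈ dcube Q₀
        · rw [indicator_of_mem hx1]
          exact not_lt.1 fun h => hx ⟨hx1, h⟩
        · simp [hx1]

/-- Control of the supremum functional by testing against finite sequences. -/
lemma exists_eLpNorm_supFun_le (n : ℕ) {p p' : ℝ} (hp : p.HolderConjugate p') :
    ∃ C : ℝ≥0∞, C ≠ ∞ ∧ ∀ (b : DIdx n → ℝ≥0∞) (K : ℝ≥0∞), (∀ Q, b Q ≠ ∞) →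
      (∀ (S : Finset (DIdx n)) (v : DIdx n → ℝ≥0∞), (∀ Q, v Q ≠ ∞) →
        ∑ Q ∈ S, v Q * volume (dcube Q) * b Q ≤
          K * eLpNorm (finSum S v) (ENNReal.ofReal p) volume) →
      eLpNorm (supFun b) (ENNReal.ofReal p') volume ≤ C * K := by
  obtain ⟨c₀, hc₀, H₀⟩ := exists_lintegral_dcube_le n
  obtain ⟨C, hC, H⟩ := exists_eLpNorm_le_of_test n hp
  refine ⟨C * c₀, ENNReal.mul_ne_top hC hc₀, fun b K hb htest => ?_⟩
  have hp'1 : 0 < p' - 1 := by linarith [hp.symm.lt]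
  have hp1 : 0 < p - 1 := by linarith [hp.lt]
  have hsup : supFun b = fun x => ⨆ S : Finset (DIdx n), finSup S b x := by
    ext x
    simp only [finSup, Finset.sup_eq_iSup, supFun]
    refine le_antisymm (iSup_le fun Q => le_iSup_of_le {Q} (by simp)) ?_
    exact iSup_le fun S => iSup₂_le fun Q _ => le_iSup_of_le Q le_rfl
  rw [hsup]
  refine eLpNorm_iSup_le volume hp.symm.pos (fun S => measurable_finSup S b) ?_ fun S => ?_
  · exact Monotone.directed_le fun S T hST x => Finset.sup_mono hST
  obtain ⟨E, hE, hEQ, hdisj, hlin⟩ := exists_finSup_eq_sum S b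
  have hm := measurable_finSup S b
  -- The extremal function for the duality of L_{p'} and L_p: as (p' - 1)p = p', its p-th power is
  -- the p'-th power of the supremum.
  set h : Bdry n → ℝ≥0∞ := fun x => finSup S b x ^ (p' - 1) with hh
  have hhm : Measurable h := hm.pow_const _
  have hle : ∀ x, finSup S b x ≤ finSum S b x := fun x =>
    Finset.sup_le fun Q hQ => Finset.single_le_sum (f := fun Q => (dcube Q).indicator
      (fun _ => b Q) x) (fun _ _ => zero_le) hQ
  have hSfin : ∫⁻ x, finSup S b x ^ p' ≠ ∞ := by
    have h1 := eLpNorm_finSum_ne_top hp.symm.lt S hb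
    rw [eLpNorm_ennreal _ hp.symm.pos] at h1
    have h2 : ∫⁻ x, finSum S b x ^ p' ≠ ∞ := by
      intro h
      rw [h] at h1
      exact h1 (ENNReal.top_rpow_of_pos (one_div_pos.2 hp.symm.pos))
    exact ne_top_of_le_ne_top h2 (lintegral_mono fun x =>
      ENNReal.rpow_le_rpow (hle x) hp.symm.pos.le)
  have hnorm : eLpNorm h (ENNReal.ofReal p) volume = (∫⁻ x, finSup S b x ^ p') ^ (1 / p) := by
    rw [eLpNorm_ennreal _ hp.pos]
    simp only [hh, ← ENNReal.rpow_mul]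
    rw [hp.symm.sub_one_mul_conj]
  -- Chosen with v_Q |Q| = ∫_{E_Q} h, so that ∑ v_Q |Q| b_Q is exactly the integral of the p'-th
  -- power of the supremum.
  set v : DIdx n → ℝ≥0∞ := fun Q => (volume (dcube Q))⁻¹ * ∫⁻ x in E Q, h x with hv
  have hvfin : ∀ Q, v Q ≠ ∞ := by
    intro Q
    refine ENNReal.mul_ne_top (ENNReal.inv_ne_top.2 (volume_dcube_ne_zero Q)) ?_
    have hbd : ∀ x, h x ≤ (∑ Q ∈ S, b Q) ^ (p' - 1) := fun x => by
      refine ENNReal.rpow_le_rpow ((hle x).trans (Finset.sum_le_sum fun Q _ => ?_)) hp'1.le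
      exact indicator_le_self' (fun _ _ => zero_le) x
    refine ne_top_of_le_ne_top ?_ (lintegral_mono (μ := volume.restrict (E Q)) hbd)
    rw [setLIntegral_const]
    refine ENNReal.mul_ne_top (ENNReal.rpow_ne_top_of_nonneg hp'1.le
      (ENNReal.sum_ne_top.2 fun Q _ => hb Q)) ?_
    exact ne_top_of_le_ne_top (volume_dcube_ne_top Q) (measure_mono (hEQ Q))
  have hvvol : ∀ Q, v Q * volume (dcube Q) = ∫⁻ x in E Q, h x := fun Q => by
    rw [hv, mul_comm, ← mul_assoc,
      ENNReal.mul_inv_cancel (volume_dcube_ne_zero _) (volume_dcube_ne_top _), one_mul]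
  have hA := measurable_finSum S v
  -- A bound for the adjoint of the linearized maximal operator. In the test against A^{p-1} the
  -- average over Q is moved onto E_Q ⊆ Q, where the maximal function dominates it; disjointness of
  -- the sets E_Q then allows summation.
  have hAnorm : eLpNorm (finSum S v) (ENNReal.ofReal p) volume ≤
      C * (c₀ * eLpNorm h (ENNReal.ofReal p) volume) := by
    have hM := measurable_hlMax (volume : Measure (Bdry n)) fun y => finSum S v y ^ (p - 1)
    refine (H (finSum S v) (fun x => c₀ * h x) hA (hhm.const_mul _)
      (eLpNorm_finSum_ne_top hp.lt S hvfin) ?_).trans ?_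
    · rw [lintegral_finSum_mul S v (hA.pow_const _)]
      calc ∑ Q ∈ S, v Q * ∫⁻ x in dcube Q, finSum S v x ^ (p - 1)
          ≤ ∑ Q ∈ S, ∫⁻ x in E Q, c₀ * h x *
              hlMax volume (fun y => finSum S v y ^ (p - 1)) x := by
            refine Finset.sum_le_sum fun Q _ => ?_
            rw [hv, mul_comm, ← mul_assoc, mul_comm, ← lintegral_mul_const _ hhm]
            refine setLIntegral_mono' (hE Q) fun x hx => ?_
            have h1 := H₀ (fun y => finSum S v y ^ (p - 1)) Q x (hEQ Q hx)
            calc h x * ((∫⁻ x in dcube Q, finSum S v x ^ (p - 1)) * (volume (dcube Q))⁻¹)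
                ≤ h x * (c₀ * volume (dcube Q) *
                  hlMax volume (fun y => finSum S v y ^ (p - 1)) x * (volume (dcube Q))⁻¹) := by
                  gcongr
              _ = c₀ * h x * hlMax volume (fun y => finSum S v y ^ (p - 1)) x *
                  (volume (dcube Q) * (volume (dcube Q))⁻¹) := by ring
              _ = _ := by
                  rw [ENNReal.mul_inv_cancel (volume_dcube_ne_zero _) (volume_dcube_ne_top _),
                    mul_one]
        _ = ∫⁻ x in ⋃ Q ∈ S, E Q, c₀ * h x *
              hlMax volume (fun y => finSum S v y ^ (p - 1)) x :=
            (lintegral_biUnion_finset hdisj (fun Q _ => hE Q) _).symm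
        _ ≤ _ := setLIntegral_le_lintegral _ _
    · gcongr
      rw [eLpNorm_ennreal _ hp.pos, eLpNorm_ennreal _ hp.pos]
      simp only [ENNReal.mul_rpow_of_nonneg _ _ hp.pos.le]
      rw [lintegral_const_mul _ (hhm.pow_const _),
        ENNReal.mul_rpow_of_nonneg _ _ (one_div_nonneg.2 hp.pos.le), ← ENNReal.rpow_mul,
        mul_one_div_cancel hp.pos.ne', ENNReal.rpow_one]
  have hmain : ∫⁻ x, finSup S b x ^ p' ≤ C * c₀ * K * (∫⁻ x, finSup S b x ^ p') ^ (1 / p) := by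
    calc ∫⁻ x, finSup S b x ^ p' = ∫⁻ x, ∑ Q ∈ S, (E Q).indicator (fun x => b Q * h x) x := by
          refine lintegral_congr fun x => ?_
          have h1 : finSup S b x ^ p' = finSup S b x * h x := by
            rw [hh]
            conv_lhs => rw [show p' = 1 + (p' - 1) by ring,
              ENNReal.rpow_add_of_nonneg _ _ zero_le_one hp'1.le, ENNReal.rpow_one]
          rw [h1, hlin x, Finset.sum_mul]
          refine Finset.sum_congr rfl fun Q _ => ?_
          simp only [indicator]
          split_ifs <;> simp
      _ = ∑ Q ∈ S, v Q * volume (dcube Q) * b Q := by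
          rw [lintegral_finsetSum _ fun Q _ => (hhm.const_mul _).indicator (hE Q)]
          refine Finset.sum_congr rfl fun Q _ => ?_
          rw [lintegral_indicator (hE Q), lintegral_const_mul _ hhm, hvvol, mul_comm]
      _ ≤ K * eLpNorm (finSum S v) (ENNReal.ofReal p) volume := htest S v hvfin
      _ ≤ K * (C * (c₀ * eLpNorm h (ENNReal.ofReal p) volume)) := by gcongr
      _ = _ := by rw [hnorm]; ring
  rw [eLpNorm_ennreal _ hp.symm.pos]
  exact rpow_le_of_le_mul_rpow hp.symm hSfin hmain

end

/-! ### Whitney boxes and averages over them -/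

lemma rpow_tsum_le_tsum_rpow {ι : Type*} (x : ι → ℝ≥0∞) {r : ℝ} (hr : 0 < r) (hr1 : r ≤ 1) :
    (∑' i, x i) ^ r ≤ ∑' i, x i ^ r := by
  rw [ENNReal.tsum_eq_iSup_sum]
  have h1 : (⨆ s : Finset ι, ∑ i ∈ s, x i) ^ r = ⨆ s : Finset ι, (∑ i ∈ s, x i) ^ r :=
    (ENNReal.orderIsoRpow r hr).map_iSup _
  rw [h1]
  refine iSup_le fun s => le_trans ?_ (ENNReal.sum_le_tsum s)
  exact Finset.le_sum_of_subadditive (fun y : ℝ≥0∞ => y ^ r) (by simp [hr])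
    (fun a b => ENNReal.rpow_add_le_add_rpow a b hr.le hr1) s x

lemma lintegral_iUnion_le_tsum {α ι : Type*} [MeasurableSpace α] [Countable ι] (μ : Measure α)
    (T : ι → Set α) (F : α → ℝ≥0∞) :
    ∫⁻ x in ⋃ i, T i, F x ∂μ ≤ ∑' i, ∫⁻ x in T i, F x ∂μ := by
  rw [← lintegral_sum_measure]
  exact lintegral_mono' Measure.restrict_iUnion_le le_rfl

section

variable {n : ℕ} {𝕜 : Type*} [RCLike 𝕜]

/-- The normalized `L_q` norm over a set. -/
noncomputable def avgNorm (q : ℝ) (f : Amb n → 𝕜) (S : Set (Amb n)) : ℝ≥0∞ :=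
  volume S ^ (-(1 / q)) * eLpNorm f (ENNReal.ofReal q) (volume.restrict S)

lemma avgNorm_eq {q : ℝ} (hq : 1 < q) (f : Amb n → 𝕜) (S : Set (Amb n)) :
    avgNorm q f S = ((volume S)⁻¹ * ∫⁻ a in S, ‖f a‖ₑ ^ q) ^ (1 / q) := by
  have hq0 : 0 < q := by linarith
  rw [avgNorm, eLpNorm_eq_lintegral_rpow_enorm_toReal (by simpa using hq0) ENNReal.ofReal_ne_top,
    ENNReal.toReal_ofReal hq0.le, ENNReal.mul_rpow_of_nonneg _ _ (by positivity),
    ENNReal.inv_rpow, ENNReal.rpow_neg]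

/-- Change of region in a normalized L_q norm: S need only be covered by sets not much larger than
itself. Subadditivity of the power 1/q ≤ 1 replaces any count of overlaps. -/
lemma avgNorm_le_tsum {q : ℝ} (hq : 1 < q) (f : Amb n → 𝕜) {ι : Type*} [Countable ι]
    {S : Set (Amb n)} {T : ι → Set (Amb n)} {M : ℝ≥0∞} (hST : S ⊆ ⋃ i, T i)
    (hM : ∀ i, (volume S)⁻¹ ≤ M * (volume (T i))⁻¹) :
    avgNorm q f S ≤ M ^ (1 / q) * ∑' i, avgNorm q f (T i) := by
  have hq0 : 0 < 1 / q := by positivity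
  have hq1 : 1 / q ≤ 1 := by rw [div_le_one (by linarith)]; exact hq.le
  simp only [avgNorm_eq hq]
  calc ((volume S)⁻¹ * ∫⁻ a in S, ‖f a‖ₑ ^ q) ^ (1 / q)
      ≤ (M * ∑' i, (volume (T i))⁻¹ * ∫⁻ a in T i, ‖f a‖ₑ ^ q) ^ (1 / q) := by
        refine ENNReal.rpow_le_rpow ?_ hq0.le
        calc (volume S)⁻¹ * ∫⁻ a in S, ‖f a‖ₑ ^ q
            ≤ (volume S)⁻¹ * ∑' i, ∫⁻ a in T i, ‖f a‖ₑ ^ q := by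
              gcongr
              exact (lintegral_mono_set hST).trans (lintegral_iUnion_le_tsum _ _ _)
          _ = ∑' i, (volume S)⁻¹ * ∫⁻ a in T i, ‖f a‖ₑ ^ q := ENNReal.tsum_mul_left.symm
          _ ≤ ∑' i, M * ((volume (T i))⁻¹ * ∫⁻ a in T i, ‖f a‖ₑ ^ q) := by
              refine ENNReal.tsum_le_tsum fun i => ?_
              rw [← mul_assoc]
              gcongr
              exact hM i
          _ = _ := ENNReal.tsum_mul_left
    _ = M ^ (1 / q) * (∑' i, (volume (T i))⁻¹ * ∫⁻ a in T i, ‖f a‖ₑ ^ q) ^ (1 / q) :=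
        ENNReal.mul_rpow_of_nonneg _ _ hq0.le
    _ ≤ _ := by
        gcongr
        exact rpow_tsum_le_tsum_rpow _ hq0 hq1

lemma avgNorm_mono_set {q : ℝ} (hq : 1 < q) (f : Amb n → 𝕜) {S T : Set (Amb n)} {M : ℝ≥0∞}
    (hST : S ⊆ T) (hM : (volume S)⁻¹ ≤ M * (volume T)⁻¹) :
    avgNorm q f S ≤ M ^ (1 / q) * avgNorm q f T := by
  have h := avgNorm_le_tsum hq f (ι := Unit) (T := fun _ => T) (S := S)
    (hST.trans (subset_iUnion (fun _ : Unit => T) ())) fun _ => hM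
  rwa [tsum_fintype, Fintype.sum_unique] at h

/-- The box `[c ℓ(Q), 2 c ℓ(Q)) × Q`. -/
def slab (c : ℝ) (Q : DIdx n) : Set (Amb n) := Ico (c * side Q) (2 * (c * side Q)) ×ˢ dcube Q

/-- The dyadic Whitney box `[2 ℓ(Q), 4 ℓ(Q)) × Q`. -/
def box (Q : DIdx n) : Set (Amb n) := slab 2 Q

lemma measurableSet_slab (c : ℝ) (Q : DIdx n) : MeasurableSet (slab c Q) :=
  measurableSet_Ico.prod (measurableSet_dcube Q)

lemma measurableSet_box (Q : DIdx n) : MeasurableSet (box Q) := measurableSet_slab 2 Q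

lemma mem_box_iff {Q : DIdx n} {a : Amb n} :
    a ∈ box Q ↔ 2 * side Q ≤ a.1 ∧ a.1 < 4 * side Q ∧ a.2 ∈ dcube Q := by
  rw [box, slab, mem_prod, mem_Ico, and_assoc, show 2 * (2 * side Q) = 4 * side Q by ring]

/-- The height of a point lies in exactly one interval [c 2^k, c 2^{k+1}), which fixes the
generation. It is needed for c = 2 (the Whitney boxes) and for c = 3 (the raised boxes on which W_q
f is integrated). -/
lemma slab_eq_of_mem {c : ℝ} (hc : 0 < c) {Q R : DIdx n} {a : Amb n} (hQ : a ∈ slab c Q)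
    (hR : a ∈ slab c R) : Q = R := by
  refine dcube_eq_of_mem hQ.2 hR.2 ?_
  have key : ∀ {Q R : DIdx n}, a ∈ slab c Q → a ∈ slab c R → Q.1 ≤ R.1 := by
    intro Q R hQ hR
    have h1 : side Q < 2 * side R := by
      have := hQ.1.1.trans_lt hR.1.2
      rw [mul_left_comm] at this
      exact lt_of_mul_lt_mul_left this hc.le
    have h2 : 2 * side R = 2 ^ (R.1 + 1) := by
      rw [side, zpow_add₀ (by norm_num), zpow_one, mul_comm]
    rw [h2, side, zpow_lt_zpow_iff_right₀ (by norm_num)] at h1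
    exact Int.lt_add_one_iff.1 h1
  exact le_antisymm (key hQ hR) (key hR hQ)

lemma pairwise_disjoint_slab {c : ℝ} (hc : 0 < c) :
    Pairwise (Function.onFun Disjoint (slab c : DIdx n → Set (Amb n))) := by
  intro Q R hQR
  exact Set.disjoint_left.2 fun a hQ hR => hQR (slab_eq_of_mem hc hQ hR)

lemma pairwise_disjoint_box : Pairwise (Function.onFun Disjoint (box : DIdx n → Set (Amb n))) :=
  pairwise_disjoint_slab two_pos

lemma box_subset_upper (Q : DIdx n) : box Q ⊆ upper n := fun a ha => by
  have := side_pos Q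
  have h1 := (mem_box_iff.1 ha).1
  show 0 < a.1
  linarith

lemma exists_mem_box {a : Amb n} (ha : a ∈ upper n) : ∃ Q : DIdx n, a ∈ box Q := by
  have ha' : 0 < a.1 := ha
  obtain ⟨k, hk1, hk2⟩ := exists_mem_Ico_zpow (half_pos ha') (one_lt_two : (1 : ℝ) < 2)
  refine ⟨(k, fun i => ⌊a.2 i / 2 ^ k⌋), mem_box_iff.2 ⟨?_, ?_, mem_dcube_floor k a.2⟩⟩
  · rw [side]; linarith
  · rw [zpow_add₀ (by norm_num), zpow_one] at hk2
    rw [side]; linarith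

lemma iUnion_box : ⋃ Q : DIdx n, box Q = upper n :=
  subset_antisymm (iUnion_subset box_subset_upper) fun _ ha => mem_iUnion.2 (exists_mem_box ha)

lemma volume_prod_amb (s : Set ℝ) (t : Set (Bdry n)) :
    volume (s ×ˢ t : Set (Amb n)) = volume s * volume t := by
  rw [Measure.volume_eq_prod, Measure.prod_prod]

lemma volume_slab (c : ℝ) (Q : DIdx n) :
    volume (slab c Q) = ENNReal.ofReal (c * side Q) * volume (dcube Q) := by
  rw [slab, volume_prod_amb, Real.volume_Ico]
  congr 2; ring

lemma volume_box (Q : DIdx n) :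
    volume (box Q) = ENNReal.ofReal (2 * side Q) * volume (dcube Q) := volume_slab 2 Q

lemma volume_box_ne_zero (Q : DIdx n) : volume (box Q) ≠ 0 := by
  rw [volume_box]
  exact mul_ne_zero (by simpa using side_pos Q) (volume_dcube_ne_zero Q)

lemma volume_box_ne_top (Q : DIdx n) : volume (box Q) ≠ ∞ := by
  rw [volume_box]
  exact ENNReal.mul_ne_top ENNReal.ofReal_ne_top (volume_dcube_ne_top Q)

lemma volume_whitneyRegion (a : Amb n) :
    volume (whitneyRegion a) = ENNReal.ofReal (a.1 / 2) * ENNReal.ofReal a.1 ^ n := by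
  rw [whitneyRegion, volume_prod_amb, Real.volume_Ioo, volume_cube]
  congr 2; ring

/-- The normalized `L_q` norm over a dyadic Whitney box. -/
noncomputable def coef (q : ℝ) (f : Amb n → 𝕜) (Q : DIdx n) : ℝ≥0∞ := avgNorm q f (box Q)

/-- Each half of a Whitney box lies in the Whitney region of every point a little above it, so W_q f
dominates the average over that half on a set of comparable measure inside `slab 3 Q`. -/
lemma exists_coef_le (n : ℕ) {q : ℝ} (hq : 1 < q) : ∃ C : ℝ≥0∞, C ≠ ∞ ∧
    ∀ (f : Amb n → 𝕜) (Q : DIdx n),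
      volume (box Q) * coef q f Q ≤ C * ∫⁻ a in slab 3 Q, whitneyAvg q f a := by
  have hq0 : 0 < 1 / q := by positivity
  -- At heights below 5ℓ(Q) a Whitney region has measure at most 3 · 6^n ℓ(Q)|Q|. The further factor
  -- 4 is the number of halves times the ratio of the measures of the box and of a half.
  set M : ℝ≥0∞ := ENNReal.ofReal 3 * ENNReal.ofReal 6 ^ n with hM
  have hMfin : M ^ (1 / q) ≠ ∞ := ENNReal.rpow_ne_top_of_nonneg hq0.le
    (ENNReal.mul_ne_top ENNReal.ofReal_ne_top (ENNReal.pow_ne_top ENNReal.ofReal_ne_top))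
  refine ⟨4 * M ^ (1 / q), ENNReal.mul_ne_top (by simp) hMfin, fun f Q => ?_⟩
  have hs := side_pos Q
  -- The whole box does not fit into the Whitney regions of a set of positive measure, since t/2 ≤
  -- 2ℓ and t ≥ 4ℓ force t = 4ℓ. Hence the cut at height 3ℓ; `U j` collects points whose Whitney
  -- regions contain `V j`.
  set V : Bool → Set (Amb n) := fun j =>
    Ico ((if j then 3 else 2) * side Q) ((if j then 4 else 3) * side Q) ×ˢ dcube Q with hV
  set U : Bool → Set (Amb n) := fun j =>
    Ico ((if j then 4 else 3) * side Q) ((if j then 5 else 4) * side Q) ×ˢ dcube Q with hU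
  have hVvol : ∀ j, volume (V j) = ENNReal.ofReal (side Q) * volume (dcube Q) := by
    intro j
    rw [hV, volume_prod_amb, Real.volume_Ico]
    congr 2
    cases j <;> simp <;> ring
  have hUvol : ∀ j, volume (U j) = ENNReal.ofReal (side Q) * volume (dcube Q) := by
    intro j
    rw [hU, volume_prod_amb, Real.volume_Ico]
    congr 2
    cases j <;> simp <;> ring
  have hbox : volume (box Q) = 2 * (ENNReal.ofReal (side Q) * volume (dcube Q)) := by
    rw [volume_box, ENNReal.ofReal_mul zero_le_two, ENNReal.ofReal_ofNat, mul_assoc]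
  have h1 : coef q f Q ≤ ∑' j, avgNorm q f (V j) := by
    have h := avgNorm_le_tsum hq f (S := box Q) (T := V) (M := 1) ?_ ?_
    · rwa [ENNReal.one_rpow, one_mul] at h
    · intro a ha
      obtain ⟨h1, h2, h3⟩ := mem_box_iff.1 ha
      rw [mem_iUnion]
      rcases lt_or_ge a.1 (3 * side Q) with h | h
      · exact ⟨false, ⟨by simpa using h1, by simpa using h⟩, h3⟩
      · exact ⟨true, ⟨by simpa using h, by simpa using h2⟩, h3⟩
    · intro j
      rw [one_mul, ENNReal.inv_le_inv, hVvol, hbox, two_mul]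
      exact le_self_add
  have h2 : ∀ j, ∀ a ∈ U j, avgNorm q f (V j) ≤ M ^ (1 / q) * whitneyAvg q f a := by
    intro j a ha
    have hlow : 3 * side Q ≤ a.1 := by
      have := ha.1.1
      cases j <;> simp at this <;> linarith
    have hup : a.1 < 5 * side Q := by
      have := ha.1.2
      cases j <;> simp at this <;> linarith
    refine avgNorm_mono_set hq f (fun b hb => ⟨⟨?_, ?_⟩, fun i => ?_⟩) ?_
    · have h1 := hb.1.1
      have h2 := ha.1.2
      cases j <;> simp at h1 h2 <;> linarith
    · have h1 := hb.1.2
      have h2 := ha.1.1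
      cases j <;> simp at h1 h2 <;> linarith
    · have := abs_sub_lt_side hb.2 ha.2 i
      linarith
    · rw [hVvol, volume_whitneyRegion]
      have h3 : ENNReal.ofReal (a.1 / 2) * ENNReal.ofReal a.1 ^ n ≤
          M * (ENNReal.ofReal (side Q) * volume (dcube Q)) := by
        calc ENNReal.ofReal (a.1 / 2) * ENNReal.ofReal a.1 ^ n
            ≤ ENNReal.ofReal (3 * side Q) * ENNReal.ofReal (6 * side Q) ^ n := by
              gcongr <;> linarith
          _ = _ := by
              rw [ENNReal.ofReal_mul (by norm_num), ENNReal.ofReal_mul (by norm_num), mul_pow,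
                volume_dcube, hM]
              ring
      have hM0 : M ≠ 0 := mul_ne_zero (by simp) (pow_ne_zero _ (by simp))
      have hM1 : M ≠ ∞ :=
        ENNReal.mul_ne_top ENNReal.ofReal_ne_top (ENNReal.pow_ne_top ENNReal.ofReal_ne_top)
      calc (ENNReal.ofReal (side Q) * volume (dcube Q))⁻¹
          = M * (M * (ENNReal.ofReal (side Q) * volume (dcube Q)))⁻¹ := by
            rw [ENNReal.mul_inv (Or.inl hM0) (Or.inl hM1), ← mul_assoc,
              ENNReal.mul_inv_cancel hM0 hM1, one_mul]
        _ ≤ _ := by gcongr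
  have h3 : ∀ j, volume (V j) * avgNorm q f (V j) ≤
      M ^ (1 / q) * ∫⁻ a in slab 3 Q, whitneyAvg q f a := by
    intro j
    have hUm : MeasurableSet (U j) := measurableSet_Ico.prod (measurableSet_dcube Q)
    rw [hVvol, ← hUvol j, mul_comm, ← setLIntegral_const]
    refine (setLIntegral_mono' hUm (h2 j)).trans ?_
    rw [lintegral_const_mul' _ _ hMfin]
    gcongr
    rintro a ⟨⟨h1, h2⟩, h3⟩
    refine ⟨⟨?_, ?_⟩, h3⟩
    · cases j <;> simp at h1 <;> linarith
    · cases j <;> simp at h2 <;> linarith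
  calc volume (box Q) * coef q f Q ≤ volume (box Q) * ∑' j, avgNorm q f (V j) := by gcongr
    _ = 2 * ∑' j, volume (V j) * avgNorm q f (V j) := by
        rw [hbox, mul_assoc, ← ENNReal.tsum_mul_left]
        simp only [hVvol]
    _ ≤ 2 * ∑' _ : Bool, M ^ (1 / q) * ∫⁻ a in slab 3 Q, whitneyAvg q f a := by
        exact mul_le_mul_right (ENNReal.tsum_le_tsum h3) _
    _ = _ := by
        rw [tsum_fintype]
        simp
        ring

/-- The relation between a point and the dyadic boxes meeting its Whitney region. -/
def Near (Q : DIdx n) (a : Amb n) : Prop := (box Q ∩ whitneyRegion a).Nonempty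

lemma Near.lt {Q : DIdx n} {a : Amb n} (h : Near Q a) : 2 * side Q < a.1 ∧ a.1 < 8 * side Q := by
  obtain ⟨b, hb, hb'⟩ := h
  obtain ⟨h1, h2, -⟩ := mem_box_iff.1 hb
  obtain ⟨h3, h4⟩ := hb'.1
  constructor <;> linarith

lemma Near.abs_sub_lt {Q : DIdx n} {a : Amb n} (h : Near Q a) {x : Bdry n} (hx : x ∈ dcube Q)
    (i : Fin n) : |x i - a.2 i| < a.1 / 2 + side Q := by
  obtain ⟨b, hb, hb'⟩ := h
  have h1 := abs_sub_lt_side hx (mem_box_iff.1 hb).2.2 i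
  have h2 := hb'.2 i
  have := abs_sub_le (x i) (b.2 i) (a.2 i)
  linarith

-- The boxes near a cover its Whitney region, and each has measure at most twice that of the region
-- because 2ℓ(Q) < t.
open Classical in
lemma whitneyAvg_le_tsum {q : ℝ} (hq : 1 < q) (f : Amb n → 𝕜) {a : Amb n} (ha : a ∈ upper n) :
    whitneyAvg q f a ≤ 2 ^ (1 / q) * ∑' Q, if Near Q a then coef q f Q else 0 := by
  have ha' : 0 < a.1 := ha
  have h := avgNorm_le_tsum hq f (S := whitneyRegion a) (ι := {Q : DIdx n // Near Q a})
    (T := fun Q => box Q.1) (M := 2) ?_ ?_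
  · refine h.trans_eq ?_
    congr 1
    refine (tsum_subtype {Q : DIdx n | Near Q a} (coef q f)).trans (tsum_congr fun Q => ?_)
    simp only [indicator, mem_ofPred_eq]
  · intro b hb
    obtain ⟨Q, hQ⟩ := exists_mem_box (whitneyRegion_subset a hb)
    exact mem_iUnion.2 ⟨⟨Q, b, hQ, hb⟩, hQ⟩
  · rintro ⟨Q, hQ⟩
    have h2 := hQ.lt.1
    have hs := side_pos Q
    dsimp only
    have h3 : volume (box Q) ≤ 2 * volume (whitneyRegion a) := by
      have : (2 : ℝ≥0∞) * (ENNReal.ofReal (a.1 / 2) * ENNReal.ofReal a.1 ^ n) =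
          ENNReal.ofReal a.1 * ENNReal.ofReal a.1 ^ n := by
        rw [← mul_assoc, ← ENNReal.ofReal_ofNat, ← ENNReal.ofReal_mul zero_le_two]
        congr 2; ring
      rw [volume_box, volume_whitneyRegion, volume_dcube, this]
      gcongr
      linarith
    calc (volume (whitneyRegion a))⁻¹ = 2 * (2 * volume (whitneyRegion a))⁻¹ := by
          rw [ENNReal.mul_inv (by simp) (by simp), ← mul_assoc,
            ENNReal.mul_inv_cancel (by simp) (by simp), one_mul]
      _ ≤ _ := by gcongr

end

/-! ### Comparison of the continuous and the discrete functionals -/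

section

variable {n : ℕ} {𝕜 : Type*} [RCLike 𝕜]

/-- The discrete sequence describing the norm of `Z`. -/
noncomputable def zcoef (q : ℝ) (f : Amb n → 𝕜) (Q : DIdx n) : ℝ≥0∞ :=
  ENNReal.ofReal (side Q) * coef q f Q

lemma ofReal_pow_ne_zero {l : ℝ} (hl : 0 < l) (n : ℕ) : ENNReal.ofReal l ^ n ≠ 0 :=
  pow_ne_zero _ (by simpa using hl)

lemma ofReal_pow_ne_top (l : ℝ) (n : ℕ) : ENNReal.ofReal l ^ n ≠ ∞ :=
  ENNReal.pow_ne_top ENNReal.ofReal_ne_top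

/-- When W_q f is integrated over a Carleson box, each Q contributes its coefficient times the
measure of the set of points near Q, which is of order ℓ(Q)|Q|. Only cubes in a fixed dilate of the
base contribute, so an average of `sumFun` remains. -/
lemma exists_carlesonFun_le (n : ℕ) {q : ℝ} (hq : 1 < q) : ∃ C : ℝ≥0∞, C ≠ ∞ ∧
    ∀ (f : Amb n → 𝕜) (x : Bdry n),
      carlesonFun (whitneyAvg q f) x ≤ C * hlMax volume (sumFun (zcoef q f)) x := by
  classical
  obtain ⟨C, hC, H⟩ := exists_lintegral_le_hlMax n 3 (by norm_num)
  set c : ℝ≥0∞ := ENNReal.ofReal 6 * ENNReal.ofReal 10 ^ n with hc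
  have hcfin : c ≠ ∞ := ENNReal.mul_ne_top ENNReal.ofReal_ne_top (ofReal_pow_ne_top _ _)
  have h2q : (2 : ℝ≥0∞) ^ (1 / q) ≠ ∞ := ENNReal.rpow_ne_top_of_nonneg (by positivity) (by simp)
  refine ⟨2 ^ (1 / q) * c * C, ENNReal.mul_ne_top (ENNReal.mul_ne_top h2q hcfin) hC, ?_⟩
  intro f x
  refine iSup_le fun z => iSup_le fun l => iSup_le fun hl => iSup_le fun hx => ?_
  set D : Set (Bdry n) := {y | ∀ i, |y i - z i| ≤ 3 * l} with hD
  -- A box containing every point near Q: the heights are between 2ℓ and 8ℓ, and the distance to the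
  -- corner of Q is below t/2 + ℓ < 5ℓ in each coordinate.
  set P : DIdx n → Set (Amb n) := fun Q =>
    Ioo (2 * side Q) (8 * side Q) ×ˢ cube (WithLp.toLp 2 fun i => Q.2 i * side Q) (10 * side Q)
    with hP
  have hPm : ∀ Q, MeasurableSet (P Q) := fun Q => (isOpen_Ioo.prod (isOpen_cube _ _)).measurableSet
  have hPvol : ∀ Q, volume (P Q) = c * (ENNReal.ofReal (side Q) * volume (dcube Q)) := by
    intro Q
    rw [hP, volume_prod_amb, Real.volume_Ioo, volume_cube, volume_dcube, ← sub_mul,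
      ENNReal.ofReal_mul (by norm_num), ENNReal.ofReal_mul (by norm_num), mul_pow, hc]
    norm_num
    ring
  have hnear : ∀ a ∈ carlesonBox z l, ∀ Q, Near Q a → dcube Q ⊆ D ∧ a ∈ P Q := by
    intro a ha Q hQ
    have h1 := hQ.lt
    have h2 := ha.1.2
    refine ⟨fun y hy i => ?_, h1, fun i => ?_⟩
    · have h3 := hQ.abs_sub_lt hy i
      have h4 := ha.2 i
      have := abs_sub_le (y i) (a.2 i) (z i)
      linarith
    · have hcor : (WithLp.toLp 2 fun i => Q.2 i * side Q : Bdry n) ∈ dcube Q := by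
        have := side_pos Q
        exact mem_dcube_iff.2 fun i => ⟨le_rfl, by
          show Q.2 i * side Q < _
          linarith⟩
      have h3 := hQ.abs_sub_lt hcor i
      rw [abs_sub_comm]
      linarith
  have hbound : ∀ a ∈ carlesonBox z l, whitneyAvg q f a ≤ 2 ^ (1 / q) * ∑' Q,
      (P Q).indicator (fun _ => if dcube Q ⊆ D then coef q f Q else 0) a := by
    intro a ha
    refine (whitneyAvg_le_tsum hq f (carlesonBox_subset z l ha)).trans ?_
    gcongr with Q
    by_cases hQ : Near Q a
    · obtain ⟨h1, h2⟩ := hnear a ha Q hQ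
      rw [if_pos hQ, indicator_of_mem h2, if_pos h1]
    · simp [hQ]
  have hint : ∫⁻ a in carlesonBox z l, whitneyAvg q f a ≤
      2 ^ (1 / q) * (c * ∫⁻ y in D, sumFun (zcoef q f) y) := by
    calc ∫⁻ a in carlesonBox z l, whitneyAvg q f a
        ≤ ∫⁻ a in carlesonBox z l, 2 ^ (1 / q) * ∑' Q,
            (P Q).indicator (fun _ => if dcube Q ⊆ D then coef q f Q else 0) a :=
          setLIntegral_mono' (isOpen_carlesonBox z l).measurableSet hbound
      _ ≤ ∫⁻ a, 2 ^ (1 / q) * ∑' Q,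
            (P Q).indicator (fun _ => if dcube Q ⊆ D then coef q f Q else 0) a :=
          setLIntegral_le_lintegral _ _
      _ = 2 ^ (1 / q) * ∑' Q, (if dcube Q ⊆ D then coef q f Q else 0) * volume (P Q) := by
          rw [lintegral_const_mul' _ _ h2q,
            lintegral_tsum fun Q => (measurable_const.indicator (hPm Q)).aemeasurable]
          simp only [lintegral_indicator_const (hPm _)]
      _ ≤ 2 ^ (1 / q) * ∑' Q, c * (zcoef q f Q * volume (dcube Q ∩ D)) := by
          refine mul_le_mul_right (ENNReal.tsum_le_tsum fun Q => ?_) _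
          split_ifs with h
          · rw [hPvol, inter_eq_left.2 h, zcoef]
            exact le_of_eq (by ring)
          · simp
      _ = _ := by rw [ENNReal.tsum_mul_left, setLIntegral_sumFun]
  have hmax : ∫⁻ y in D, sumFun (zcoef q f) y ≤
      C * ENNReal.ofReal l ^ n * hlMax volume (sumFun (zcoef q f)) x := by
    refine H _ D z x l hl (fun y hy => hy) fun i => ?_
    have := hx i
    linarith
  rw [volume_cube]
  calc (ENNReal.ofReal l ^ n)⁻¹ * ∫⁻ a in carlesonBox z l, whitneyAvg q f a
      ≤ (ENNReal.ofReal l ^ n)⁻¹ * (2 ^ (1 / q) * (c *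
          (C * ENNReal.ofReal l ^ n * hlMax volume (sumFun (zcoef q f)) x))) := by
        gcongr
        exact hint.trans (by gcongr)
    _ = (ENNReal.ofReal l ^ n)⁻¹ * ENNReal.ofReal l ^ n *
          (2 ^ (1 / q) * c * C * hlMax volume (sumFun (zcoef q f)) x) := by ring
    _ = _ := by
        rw [ENNReal.inv_mul_cancel (ofReal_pow_ne_zero hl n) (ofReal_pow_ne_top l n), one_mul]

/-- This is false for n = 0, where all cubes coincide. -/
lemma side_le_of_subset (hn : 1 ≤ n) {Q R : DIdx n} (h : dcube R ⊆ dcube Q) :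
    side R ≤ side Q := by
  have h1 := measure_mono (μ := volume) h
  rw [volume_dcube, volume_dcube, ENNReal.pow_le_pow_left_iff (by lia)] at h1
  exact (ENNReal.ofReal_le_ofReal_iff (side_pos Q).le).1 h1

/-- The sets `slab 3 R` with R ⊆ Q are disjoint and lie in one Carleson box above Q, so the bounds
for the single coefficients add up. -/
lemma exists_carFun_le (hn : 1 ≤ n) {q : ℝ} (hq : 1 < q) : ∃ C : ℝ≥0∞, C ≠ ∞ ∧
    ∀ (f : Amb n → 𝕜) (x : Bdry n),
      carFun (zcoef q f) x ≤ C * carlesonFun (whitneyAvg q f) x := by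
  classical
  obtain ⟨C, hC, H⟩ := exists_coef_le (𝕜 := 𝕜) n hq
  refine ⟨C * ENNReal.ofReal 6 ^ n, ENNReal.mul_ne_top hC (ofReal_pow_ne_top _ _), fun f x => ?_⟩
  refine supFun_le fun Q hx => ?_
  have hs := side_pos Q
  -- The side 6ℓ(Q) is dictated by the height that `slab 3 Q` reaches.
  have h6 : 0 < 6 * side Q := by positivity
  have h1 : ∀ R, (if dcube R ⊆ dcube Q then zcoef q f R * volume (dcube R) else 0) ≤
      C * if dcube R ⊆ dcube Q then ∫⁻ a in slab 3 R, whitneyAvg q f a else 0 := by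
    intro R
    split_ifs with h
    · refine le_trans ?_ (H f R)
      rw [zcoef, volume_box, mul_right_comm]
      gcongr
      linarith [side_pos R]
    · simp
  have h2 : ∑' R, (if dcube R ⊆ dcube Q then ∫⁻ a in slab 3 R, whitneyAvg q f a else 0) ≤
      ∫⁻ a in carlesonBox x (6 * side Q), whitneyAvg q f a := by
    calc ∑' R, (if dcube R ⊆ dcube Q then ∫⁻ a in slab 3 R, whitneyAvg q f a else 0)
        = ∑' R : {R : DIdx n // dcube R ⊆ dcube Q}, ∫⁻ a in slab 3 R.1, whitneyAvg q f a := by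
          refine Eq.trans (tsum_congr fun R => ?_) (tsum_subtype {R : DIdx n | dcube R ⊆ dcube Q}
            fun R => ∫⁻ a in slab 3 R, whitneyAvg q f a).symm
          simp only [indicator, mem_ofPred_eq]
      _ = ∫⁻ a in ⋃ R : {R : DIdx n // dcube R ⊆ dcube Q}, slab 3 R.1, whitneyAvg q f a := by
          refine (lintegral_iUnion (s := fun R : {R : DIdx n // dcube R ⊆ dcube Q} => slab 3 R.1)
            (fun R => measurableSet_slab 3 R.1) ?_ _).symm
          intro R S hRS
          exact pairwise_disjoint_slab (by norm_num) fun h => hRS (Subtype.ext h)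
      _ ≤ _ := by
          refine lintegral_mono_set (iUnion_subset fun R a ha => ?_)
          have hR := side_le_of_subset hn R.2
          have hR0 := side_pos R.1
          have h1 := ha.1.1
          have h2 := ha.1.2
          refine ⟨⟨by linarith, by linarith⟩, fun i => ?_⟩
          have := abs_sub_lt_side (R.2 ha.2) hx i
          linarith
  have h3 : (volume (cube x (6 * side Q)))⁻¹ *
      ∫⁻ a in carlesonBox x (6 * side Q), whitneyAvg q f a ≤ carlesonFun (whitneyAvg q f) x :=
    le_iSup_of_le x (le_iSup_of_le _ (le_iSup_of_le h6
      (le_iSup_of_le (fun i => by simpa using hs) le_rfl)))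
  have h4 : (volume (dcube Q))⁻¹ = ENNReal.ofReal 6 ^ n * (volume (cube x (6 * side Q)))⁻¹ := by
    rw [volume_cube, volume_dcube, ENNReal.ofReal_mul (by norm_num), mul_pow,
      ENNReal.mul_inv (Or.inl (ofReal_pow_ne_zero (by norm_num) _))
        (Or.inl (ofReal_pow_ne_top _ _)), ← mul_assoc,
      ENNReal.mul_inv_cancel (ofReal_pow_ne_zero (by norm_num) _) (ofReal_pow_ne_top _ _), one_mul]
  calc (volume (dcube Q))⁻¹ *
        ∑' R, (if dcube R ⊆ dcube Q then zcoef q f R * volume (dcube R) else 0)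
      ≤ (volume (dcube Q))⁻¹ *
        ∑' R, C * if dcube R ⊆ dcube Q then ∫⁻ a in slab 3 R, whitneyAvg q f a else 0 := by
        gcongr; exact h1 _
    _ ≤ (volume (dcube Q))⁻¹ * (C * ∫⁻ a in carlesonBox x (6 * side Q), whitneyAvg q f a) := by
        rw [ENNReal.tsum_mul_left]; gcongr
    _ = C * ENNReal.ofReal 6 ^ n * ((volume (cube x (6 * side Q)))⁻¹ *
          ∫⁻ a in carlesonBox x (6 * side Q), whitneyAvg q f a) := by rw [h4]; ring
    _ ≤ _ := by gcongr

/-- Each coefficient near a is at most the average of `supFun` over its box. These boxes are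
disjoint, have size comparable to the height of a, and lie above a set of the same size around the
vertex; so their sum is an average of `supFun`. -/
lemma exists_ntMax_le (n : ℕ) {α q : ℝ} (hα : 0 < α) (hq : 1 < q) : ∃ C : ℝ≥0∞, C ≠ ∞ ∧
    ∀ (f : Amb n → 𝕜) (x : Bdry n),
      ntMax α (whitneyAvg q f) x ≤ C * hlMax volume (supFun (coef q f)) x := by
  classical
  obtain ⟨C, hC, H⟩ := exists_lintegral_le_hlMax n (2 + α) (by linarith)
  have h2q : (2 : ℝ≥0∞) ^ (1 / q) ≠ ∞ := ENNReal.rpow_ne_top_of_nonneg (by positivity) (by simp)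
  refine ⟨2 ^ (1 / q) * (ENNReal.ofReal 8 ^ (n + 1) * (2 * C)), ENNReal.mul_ne_top h2q
    (ENNReal.mul_ne_top (ofReal_pow_ne_top _ _) (ENNReal.mul_ne_top (by simp) hC)), ?_⟩
  intro f x
  refine essSup_le_of_ae_le _ ?_
  filter_upwards [self_mem_ae_restrict (isOpen_cone α x).measurableSet] with a ha
  have ht : 0 < a.1 := ha.1
  refine (whitneyAvg_le_tsum hq f (cone_subset α x ha)).trans ?_
  rw [mul_assoc]
  gcongr
  set D : Set (Bdry n) := {y | ∀ i, |y i - a.2 i| ≤ (2 + α) * a.1} with hD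
  -- An upper bound for 1/|box Q|, as ℓ(Q) > t/8 whenever Q is near a point at height t.
  set N : ℝ≥0∞ := ENNReal.ofReal (8 / a.1) ^ (n + 1) with hN
  have hG : Measurable fun b : Amb n => supFun (coef q f) b.2 :=
    (measurable_supFun _).comp measurable_snd
  have h1 : ∀ Q, (if Near Q a then coef q f Q else 0) ≤
      N * if Near Q a then ∫⁻ b in box Q, supFun (coef q f) b.2 else 0 := by
    intro Q
    split_ifs with h
    · have hvol : 1 ≤ N * volume (box Q) := by
        have hs := side_pos Q
        have h8 : 1 ≤ 8 / a.1 * side Q := by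
          rw [div_mul_eq_mul_div, one_le_div ht]
          exact h.lt.2.le
        calc (1 : ℝ≥0∞) ≤ ENNReal.ofReal (8 / a.1 * side Q) ^ (n + 1) :=
              one_le_pow₀ (by simpa using h8)
          _ = N * (ENNReal.ofReal (side Q) * ENNReal.ofReal (side Q) ^ n) := by
              rw [ENNReal.ofReal_mul (by positivity), mul_pow, hN, pow_succ' (ENNReal.ofReal (side Q))]
          _ ≤ _ := by
              rw [volume_box, volume_dcube]
              gcongr
              linarith
      calc coef q f Q = 1 * coef q f Q := (one_mul _).symm
        _ ≤ N * volume (box Q) * coef q f Q := by gcongr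
        _ = N * ∫⁻ _ in box Q, coef q f Q := by rw [setLIntegral_const]; ring
        _ ≤ _ := by
            exact mul_le_mul_right (setLIntegral_mono' (measurableSet_box Q) fun b hb =>
              le_supFun (coef q f) (mem_box_iff.1 hb).2.2) _
    · simp
  have h2 : ∑' Q, (if Near Q a then ∫⁻ b in box Q, supFun (coef q f) b.2 else 0) ≤
      ENNReal.ofReal (2 * a.1) * ∫⁻ y in D, supFun (coef q f) y := by
    calc ∑' Q, (if Near Q a then ∫⁻ b in box Q, supFun (coef q f) b.2 else 0)
        = ∑' Q : {Q : DIdx n // Near Q a}, ∫⁻ b in box Q.1, supFun (coef q f) b.2 := by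
          refine Eq.trans (tsum_congr fun R => ?_) (tsum_subtype {Q : DIdx n | Near Q a}
            fun R => ∫⁻ b in box R, supFun (coef q f) b.2).symm
          simp only [indicator, mem_ofPred_eq]
      _ = ∫⁻ b in ⋃ Q : {Q : DIdx n // Near Q a}, box Q.1, supFun (coef q f) b.2 := by
          refine (lintegral_iUnion (s := fun R : {Q : DIdx n // Near Q a} => box R.1)
            (fun R => measurableSet_box R.1) ?_ _).symm
          intro R S hRS
          exact pairwise_disjoint_box fun h => hRS (Subtype.ext h)
      _ ≤ ∫⁻ b in Ioo 0 (2 * a.1) ×ˢ D, supFun (coef q f) b.2 := by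
          refine lintegral_mono_set (iUnion_subset fun Q b hb => ?_)
          obtain ⟨h3, h4, h5⟩ := mem_box_iff.1 hb
          have h6 := Q.2.lt
          have h7 := side_pos Q.1
          refine ⟨⟨by linarith, by linarith⟩, fun i => ?_⟩
          have h8 := Q.2.abs_sub_lt h5 i
          have : 0 < α * a.1 := by positivity
          linarith
      _ = _ := by
          rw [Measure.volume_eq_prod, ← Measure.prod_restrict,
            lintegral_prod_symm _ hG.aemeasurable]
          simp only [lintegral_const, Measure.restrict_apply MeasurableSet.univ, univ_inter,
            Real.volume_Ioo, sub_zero]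
          rw [lintegral_mul_const' _ _ ENNReal.ofReal_ne_top, mul_comm]
  have h3 : ∫⁻ y in D, supFun (coef q f) y ≤
      C * ENNReal.ofReal a.1 ^ n * hlMax volume (supFun (coef q f)) x := by
    refine H _ D a.2 x a.1 ht (fun y hy => hy) fun i => ?_
    have h4 : |a.2 i - x i| ≤ ‖a.2 - x‖ := PiLp.norm_apply_le (a.2 - x) i
    rw [abs_sub_comm] at h4
    have := ha.2
    linarith
  calc ∑' Q, (if Near Q a then coef q f Q else 0)
      ≤ ∑' Q, N * if Near Q a then ∫⁻ b in box Q, supFun (coef q f) b.2 else 0 :=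
        ENNReal.tsum_le_tsum h1
    _ ≤ N * (ENNReal.ofReal (2 * a.1) * (C * ENNReal.ofReal a.1 ^ n *
          hlMax volume (supFun (coef q f)) x)) := by
        rw [ENNReal.tsum_mul_left]
        gcongr
        exact h2.trans (by gcongr)
    _ = (N * ENNReal.ofReal a.1 ^ (n + 1)) * (2 * C * hlMax volume (supFun (coef q f)) x) := by
        rw [ENNReal.ofReal_mul zero_le_two, ENNReal.ofReal_ofNat]; ring
    _ = _ := by
        rw [hN, ← mul_pow, ← ENNReal.ofReal_mul (by positivity), div_mul_cancel₀ _ ht.ne']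
        ring

/-- A point of `slab 3 Q` has height at least 3ℓ(Q), so it lies in the cone of every vertex within
3αℓ(Q) of its base point. The bound by the essential supremum holds only almost everywhere in each
cone, so it is integrated over points and vertices together and Tonelli is applied. -/
lemma exists_supFun_le (n : ℕ) {α q : ℝ} (hα : 0 < α) (hq : 1 < q) : ∃ C : ℝ≥0∞, C ≠ ∞ ∧
    ∀ (f : Amb n → 𝕜), StronglyMeasurable f → ∀ x : Bdry n,
      supFun (coef q f) x ≤ C * hlMax volume (ntMax α (whitneyAvg q f)) x := by
  obtain ⟨C, hC, H⟩ := exists_lintegral_le_hlMax n (1 + 3 * α) (by linarith)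
  obtain ⟨C₁, hC₁, H₁⟩ := exists_coef_le (𝕜 := 𝕜) n hq
  set κ : ℝ≥0∞ := ENNReal.ofReal (3 * α) ^ n * volume (ball (0 : Bdry n) 1) with hκ
  have hκ0 : κ ≠ 0 := mul_ne_zero (ofReal_pow_ne_zero (by positivity) n)
    (measure_ball_pos volume _ one_pos).ne'
  have hκt : κ ≠ ∞ := ENNReal.mul_ne_top (ofReal_pow_ne_top _ _) measure_ball_lt_top.ne
  refine ⟨C₁ * 2 * C * κ⁻¹, ENNReal.mul_ne_top (ENNReal.mul_ne_top
    (ENNReal.mul_ne_top hC₁ (by simp)) hC) (ENNReal.inv_ne_top.2 hκ0), fun f hf x => ?_⟩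
  refine supFun_le fun Q hx => ?_
  have hs := side_pos Q
  set W := whitneyAvg q f with hW
  have hWm : Measurable W := measurable_whitneyAvg hq hf
  set D : Set (Bdry n) := {y | ∀ i, |y i - x i| ≤ (1 + 3 * α) * side Q} with hD
  -- The admissible pairs of point and vertex; every section over a point has measure κ ℓ(Q)^n.
  set B : Set (Amb n × Bdry n) := {w | ‖w.1.2 - w.2‖ < 3 * α * side Q} with hB
  have hBm : MeasurableSet B := (isOpen_lt (by fun_prop) (by fun_prop)).measurableSet
  have hvolB : ∀ a : Amb n, volume {z : Bdry n | (a, z) ∈ B} = κ * ENNReal.ofReal (side Q) ^ n := by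
    intro a
    have : {z : Bdry n | (a, z) ∈ B} = ball a.2 (3 * α * side Q) := by
      ext z
      rw [mem_ball_iff_norm', mem_ofPred_eq, hB, mem_ofPred_eq]
    rw [this, volume_ball_bdry _ (by positivity), ENNReal.ofReal_mul (by positivity), mul_pow, hκ]
    ring
  have hkm : Measurable (Function.uncurry fun (a : Amb n) (z : Bdry n) =>
      B.indicator (fun w => W w.1) (a, z)) :=
    (hWm.comp measurable_fst).indicator hBm
  have h1 : κ * ENNReal.ofReal (side Q) ^ n * ∫⁻ a in slab 3 Q, W a ≤
      ENNReal.ofReal (3 * side Q) * volume (dcube Q) * ∫⁻ z in D, ntMax α W z := by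
    calc κ * ENNReal.ofReal (side Q) ^ n * ∫⁻ a in slab 3 Q, W a
        = ∫⁻ a in slab 3 Q, ∫⁻ z, B.indicator (fun w => W w.1) (a, z) := by
          rw [← lintegral_const_mul _ hWm]
          refine lintegral_congr fun a => ?_
          have h2 : ∀ z, B.indicator (fun w => W w.1) (a, z) =
              {z : Bdry n | (a, z) ∈ B}.indicator (fun _ => W a) z := fun z => rfl
          simp only [h2]
          have hsm : MeasurableSet {z : Bdry n | (a, z) ∈ B} := measurable_prodMk_left hBm
          rw [lintegral_indicator_const hsm, hvolB, mul_comm]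
      _ = ∫⁻ z, ∫⁻ a in slab 3 Q, B.indicator (fun w => W w.1) (a, z) :=
          lintegral_lintegral_swap hkm.aemeasurable
      _ ≤ ∫⁻ z, D.indicator (fun z => volume (slab 3 Q) * ntMax α W z) z := by
          refine lintegral_mono fun z => ?_
          by_cases hz : z ∈ D
          · rw [indicator_of_mem hz, mul_comm, ← setLIntegral_const]
            have hae : ∀ᵐ a ∂(volume.restrict (cone α z)), W a ≤ ntMax α W z :=
              ENNReal.ae_le_essSup W
            rw [ae_restrict_iff' (isOpen_cone α z).measurableSet] at hae
            refine lintegral_mono_ae ?_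
            filter_upwards [self_mem_ae_restrict (measurableSet_slab 3 Q),
              ae_restrict_of_ae hae] with a ha ha'
            by_cases hab : (a, z) ∈ B
            · rw [indicator_of_mem hab]
              refine ha' ⟨by linarith [ha.1.1], lt_of_lt_of_le hab ?_⟩
              rw [mul_right_comm, mul_comm]
              exact mul_le_mul_of_nonneg_left ha.1.1 hα.le
            · simp [hab]
          · rw [indicator_of_notMem hz]
            refine le_of_eq ((setLIntegral_congr_fun (measurableSet_slab 3 Q)
              (g := fun _ => 0) fun a ha => ?_).trans lintegral_zero)
            refine indicator_of_notMem (fun hab => hz fun i => ?_) _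
            have h3 := abs_sub_lt_side ha.2 hx i
            have h4 : |a.2 i - z i| ≤ ‖a.2 - z‖ := PiLp.norm_apply_le (a.2 - z) i
            have h5 : ‖a.2 - z‖ < 3 * α * side Q := hab
            rw [abs_sub_comm] at h4
            have := abs_sub_le (z i) (a.2 i) (x i)
            linarith
      _ ≤ _ := by
          have hDm : MeasurableSet D := by
            have : D = ⋂ i, {y : Bdry n | |y i - x i| ≤ (1 + 3 * α) * side Q} := by
              ext y; simp [hD]
            rw [this]
            exact (isClosed_iInter fun i => isClosed_le (by fun_prop) (by fun_prop)).measurableSet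
          rw [lintegral_indicator hDm, lintegral_const_mul _ (measurable_ntMax α W), volume_slab]
  have h2 : ∫⁻ z in D, ntMax α W z ≤
      C * ENNReal.ofReal (side Q) ^ n * hlMax volume (ntMax α W) x := by
    refine H _ D x x (side Q) hs (fun y hy => hy) fun i => ?_
    simp only [sub_self, abs_zero]
    positivity
  have hs0 := ofReal_pow_ne_zero hs n
  have hst := ofReal_pow_ne_top (side Q) n
  have h3 : κ * ∫⁻ a in slab 3 Q, W a ≤
      ENNReal.ofReal (3 * side Q) * volume (dcube Q) * (C * hlMax volume (ntMax α W) x) := by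
    have h4 : ENNReal.ofReal (side Q) ^ n * (κ * ∫⁻ a in slab 3 Q, W a) ≤
        ENNReal.ofReal (side Q) ^ n * (ENNReal.ofReal (3 * side Q) * volume (dcube Q) *
          (C * hlMax volume (ntMax α W) x)) := by
      calc _ = κ * ENNReal.ofReal (side Q) ^ n * ∫⁻ a in slab 3 Q, W a := by ring
        _ ≤ ENNReal.ofReal (3 * side Q) * volume (dcube Q) *
            (C * ENNReal.ofReal (side Q) ^ n * hlMax volume (ntMax α W) x) :=
          h1.trans (mul_le_mul_right h2 _)
        _ = _ := by ring
    exact (ENNReal.mul_le_mul_iff_right hs0 hst).1 h4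
  have h5 : volume (box Q) * (κ * coef q f Q) ≤
      volume (box Q) * (2 * C₁ * C * hlMax volume (ntMax α W) x) := by
    calc volume (box Q) * (κ * coef q f Q) = κ * (volume (box Q) * coef q f Q) := by ring
      _ ≤ κ * (C₁ * ∫⁻ a in slab 3 Q, W a) := mul_le_mul_right (H₁ f Q) _
      _ = C₁ * (κ * ∫⁻ a in slab 3 Q, W a) := by ring
      _ ≤ C₁ * (ENNReal.ofReal (2 * (2 * side Q)) * volume (dcube Q) *
            (C * hlMax volume (ntMax α W) x)) := by
          refine mul_le_mul_right (h3.trans ?_) _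
          refine mul_le_mul_left (mul_le_mul_left (ENNReal.ofReal_le_ofReal ?_) _) _
          linarith
      _ = _ := by
          rw [volume_box, ENNReal.ofReal_mul zero_le_two, ENNReal.ofReal_ofNat]; ring
  have h6 := (ENNReal.mul_le_mul_iff_right (volume_box_ne_zero Q) (volume_box_ne_top Q)).1 h5
  calc coef q f Q = κ⁻¹ * (κ * coef q f Q) := by
        rw [← mul_assoc, ENNReal.inv_mul_cancel hκ0 hκt, one_mul]
    _ ≤ κ⁻¹ * (2 * C₁ * C * hlMax volume (ntMax α W) x) := by gcongr
    _ = _ := by ring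

/-! ### Equivalence of the norms with their dyadic forms -/

lemma eLpNorm_const_mul_ennreal {β : Type*} [MeasurableSpace β] (μ : Measure β) {p : ℝ}
    (hp : 0 < p) {F : β → ℝ≥0∞} (hF : Measurable F) (c : ℝ≥0∞) :
    eLpNorm (fun x => c * F x) (ENNReal.ofReal p) μ = c * eLpNorm F (ENNReal.ofReal p) μ := by
  rw [eLpNorm_ennreal _ hp, eLpNorm_ennreal _ hp]
  simp only [ENNReal.mul_rpow_of_nonneg _ _ hp.le]
  rw [lintegral_const_mul _ (hF.pow_const _), ENNReal.mul_rpow_of_nonneg _ _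
    (one_div_nonneg.2 hp.le), ← ENNReal.rpow_mul, mul_one_div_cancel hp.ne', ENNReal.rpow_one]

lemma eLpNorm_le_const_mul {β : Type*} [MeasurableSpace β] (μ : Measure β) {p : ℝ}
    (hp : 0 < p) {F G : β → ℝ≥0∞} (hG : Measurable G) (c : ℝ≥0∞) (h : ∀ x, F x ≤ c * G x) :
    eLpNorm F (ENNReal.ofReal p) μ ≤ c * eLpNorm G (ENNReal.ofReal p) μ := by
  rw [← eLpNorm_const_mul_ennreal μ hp hG]
  exact eLpNorm_mono_enorm h

/-- Boundedness of an operator controlled pointwise by a maximal function. -/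
lemma eLpNorm_le_of_le_hlMax (n : ℕ) {p : ℝ} (hp : 1 < p) : ∃ C : ℝ≥0∞, C ≠ ∞ ∧
    ∀ (c : ℝ≥0∞) (F G : Bdry n → ℝ≥0∞), Measurable G → (∀ x, F x ≤ c * hlMax volume G x) →
      eLpNorm F (ENNReal.ofReal p) volume ≤ c * C * eLpNorm G (ENNReal.ofReal p) volume := by
  obtain ⟨C, hC, H⟩ := eLpNorm_hlMax_le (volume : Measure (Bdry n)) hp
  refine ⟨C, hC, fun c F G hG h => ?_⟩
  refine (eLpNorm_le_const_mul volume (by linarith) (measurable_hlMax _ _) c h).trans ?_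
  rw [mul_assoc]
  gcongr
  exact H G hG

/-- The dyadic form of the norm of `Z`. -/
noncomputable def zNorm (p q : ℝ) (f : Amb n → 𝕜) : ℝ≥0∞ :=
  eLpNorm (sumFun (zcoef q f)) (ENNReal.ofReal p) volume

/-- The dyadic form of the norm of `X`. -/
noncomputable def xNorm (p q : ℝ) (f : Amb n → 𝕜) : ℝ≥0∞ :=
  eLpNorm (supFun (coef q f)) (ENNReal.ofReal p) volume

lemma exists_carlesonNorm_le_zNorm (n : ℕ) {p q : ℝ} (hp : 1 < p) (hq : 1 < q) :
    ∃ C : ℝ≥0∞, C ≠ ∞ ∧ ∀ f : Amb n → 𝕜, carlesonNorm p q f ≤ C * zNorm p q f := by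
  obtain ⟨C, hC, H⟩ := exists_carlesonFun_le (𝕜 := 𝕜) n hq
  obtain ⟨C', hC', H'⟩ := eLpNorm_le_of_le_hlMax n hp
  exact ⟨C * C', ENNReal.mul_ne_top hC hC', fun f =>
    H' C _ _ (measurable_sumFun _) (H f)⟩

lemma exists_ntNorm_le_xNorm (n : ℕ) {α p q : ℝ} (hα : 0 < α) (hp : 1 < p) (hq : 1 < q) :
    ∃ C : ℝ≥0∞, C ≠ ∞ ∧ ∀ f : Amb n → 𝕜, ntNorm α p q f ≤ C * xNorm p q f := by
  obtain ⟨C, hC, H⟩ := exists_ntMax_le (𝕜 := 𝕜) n hα hq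
  obtain ⟨C', hC', H'⟩ := eLpNorm_le_of_le_hlMax n hp
  exact ⟨C * C', ENNReal.mul_ne_top hC hC', fun f =>
    H' C _ _ (measurable_supFun _) (H f)⟩

lemma exists_xNorm_le_ntNorm (n : ℕ) {α p q : ℝ} (hα : 0 < α) (hp : 1 < p) (hq : 1 < q) :
    ∃ C : ℝ≥0∞, C ≠ ∞ ∧ ∀ f : Amb n → 𝕜, StronglyMeasurable f →
      xNorm p q f ≤ C * ntNorm α p q f := by
  obtain ⟨C, hC, H⟩ := exists_supFun_le (𝕜 := 𝕜) n hα hq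
  obtain ⟨C', hC', H'⟩ := eLpNorm_le_of_le_hlMax n hp
  exact ⟨C * C', ENNReal.mul_ne_top hC hC', fun f hf =>
    H' C _ _ (measurable_ntMax _ _) (H f hf)⟩

/-- An infinite entry would make `carFun` infinite on a cube of positive measure. Finite entries are
needed before finite partial sums can be absorbed. -/
lemma coef_ne_top_of_carFun_ne_top {a : DIdx n → ℝ≥0∞} {p : ℝ} (hp : 1 < p)
    (h : eLpNorm (carFun a) (ENNReal.ofReal p) volume ≠ ∞) (Q : DIdx n) : a Q ≠ ∞ := by
  classical
  intro hQ
  refine h ?_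
  have h1 : ∀ x, (dcube Q).indicator (fun _ => (∞ : ℝ≥0∞)) x ≤ carFun a x := by
    intro x
    by_cases hx : x ∈ dcube Q
    · rw [indicator_of_mem hx]
      refine le_trans ?_ (le_supFun _ hx)
      have h2 := ENNReal.le_tsum (f := fun R => if dcube R ⊆ dcube Q then
        a R * volume (dcube R) else 0) Q
      simp only [subset_refl, if_true, hQ, ENNReal.top_mul (volume_dcube_ne_zero Q),
        top_le_iff] at h2
      have h3 : (volume (dcube Q))⁻¹ * ∑' R, (if dcube R ⊆ dcube Q then
          a R * volume (dcube R) else 0) = ∞ := by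
        rw [h2, ENNReal.mul_top (ENNReal.inv_ne_zero.2 (volume_dcube_ne_top Q))]
      refine h3.ge.trans_eq ?_
      congr!
    · simp [hx]
  have h4 := eLpNorm_mono_enorm (μ := volume) (p := ENNReal.ofReal p)
    (f := (dcube Q).indicator fun _ => (∞ : ℝ≥0∞)) (g := carFun a) h1
  rw [eLpNorm_indicator_const (measurableSet_dcube Q) (by simp; linarith) (by simp),
    enorm_eq_self, ENNReal.top_mul, top_le_iff] at h4
  · exact h4
  · simp [ENNReal.rpow_eq_zero_iff, volume_dcube_ne_zero, volume_dcube_ne_top]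

/-- The hard direction, through `carFun`. Finiteness of the Carleson norm is assumed because it
supplies the finite coefficients. -/
lemma exists_zNorm_le_carlesonNorm (hn : 1 ≤ n) {p q : ℝ} (hp : 1 < p) (hq : 1 < q) :
    ∃ C : ℝ≥0∞, C ≠ ∞ ∧ ∀ f : Amb n → 𝕜, carlesonNorm p q f ≠ ∞ →
      zNorm p q f ≤ C * carlesonNorm p q f := by
  obtain ⟨C, hC, H⟩ := exists_carFun_le (𝕜 := 𝕜) hn hq
  obtain ⟨C', hC', H'⟩ := exists_eLpNorm_sumFun_le n (Real.HolderConjugate.conjExponent hp)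
  refine ⟨C' * C, ENNReal.mul_ne_top hC' hC, fun f hf => ?_⟩
  have h1 : eLpNorm (carFun (zcoef q f)) (ENNReal.ofReal p) volume ≤ C * carlesonNorm p q f :=
    eLpNorm_le_const_mul volume (by linarith) (measurable_carlesonFun _) C (H f)
  have h2 := coef_ne_top_of_carFun_ne_top hp (ne_top_of_le_ne_top (ENNReal.mul_ne_top hC hf) h1)
  refine (H' _ h2).trans ?_
  rw [mul_assoc]
  gcongr

end

/-! ### Norms in dyadic form, membership and restriction to unions of boxes -/

section

variable {n : ℕ} {𝕜 : Type*} [RCLike 𝕜]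

lemma mu_restrict_box (Q : DIdx n) : (mu n).restrict (box Q) = volume.restrict (box Q) := by
  rw [mu, Measure.restrict_restrict (measurableSet_box Q), inter_eq_left.2 (box_subset_upper Q)]

lemma ae_mu_iff {P : Amb n → Prop} :
    (∀ᵐ a ∂(mu n), P a) ↔ ∀ Q : DIdx n, ∀ᵐ a ∂(volume.restrict (box Q)), P a := by
  rw [mu, ← iUnion_box, ae_restrict_iUnion_iff]

lemma lintegral_mu (F : Amb n → ℝ≥0∞) : ∫⁻ a, F a ∂(mu n) = ∑' Q, ∫⁻ a in box Q, F a := by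
  rw [mu, ← iUnion_box, lintegral_iUnion measurableSet_box pairwise_disjoint_box]

lemma coef_congr (q : ℝ) {f g : Amb n → 𝕜} {Q : DIdx n}
    (h : f =ᵐ[volume.restrict (box Q)] g) : coef q f Q = coef q g Q := by
  rw [coef, coef, avgNorm, avgNorm, eLpNorm_congr_ae h]

lemma coef_congr_mu (q : ℝ) {f g : Amb n → 𝕜} (h : f =ᵐ[mu n] g) : coef q f = coef q g :=
  funext fun Q => coef_congr q ((ac_of_subset (box_subset_upper Q)).ae_le h)

lemma zNorm_congr (p q : ℝ) {f g : Amb n → 𝕜} (h : f =ᵐ[mu n] g) : zNorm p q f = zNorm p q g := by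
  have : zcoef q f = zcoef q g := funext fun Q => by rw [zcoef, zcoef, coef_congr_mu q h]
  rw [zNorm, zNorm, this]

lemma xNorm_congr (p q : ℝ) {f g : Amb n → 𝕜} (h : f =ᵐ[mu n] g) : xNorm p q f = xNorm p q g := by
  rw [xNorm, xNorm, coef_congr_mu q h]

lemma eLpNorm_box_eq (q : ℝ) (f : Amb n → 𝕜) (Q : DIdx n) :
    eLpNorm f (ENNReal.ofReal q) (volume.restrict (box Q)) =
      volume (box Q) ^ (1 / q) * coef q f Q := by
  rw [coef, avgNorm, ← mul_assoc, ← ENNReal.rpow_add _ _ (volume_box_ne_zero Q)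
    (volume_box_ne_top Q), add_neg_cancel, ENNReal.rpow_zero, one_mul]

lemma volume_box_rpow_ne_top {q : ℝ} (hq : 1 < q) (Q : DIdx n) :
    volume (box Q) ^ (1 / q) ≠ ∞ :=
  ENNReal.rpow_ne_top_of_nonneg (by positivity) (volume_box_ne_top Q)

lemma memLp_box_iff {q : ℝ} (hq : 1 < q) {f : Amb n → 𝕜} (hf : AEStronglyMeasurable f (mu n))
    (Q : DIdx n) :
    MemLp f (ENNReal.ofReal q) (volume.restrict (box Q)) ↔ coef q f Q ≠ ∞ := by
  have hfQ : AEStronglyMeasurable f (volume.restrict (box Q)) :=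
    hf.mono_ac (ac_of_subset (box_subset_upper Q))
  rw [MemLp, eLpNorm_box_eq, and_iff_right hfQ, ENNReal.mul_lt_top_iff, lt_top_iff_ne_top,
    lt_top_iff_ne_top]
  constructor
  · rintro (⟨-, h⟩ | h | h)
    · exact h
    · exact absurd h (by simp [ENNReal.rpow_eq_zero_iff, volume_box_ne_zero, volume_box_ne_top])
    · simp [h]
  · exact fun h => Or.inl ⟨volume_box_rpow_ne_top hq Q, h⟩

/-- A compact set stays away from the boundary and is bounded, so the boxes meeting it have measure
bounded below and lie in a bounded set; being disjoint, they are finite in number. -/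
lemma finite_box_inter {K : Set (Amb n)} (hK : IsCompact K) (hKu : K ⊆ upper n) :
    {Q : DIdx n | (box Q ∩ K).Nonempty}.Finite := by
  rcases K.eq_empty_or_nonempty with rfl | hne
  · simp
  obtain ⟨a₀, ha₀, hmin⟩ := hK.exists_isMinOn hne continuous_fst.continuousOn
  obtain ⟨R, hR⟩ := hK.isBounded.subset_closedBall (0 : Amb n)
  have hε : 0 < a₀.1 := hKu ha₀
  have hab : ∀ b ∈ K, a₀.1 ≤ b.1 ∧ b.1 ≤ R ∧ ‖b.2‖ ≤ R := by
    intro b hb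
    have h1 := hR hb
    rw [mem_closedBall_zero_iff, Prod.norm_def, max_le_iff, Real.norm_eq_abs] at h1
    exact ⟨hmin hb, (le_abs_self _).trans h1.1, h1.2⟩
  have hRpos : 0 < R := hε.trans_le (hab a₀ ha₀).2.1
  set ε : ℝ≥0∞ := ENNReal.ofReal (a₀.1 / 4) * ENNReal.ofReal (a₀.1 / 4) ^ n with hεdef
  have hε0 : 0 < ε := by
    refine pos_iff_ne_zero.2 (mul_ne_zero ?_ (ofReal_pow_ne_zero (by positivity) n))
    simpa using hε
  have hside : ∀ Q : DIdx n, (box Q ∩ K).Nonempty → a₀.1 / 4 ≤ side Q ∧ side Q ≤ R := by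
    rintro Q ⟨b, hb, hbK⟩
    obtain ⟨h1, h2, -⟩ := mem_box_iff.1 hb
    have := hab b hbK
    constructor <;> linarith [side_pos Q]
  have hfin := Measure.finite_const_le_meas_of_disjoint_iUnion (volume : Measure (Amb n)) hε0
    (As := fun Q : {Q : DIdx n // (box Q ∩ K).Nonempty} => box Q.1)
    (fun Q => measurableSet_box Q.1)
    (fun Q S hQS => pairwise_disjoint_box fun h => hQS (Subtype.ext h)) ?_
  · have huniv : {Q : {Q : DIdx n // (box Q ∩ K).Nonempty} | ε ≤ volume (box Q.1)} = univ := by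
      refine eq_univ_of_forall fun Q => ?_
      have h1 := (hside Q.1 Q.2).1
      have h2 := side_pos Q.1
      show ε ≤ volume (box Q.1)
      rw [volume_box, volume_dcube, hεdef]
      gcongr
      linarith
    rw [huniv] at hfin
    exact (hfin.image Subtype.val).subset fun Q hQ => ⟨⟨Q, hQ⟩, mem_univ _, rfl⟩
  · have hb : Bornology.IsBounded (Ioo 0 (4 * R) ×ˢ ball (0 : Bdry n) (R + (n * R + 1))) :=
      (Metric.isBounded_Ioo _ _).prod Metric.isBounded_ball
    refine ((measure_mono (iUnion_subset fun Q b hb => ?_)).trans_lt hb.measure_lt_top).ne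
    obtain ⟨h1, h2, h3⟩ := mem_box_iff.1 hb
    have h4 := side_pos Q.1
    have h5 := (hside Q.1 Q.2).2
    refine ⟨⟨by linarith, by linarith⟩, ?_⟩
    obtain ⟨c, hc, hcK⟩ := Q.2
    have h6 := norm_le_of_abs_le (v := b.2 - c.2)
      fun i => (abs_sub_lt_side h3 (mem_box_iff.1 hc).2.2 i).le
    have h7 : ‖b.2‖ ≤ ‖b.2 - c.2‖ + ‖c.2‖ := norm_le_norm_sub_add _ _
    have h8 := (hab c hcK).2.2
    have h9 : (n : ℝ) * side Q.1 ≤ n * R := by gcongr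
    rw [mem_ball_zero_iff]
    linarith

/-- Local integrability is thus automatic for functions of finite dyadic norm. -/
lemma locLq_of_coef_ne_top {q : ℝ} (hq : 1 < q) {f : Amb n → 𝕜}
    (hf : AEStronglyMeasurable f (mu n)) (h : ∀ Q, coef q f Q ≠ ∞) : LocLq q f := by
  intro K hK hKu
  have hfin := finite_box_inter hK hKu
  have hq0 : ENNReal.ofReal q ≠ 0 := by simp; linarith
  have hcov : K ⊆ ⋃ Q ∈ hfin.toFinset, box Q := by
    intro a ha
    obtain ⟨Q, hQ⟩ := exists_mem_box (hKu ha)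
    simp only [mem_iUnion, Finite.mem_toFinset]
    exact ⟨Q, ⟨a, hQ, ha⟩, hQ⟩
  have hU : MemLp f (ENNReal.ofReal q) (volume.restrict (⋃ Q ∈ hfin.toFinset, box Q)) := by
    refine ⟨hf.mono_ac (ac_of_subset (iUnion₂_subset fun Q _ => box_subset_upper Q)), ?_⟩
    rw [eLpNorm_lt_top_iff_lintegral_rpow_enorm_lt_top hq0 ENNReal.ofReal_ne_top,
      lintegral_biUnion_finset (fun Q _ R _ hQR => pairwise_disjoint_box hQR)
        fun Q _ => measurableSet_box Q]
    refine ENNReal.sum_lt_top.2 fun Q _ => ?_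
    rw [← eLpNorm_lt_top_iff_lintegral_rpow_enorm_lt_top hq0 ENNReal.ofReal_ne_top]
    exact ((memLp_box_iff hq hf Q).2 (h Q)).2
  exact hU.mono_measure (Measure.restrict_mono hcov le_rfl)

lemma const_mul_le_eLpNorm {p : ℝ} (hp : 1 < p) {F : Bdry n → ℝ≥0∞} {Q : DIdx n} {c : ℝ≥0∞}
    (h : ∀ x ∈ dcube Q, c ≤ F x) :
    c * volume (dcube Q) ^ (1 / p) ≤ eLpNorm F (ENNReal.ofReal p) volume := by
  have h1 : ∀ x, (dcube Q).indicator (fun _ => c) x ≤ F x := fun x => by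
    by_cases hx : x ∈ dcube Q
    · rw [indicator_of_mem hx]; exact h x hx
    · simp [hx]
  have h4 := eLpNorm_mono_enorm (μ := volume) (p := ENNReal.ofReal p)
    (f := (dcube Q).indicator fun _ => c) (g := F) h1
  rwa [eLpNorm_indicator_const (measurableSet_dcube Q) (by simp; linarith) (by simp),
    enorm_eq_self, ENNReal.toReal_ofReal (by linarith)] at h4

lemma zcoef_mul_le_zNorm {p : ℝ} (hp : 1 < p) (q : ℝ) (f : Amb n → 𝕜) (Q : DIdx n) :
    zcoef q f Q * volume (dcube Q) ^ (1 / p) ≤ zNorm p q f := by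
  refine const_mul_le_eLpNorm hp fun x hx => ?_
  refine le_trans ?_ (ENNReal.le_tsum Q)
  rw [indicator_of_mem hx]

lemma coef_mul_le_xNorm {p : ℝ} (hp : 1 < p) (q : ℝ) (f : Amb n → 𝕜) (Q : DIdx n) :
    coef q f Q * volume (dcube Q) ^ (1 / p) ≤ xNorm p q f :=
  const_mul_le_eLpNorm hp fun _ hx => le_supFun _ hx

lemma volume_dcube_rpow_ne_zero {p : ℝ} (Q : DIdx n) : volume (dcube Q) ^ (1 / p) ≠ 0 := by
  simp [ENNReal.rpow_eq_zero_iff, volume_dcube_ne_zero, volume_dcube_ne_top]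

lemma ofReal_side_ne_zero (Q : DIdx n) : ENNReal.ofReal (side Q) ≠ 0 := by
  simpa using side_pos Q

lemma coef_ne_top_of_zNorm {p q : ℝ} (hp : 1 < p) {f : Amb n → 𝕜} (h : zNorm p q f ≠ ∞)
    (Q : DIdx n) : coef q f Q ≠ ∞ := by
  intro hQ
  refine h (top_le_iff.1 ((zcoef_mul_le_zNorm hp q f Q).trans' ?_))
  rw [zcoef, hQ, ENNReal.mul_top (ofReal_side_ne_zero Q),
    ENNReal.top_mul (volume_dcube_rpow_ne_zero Q)]

lemma coef_ne_top_of_xNorm {p q : ℝ} (hp : 1 < p) {f : Amb n → 𝕜} (h : xNorm p q f ≠ ∞)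
    (Q : DIdx n) : coef q f Q ≠ ∞ := by
  intro hQ
  refine h (top_le_iff.1 ((coef_mul_le_xNorm hp q f Q).trans' ?_))
  rw [hQ, ENNReal.top_mul (volume_dcube_rpow_ne_zero Q)]

/-- Control of the `L_q` norm over a box by the norm of `Z`. -/
lemma exists_eLpNorm_box_le_zNorm {p q : ℝ} (hp : 1 < p) (hq : 1 < q) (Q : DIdx n) :
    ∃ C : ℝ≥0∞, C ≠ ∞ ∧ ∀ f : Amb n → 𝕜,
      eLpNorm f (ENNReal.ofReal q) (volume.restrict (box Q)) ≤ C * zNorm p q f := by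
  set D : ℝ≥0∞ := ENNReal.ofReal (side Q) * volume (dcube Q) ^ (1 / p) with hD
  have hD0 : D ≠ 0 := mul_ne_zero (ofReal_side_ne_zero Q) (volume_dcube_rpow_ne_zero Q)
  have hDt : D ≠ ∞ := ENNReal.mul_ne_top ENNReal.ofReal_ne_top
    (ENNReal.rpow_ne_top_of_nonneg (by positivity) (volume_dcube_ne_top Q))
  refine ⟨volume (box Q) ^ (1 / q) * D⁻¹, ENNReal.mul_ne_top (volume_box_rpow_ne_top hq Q)
    (ENNReal.inv_ne_top.2 hD0), fun f => ?_⟩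
  rw [eLpNorm_box_eq, mul_assoc]
  gcongr
  calc coef q f Q = D⁻¹ * (D * coef q f Q) := by
        rw [← mul_assoc, ENNReal.inv_mul_cancel hD0 hDt, one_mul]
    _ = D⁻¹ * (zcoef q f Q * volume (dcube Q) ^ (1 / p)) := by rw [hD, zcoef]; ring
    _ ≤ _ := by gcongr; exact zcoef_mul_le_zNorm hp q f Q

/-- The union of the boxes with index in a given set. -/
def boxes (T : Set (DIdx n)) : Set (Amb n) := ⋃ Q ∈ T, box Q

lemma measurableSet_boxes (T : Set (DIdx n)) : MeasurableSet (boxes T) :=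
  MeasurableSet.biUnion T.to_countable fun Q _ => measurableSet_box Q

lemma mem_boxes_iff {T : Set (DIdx n)} {Q : DIdx n} {a : Amb n} (ha : a ∈ box Q) :
    a ∈ boxes T ↔ Q ∈ T := by
  simp only [boxes, mem_iUnion, exists_prop]
  constructor
  · rintro ⟨R, hR, haR⟩
    rwa [slab_eq_of_mem two_pos ha haR]
  · exact fun h => ⟨Q, h, ha⟩

lemma coef_zero (q : ℝ) (Q : DIdx n) : coef q (0 : Amb n → 𝕜) Q = 0 := by
  rw [coef, avgNorm, eLpNorm_zero, mul_zero]

-- Cutting along whole boxes only deletes coefficients, which is why all restrictions below are to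
-- unions of boxes.
open Classical in
lemma coef_indicator_boxes (q : ℝ) (f : Amb n → 𝕜) (T : Set (DIdx n)) (Q : DIdx n) :
    coef q ((boxes T).indicator f) Q = if Q ∈ T then coef q f Q else 0 := by
  split_ifs with h
  · refine coef_congr q ?_
    filter_upwards [self_mem_ae_restrict (measurableSet_box Q)] with a ha
    rw [indicator_of_mem ((mem_boxes_iff ha).2 h)]
  · rw [← coef_zero (𝕜 := 𝕜) q Q]
    refine coef_congr q ?_
    filter_upwards [self_mem_ae_restrict (measurableSet_box Q)] with a ha
    rw [indicator_of_notMem (fun h' => h ((mem_boxes_iff ha).1 h')), Pi.zero_apply]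

lemma indicator_boxes_add_compl (f : Amb n → 𝕜) (T : Set (DIdx n)) :
    f =ᵐ[mu n] (boxes T).indicator f + (boxes Tᶜ).indicator f := by
  filter_upwards [self_mem_ae_restrict (isOpen_upper n).measurableSet] with a ha
  obtain ⟨Q, hQ⟩ := exists_mem_box ha
  by_cases h : Q ∈ T
  · simp [indicator, mem_boxes_iff hQ, h]
  · simp [indicator, mem_boxes_iff hQ, h]

lemma coef_indicator_boxes_le (q : ℝ) (f : Amb n → 𝕜) (T : Set (DIdx n)) (Q : DIdx n) :
    coef q ((boxes T).indicator f) Q ≤ coef q f Q := by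
  classical
  rw [coef_indicator_boxes]
  split_ifs
  exacts [le_rfl, zero_le]

lemma eLpNorm_mono_ennreal {β : Type*} [MeasurableSpace β] {μ : Measure β} {p : ℝ≥0∞}
    {F G : β → ℝ≥0∞} (h : ∀ x, F x ≤ G x) : eLpNorm F p μ ≤ eLpNorm G p μ :=
  eLpNorm_mono_enorm h

lemma zNorm_indicator_boxes_le (p q : ℝ) (f : Amb n → 𝕜) (T : Set (DIdx n)) :
    zNorm p q ((boxes T).indicator f) ≤ zNorm p q f :=
  eLpNorm_mono_ennreal fun _ => ENNReal.tsum_le_tsum fun Q =>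
    indicator_le_indicator (mul_le_mul_right (coef_indicator_boxes_le q f T Q) _)

lemma xNorm_indicator_boxes_le (p q : ℝ) (f : Amb n → 𝕜) (T : Set (DIdx n)) :
    xNorm p q ((boxes T).indicator f) ≤ xNorm p q f :=
  eLpNorm_mono_ennreal fun _ => iSup_mono fun Q =>
    indicator_le_indicator (coef_indicator_boxes_le q f T Q)

/-- Membership in `Z` in terms of the dyadic norm. -/
lemma mem_ZSpace_of_zNorm {p q : ℝ} [hp : Fact (1 < p)] [hq : Fact (1 < q)]
    (f : Amb n →ₘ[mu n] 𝕜) (h : zNorm p q f ≠ ∞) : f ∈ ZSpace 𝕜 n p q := by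
  refine ⟨locLq_of_coef_ne_top hq.out f.aestronglyMeasurable (coef_ne_top_of_zNorm hp.out h), ?_⟩
  obtain ⟨C, hC, H⟩ := exists_carlesonNorm_le_zNorm (𝕜 := 𝕜) n hp.out hq.out
  exact (H f).trans_lt (ENNReal.mul_lt_top hC.lt_top h.lt_top)

/-- Membership in `X` in terms of the dyadic norm. -/
lemma mem_XSpace_of_xNorm {α p q : ℝ} [hα : Fact (0 < α)] [hp : Fact (1 < p)] [hq : Fact (1 < q)]
    (f : Amb n →ₘ[mu n] 𝕜) (h : xNorm p q f ≠ ∞) : f ∈ XSpace 𝕜 n α p q := by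
  refine ⟨locLq_of_coef_ne_top hq.out f.aestronglyMeasurable (coef_ne_top_of_xNorm hp.out h), ?_⟩
  obtain ⟨C, hC, H⟩ := exists_ntNorm_le_xNorm (𝕜 := 𝕜) n hα.out hp.out hq.out
  exact (H f).trans_lt (ENNReal.mul_lt_top hC.lt_top h.lt_top)

lemma zNorm_ne_top (hn : 1 ≤ n) {p q : ℝ} [hp : Fact (1 < p)] [hq : Fact (1 < q)]
    (f : ZSpace 𝕜 n p q) : zNorm p q (f.1 : Amb n → 𝕜) ≠ ∞ := by
  obtain ⟨C, hC, H⟩ := exists_zNorm_le_carlesonNorm (𝕜 := 𝕜) hn hp.out hq.out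
  exact ne_top_of_le_ne_top (ENNReal.mul_ne_top hC f.2.2.ne) (H f.1 f.2.2.ne)

lemma xNorm_ne_top {α p q : ℝ} [hα : Fact (0 < α)] [hp : Fact (1 < p)] [hq : Fact (1 < q)]
    (f : XSpace 𝕜 n α p q) : xNorm p q (f.1 : Amb n → 𝕜) ≠ ∞ := by
  obtain ⟨C, hC, H⟩ := exists_xNorm_le_ntNorm (𝕜 := 𝕜) n hα.out hp.out hq.out
  exact ne_top_of_le_ne_top (ENNReal.mul_ne_top hC f.2.2.ne) (H f.1 f.1.stronglyMeasurable)

/-- The element of `Z` given by a function with finite dyadic norm. -/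
noncomputable def ZSpace.mk {p q : ℝ} [Fact (1 < p)] [Fact (1 < q)] (f : Amb n → 𝕜)
    (hf : AEStronglyMeasurable f (mu n)) (h : zNorm p q f ≠ ∞) : ZSpace 𝕜 n p q :=
  ⟨AEEqFun.mk f hf, mem_ZSpace_of_zNorm _ (by rwa [zNorm_congr p q (AEEqFun.coeFn_mk f hf)])⟩

/-- The element of `X` given by a function with finite dyadic norm. -/
noncomputable def XSpace.mk {α p q : ℝ} [Fact (0 < α)] [Fact (1 < p)] [Fact (1 < q)]
    (f : Amb n → 𝕜) (hf : AEStronglyMeasurable f (mu n)) (h : xNorm p q f ≠ ∞) :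
    XSpace 𝕜 n α p q :=
  ⟨AEEqFun.mk f hf, mem_XSpace_of_xNorm _ (by rwa [xNorm_congr p q (AEEqFun.coeFn_mk f hf)])⟩

lemma ZSpace.coe_mk {p q : ℝ} [Fact (1 < p)] [Fact (1 < q)] {f : Amb n → 𝕜}
    (hf : AEStronglyMeasurable f (mu n)) (h : zNorm p q f ≠ ∞) :
    ((ZSpace.mk f hf h).1 : Amb n → 𝕜) =ᵐ[mu n] f := AEEqFun.coeFn_mk f hf

lemma XSpace.coe_mk {α p q : ℝ} [Fact (0 < α)] [Fact (1 < p)] [Fact (1 < q)] {f : Amb n → 𝕜}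
    (hf : AEStronglyMeasurable f (mu n)) (h : xNorm p q f ≠ ∞) :
    ((XSpace.mk (α := α) f hf h).1 : Amb n → 𝕜) =ᵐ[mu n] f := AEEqFun.coeFn_mk f hf

lemma ZSpace.norm_sub_eq {p q : ℝ} [Fact (1 < p)] [Fact (1 < q)] {f g : ZSpace 𝕜 n p q}
    {h : Amb n → 𝕜} (hfg : (f.1 : Amb n → 𝕜) - (g.1 : Amb n → 𝕜) =ᵐ[mu n] h) :
    ‖f - g‖ = (carlesonNorm p q h).toReal := by
  rw [ZSpace.norm_def]
  congr 1
  exact carlesonNorm_congr p q ((AEEqFun.coeFn_sub f.1 g.1).trans hfg)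

lemma XSpace.norm_sub_eq {α p q : ℝ} [Fact (0 < α)] [Fact (1 < p)] [Fact (1 < q)]
    {f g : XSpace 𝕜 n α p q}
    {h : Amb n → 𝕜} (hfg : (f.1 : Amb n → 𝕜) - (g.1 : Amb n → 𝕜) =ᵐ[mu n] h) :
    ‖f - g‖ = (ntNorm α p q h).toReal := by
  rw [XSpace.norm_def]
  congr 1
  exact ntNorm_congr α p q ((AEEqFun.coeFn_sub f.1 g.1).trans hfg)

/-- Dominated convergence to zero in the norm. -/
lemma tendsto_eLpNorm_zero {β ι : Type*} [MeasurableSpace β] (μ : Measure β) {l : Filter ι}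
    [l.IsCountablyGenerated] {p : ℝ} (hp : 0 < p) {F : ι → β → ℝ≥0∞} {G : β → ℝ≥0∞}
    (hF : ∀ i, Measurable (F i)) (hG : eLpNorm G (ENNReal.ofReal p) μ ≠ ∞)
    (hFG : ∀ i x, F i x ≤ G x) (hlim : ∀ᵐ x ∂μ, Tendsto (fun i => F i x) l (𝓝 0)) :
    Tendsto (fun i => eLpNorm (F i) (ENNReal.ofReal p) μ) l (𝓝 0) := by
  have hp1 : 0 < 1 / p := by positivity
  have hGi : ∫⁻ x, G x ^ p ∂μ ≠ ∞ := by
    intro h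
    rw [eLpNorm_ennreal _ hp, h] at hG
    exact hG (ENNReal.top_rpow_of_pos hp1)
  have h1 : Tendsto (fun i => ∫⁻ x, F i x ^ p ∂μ) l (𝓝 (∫⁻ _, 0 ∂μ)) := by
    refine tendsto_lintegral_filter_of_dominated_convergence (fun x => G x ^ p)
      (Eventually.of_forall fun i => (hF i).pow_const p)
      (Eventually.of_forall fun i => ae_of_all _ fun x => ENNReal.rpow_le_rpow (hFG i x) hp.le)
      hGi ?_
    filter_upwards [hlim] with x hx
    have := (ENNReal.continuous_rpow_const (y := p)).tendsto 0 |>.comp hx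
    rwa [ENNReal.zero_rpow_of_pos hp] at this
  rw [lintegral_zero] at h1
  have h2 := (ENNReal.continuous_rpow_const (y := 1 / p)).tendsto 0 |>.comp h1
  rw [ENNReal.zero_rpow_of_pos hp1] at h2
  refine h2.congr fun i => ?_
  rw [eLpNorm_ennreal _ hp]
  rfl

lemma ae_lt_top_of_eLpNorm {β : Type*} [MeasurableSpace β] {μ : Measure β} {p : ℝ}
    (hp : 0 < p) {G : β → ℝ≥0∞} (hGm : Measurable G) (hG : eLpNorm G (ENNReal.ofReal p) μ ≠ ∞) :
    ∀ᵐ x ∂μ, G x < ∞ := by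
  have hGi : ∫⁻ x, G x ^ p ∂μ ≠ ∞ := by
    intro h
    rw [eLpNorm_ennreal _ hp, h] at hG
    exact hG (ENNReal.top_rpow_of_pos (by positivity))
  filter_upwards [ae_lt_top (hGm.pow_const p) hGi] with x hx
  by_contra hcon
  rw [not_lt, top_le_iff] at hcon
  rw [hcon, ENNReal.top_rpow_of_pos hp] at hx
  exact lt_irrefl _ hx

/-- Approximation in `Z` by restriction to finitely many boxes. -/
lemma tendsto_zNorm_indicator_compl {p q : ℝ} (hp : 1 < p) {f : Amb n → 𝕜}
    (h : zNorm p q f ≠ ∞) :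
    Tendsto (fun S : Finset (DIdx n) => zNorm p q ((boxes (S : Set (DIdx n))ᶜ).indicator f))
      atTop (𝓝 0) := by
  classical
  have hp0 : 0 < p := by linarith
  refine tendsto_eLpNorm_zero volume hp0 (G := sumFun (zcoef q f)) (fun S => measurable_sumFun _) h
    (fun S x => ENNReal.tsum_le_tsum fun Q =>
      indicator_le_indicator (mul_le_mul_right (coef_indicator_boxes_le q f _ Q) _)) ?_
  filter_upwards [ae_lt_top_of_eLpNorm hp0 (measurable_sumFun _) h] with x hx
  -- At almost every x the series of coefficients converges, so its tails vanish; the full sum is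
  -- the dominating function.
  refine (ENNReal.tendsto_tsum_compl_atTop_zero hx.ne).congr fun S => ?_
  refine (tsum_subtype {Q : DIdx n | Q ∉ S}
    fun Q => (dcube Q).indicator (fun _ => zcoef q f Q) x).trans (tsum_congr fun Q => ?_)
  simp only [zcoef, coef_indicator_boxes]
  by_cases hQ : Q ∈ S <;> simp [hQ]

lemma isBounded_box (Q : DIdx n) : Bornology.IsBounded (box Q) := by
  refine (Metric.isBounded_Ico _ _).prod ?_
  refine isBounded_iff.2 ⟨n * side Q, fun x hx y hy => ?_⟩
  rw [dist_eq_norm]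
  exact norm_le_of_abs_le fun i => (abs_sub_lt_side hx hy i).le

lemma bddSupport_of_ae_eq_indicator {f g : Amb n → 𝕜} {B : Set (Amb n)}
    (hB : Bornology.IsBounded B) (h : f =ᵐ[mu n] B.indicator g) : BddSupport f := by
  refine ⟨B, hB, ?_⟩
  filter_upwards [h] with a ha haB
  rw [ha, indicator_of_notMem haB]

lemma lintegral_mu_indicator_boxes {F : Amb n → ℝ≥0∞} (T : Set (DIdx n)) :
    ∫⁻ a, (boxes T).indicator F a ∂(mu n) = ∫⁻ a in boxes T, F a := by
  rw [lintegral_indicator (measurableSet_boxes T), mu, Measure.restrict_restrict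
    (measurableSet_boxes T), inter_eq_left.2
    (show boxes T ⊆ upper n from iUnion₂_subset fun Q _ => box_subset_upper Q)]

lemma lintegral_box_rpow {q : ℝ} (hq : 1 < q) (f : Amb n → 𝕜) (Q : DIdx n) :
    ∫⁻ a in box Q, ‖f a‖ₑ ^ q = volume (box Q) * coef q f Q ^ q := by
  have hq0 : 0 < q := by linarith
  rw [coef, avgNorm_eq hq, ← ENNReal.rpow_mul, one_div_mul_cancel hq0.ne', ENNReal.rpow_one,
    ← mul_assoc, ENNReal.mul_inv_cancel (volume_box_ne_zero Q) (volume_box_ne_top Q), one_mul]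

lemma memLp_indicator_boxes {q : ℝ} (hq : 1 < q) {f : Amb n → 𝕜}
    (hf : AEStronglyMeasurable f (mu n)) (T : Set (DIdx n))
    (h : ∑' Q : T, volume (box Q.1) * coef q f Q ^ q ≠ ∞) :
    MemLp ((boxes T).indicator f) (ENNReal.ofReal q) (mu n) := by
  have hq0 : 0 < q := by linarith
  have hq1 : ENNReal.ofReal q ≠ 0 := by simpa using hq0
  refine ⟨hf.indicator (measurableSet_boxes T), ?_⟩
  rw [eLpNorm_lt_top_iff_lintegral_rpow_enorm_lt_top hq1 ENNReal.ofReal_ne_top,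
    ENNReal.toReal_ofReal hq0.le]
  have h1 : ∀ a, ‖(boxes T).indicator f a‖ₑ ^ q = (boxes T).indicator (fun a => ‖f a‖ₑ ^ q) a := by
    intro a
    by_cases ha : a ∈ boxes T <;> simp [ha, hq0]
  simp only [h1]
  rw [lintegral_mu_indicator_boxes, boxes, lintegral_biUnion T.to_countable
    (fun Q _ => measurableSet_box Q) fun Q _ R _ hQR => pairwise_disjoint_box hQR]
  simp only [lintegral_box_rpow hq]
  exact h.lt_top

/-! ### Density of Z₀ and X₀ -/

lemma dense_ZZero (hn : 1 ≤ n) (p q : ℝ) [hp : Fact (1 < p)] [hq : Fact (1 < q)] :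
    Dense (ZZero 𝕜 n p q) := by
  rw [Metric.dense_iff]
  intro f ε hε
  obtain ⟨C, hC, H⟩ := exists_carlesonNorm_le_zNorm (𝕜 := 𝕜) n hp.out hq.out
  have hz := zNorm_ne_top hn f
  have hlim := ENNReal.Tendsto.const_mul (tendsto_zNorm_indicator_compl hp.out hz) (Or.inr hC)
  rw [mul_zero] at hlim
  obtain ⟨S, hS⟩ := (hlim.eventually (gt_mem_nhds (ENNReal.ofReal_pos.2 hε))).exists
  set g : Amb n → 𝕜 := (boxes (S : Set (DIdx n))).indicator f.1 with hg
  have hgm : AEStronglyMeasurable g (mu n) :=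
    f.1.aestronglyMeasurable.indicator (measurableSet_boxes _)
  have hgz : zNorm p q g ≠ ∞ := ne_top_of_le_ne_top hz (zNorm_indicator_boxes_le p q _ _)
  refine ⟨ZSpace.mk g hgm hgz, ?_, ?_, ?_⟩
  · rw [mem_ball_comm, mem_ball, dist_eq_norm, ZSpace.norm_sub_eq
      (h := (boxes (S : Set (DIdx n))ᶜ).indicator f.1)]
    · refine (ENNReal.toReal_lt_of_lt_ofReal ((H _).trans_lt hS))
    · filter_upwards [ZSpace.coe_mk hgm hgz, indicator_boxes_add_compl (f.1 : Amb n → 𝕜)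
        (S : Set (DIdx n))] with a ha ha'
      rw [Pi.sub_apply, ha]
      rw [Pi.add_apply] at ha'
      rw [sub_eq_iff_eq_add, add_comm]
      exact ha'
  · refine (memLp_congr_ae (ZSpace.coe_mk hgm hgz)).2
      (memLp_indicator_boxes hq.out f.1.aestronglyMeasurable _ ?_)
    have hfin : Fintype (S : Set (DIdx n)) := inferInstance
    rw [tsum_fintype]
    refine ENNReal.sum_ne_top.2 fun Q _ => ENNReal.mul_ne_top (volume_box_ne_top _)
      (ENNReal.rpow_ne_top_of_nonneg (by linarith [hq.out]) (coef_ne_top_of_zNorm hp.out hz _))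
  · refine bddSupport_of_ae_eq_indicator (B := boxes (S : Set (DIdx n))) (g := f.1) ?_
      (ZSpace.coe_mk hgm hgz)
    exact (Bornology.isBounded_biUnion S.finite_toSet).2 fun Q _ => isBounded_box Q

/-- The boxes of bounded size and location on which the average of `f` is bounded. -/
def goodBoxes (q : ℝ) (f : Amb n → 𝕜) (m : ℕ) : Set (DIdx n) :=
  {Q | side Q ≤ m ∧ (∃ y ∈ dcube Q, ‖y‖ ≤ m) ∧ coef q f Q ≤ m}

lemma isBounded_boxes_goodBoxes (q : ℝ) (f : Amb n → 𝕜) (m : ℕ) :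
    Bornology.IsBounded (boxes (goodBoxes q f m)) := by
  have hb : Bornology.IsBounded (Ioo 0 (4 * (m : ℝ) + 1) ×ˢ ball (0 : Bdry n) (m + (n * m + 1))) :=
    (Metric.isBounded_Ioo _ _).prod Metric.isBounded_ball
  refine hb.subset (iUnion₂_subset fun Q hQ b hb => ?_)
  obtain ⟨h1, h2, h3⟩ := mem_box_iff.1 hb
  obtain ⟨h5, ⟨y, hy, hym⟩, -⟩ := hQ
  have h4 := side_pos Q
  refine ⟨⟨by linarith, by linarith⟩, ?_⟩
  have h6 := norm_le_of_abs_le (v := b.2 - y) fun i => (abs_sub_lt_side h3 hy i).le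
  have h7 : ‖b.2‖ ≤ ‖b.2 - y‖ + ‖y‖ := norm_le_norm_sub_add _ _
  have h9 : (n : ℝ) * side Q ≤ n * m := by gcongr
  rw [mem_ball_zero_iff]
  linarith

/-- Approximation in `X` by restriction to good boxes. -/
lemma tendsto_xNorm_indicator_compl (hn : 1 ≤ n) {p q : ℝ} (hp : 1 < p) {f : Amb n → 𝕜}
    (h : xNorm p q f ≠ ∞) :
    Tendsto (fun m : ℕ => xNorm p q ((boxes (goodBoxes q f m)ᶜ).indicator f)) atTop (𝓝 0) := by
  classical
  have hp0 : 0 < p := by linarith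
  refine tendsto_eLpNorm_zero volume hp0 (G := supFun (coef q f)) (fun m => measurable_supFun _) h
    (fun m x => iSup_mono fun Q => indicator_le_indicator (coef_indicator_boxes_le q f _ Q)) ?_
  filter_upwards [ae_lt_top_of_eLpNorm hp0 (measurable_supFun _) h] with x hx
  obtain ⟨k, hk⟩ := ENNReal.exists_nat_gt hx.ne
  obtain ⟨k', hk'⟩ := exists_nat_gt ‖x‖
  -- Removing finitely many boxes does not make a supremum small, so infinitely many small cubes are
  -- kept. For m large, a cube through x can only fail to be good by having side above m; its
  -- coefficient is then at most `xNorm` f · |Q|^{-1/p}, and |Q| ≥ m because n ≥ 1.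
  have hlim : Tendsto (fun m : ℕ => xNorm p q f * ((m : ℝ≥0∞)⁻¹) ^ (1 / p)) atTop (𝓝 0) := by
    have h1 := (ENNReal.continuous_rpow_const (y := 1 / p)).tendsto 0 |>.comp
      ENNReal.tendsto_inv_nat_nhds_zero
    rw [ENNReal.zero_rpow_of_pos (by positivity)] at h1
    have h2 := ENNReal.Tendsto.const_mul h1 (Or.inr h)
    rwa [mul_zero] at h2
  refine tendsto_of_tendsto_of_tendsto_of_le_of_le' tendsto_const_nhds hlim
    (Eventually.of_forall fun _ => zero_le) ?_
  filter_upwards [eventually_ge_atTop (max 1 (max k k'))] with m hm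
  simp only [max_le_iff] at hm
  refine supFun_le fun Q hxQ => ?_
  rw [coef_indicator_boxes]
  split_ifs with hQ
  swap
  · exact zero_le
  have hlarge : (m : ℝ) < side Q := by
    by_contra hcon
    refine hQ ⟨not_lt.1 hcon, ⟨x, hxQ, hk'.le.trans (by exact_mod_cast hm.2.2)⟩, ?_⟩
    exact (le_supFun _ hxQ).trans (hk.le.trans (by exact_mod_cast hm.2.1))
  have hm0 : (m : ℝ≥0∞) ≠ 0 := by
    have := hm.1
    simp only [ne_eq, Nat.cast_eq_zero]
    lia
  have hvol : (m : ℝ≥0∞) ≤ volume (dcube Q) := by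
    rw [volume_dcube]
    calc (m : ℝ≥0∞) ≤ (m : ℝ≥0∞) ^ n := le_self_pow₀ (by exact_mod_cast hm.1) (by lia)
      _ ≤ _ := by
        gcongr
        rw [← ENNReal.ofReal_natCast]
        exact ENNReal.ofReal_le_ofReal hlarge.le
  have hmp0 : (m : ℝ≥0∞) ^ (1 / p) ≠ 0 := by
    simp [ENNReal.rpow_eq_zero_iff, hm0]
  have hmpt : (m : ℝ≥0∞) ^ (1 / p) ≠ ∞ :=
    ENNReal.rpow_ne_top_of_nonneg (by positivity) (by simp)
  rw [ENNReal.inv_rpow, ← div_eq_mul_inv, ENNReal.le_div_iff_mul_le (Or.inl hmp0) (Or.inl hmpt)]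
  refine le_trans ?_ (coef_mul_le_xNorm hp q f Q)
  gcongr

lemma dense_XZero (hn : 1 ≤ n) (α p q : ℝ) [hα : Fact (0 < α)] [hp : Fact (1 < p)]
    [hq : Fact (1 < q)] : Dense (XZero 𝕜 n α p q) := by
  rw [Metric.dense_iff]
  intro f ε hε
  obtain ⟨C, hC, H⟩ := exists_ntNorm_le_xNorm (𝕜 := 𝕜) n hα.out hp.out hq.out
  have hz := xNorm_ne_top f
  have hlim := ENNReal.Tendsto.const_mul (tendsto_xNorm_indicator_compl hn hp.out hz) (Or.inr hC)
  rw [mul_zero] at hlim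
  obtain ⟨m, hm⟩ := (hlim.eventually (gt_mem_nhds (ENNReal.ofReal_pos.2 hε))).exists
  set T : Set (DIdx n) := goodBoxes q (f.1 : Amb n → 𝕜) m with hT
  set g : Amb n → 𝕜 := (boxes T).indicator f.1 with hg
  have hgm : AEStronglyMeasurable g (mu n) :=
    f.1.aestronglyMeasurable.indicator (measurableSet_boxes _)
  have hgz : xNorm p q g ≠ ∞ := ne_top_of_le_ne_top hz (xNorm_indicator_boxes_le p q _ _)
  have hbdd := isBounded_boxes_goodBoxes q (f.1 : Amb n → 𝕜) m
  refine ⟨XSpace.mk g hgm hgz, ?_, ?_, ?_⟩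
  · rw [mem_ball_comm, mem_ball, dist_eq_norm, XSpace.norm_sub_eq (h := (boxes Tᶜ).indicator f.1)]
    · refine (ENNReal.toReal_lt_of_lt_ofReal ((H _).trans_lt hm))
    · filter_upwards [XSpace.coe_mk (α := α) hgm hgz, indicator_boxes_add_compl
        (f.1 : Amb n → 𝕜) T] with a ha ha'
      rw [Pi.sub_apply, ha]
      rw [Pi.add_apply] at ha'
      rw [sub_eq_iff_eq_add, add_comm]
      exact ha'
  · refine (memLp_congr_ae (XSpace.coe_mk hgm hgz)).2
      (memLp_indicator_boxes hq.out f.1.aestronglyMeasurable _ ?_)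
    -- The good boxes are disjoint, lie in a bounded set and carry coefficients at most m; this
    -- gives membership in L_q although there may be infinitely many of them.
    have hle : ∑' Q : T, volume (box Q.1) * coef q (f.1 : Amb n → 𝕜) Q ^ q ≤
        volume (boxes T) * (m : ℝ≥0∞) ^ q := by
      rw [boxes, measure_biUnion T.to_countable (fun Q _ R _ hQR => pairwise_disjoint_box hQR)
        fun Q _ => measurableSet_box Q, ← ENNReal.tsum_mul_right]
      refine ENNReal.tsum_le_tsum fun Q => mul_le_mul_right ?_ _
      exact ENNReal.rpow_le_rpow Q.2.2.2 (by linarith [hq.out])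
    exact ne_top_of_le_ne_top (ENNReal.mul_ne_top hbdd.measure_lt_top.ne
      (ENNReal.rpow_ne_top_of_nonneg (by linarith [hq.out]) (by simp))) hle
  · exact bddSupport_of_ae_eq_indicator hbdd (XSpace.coe_mk hgm hgz)

end

/-! ### Countable subadditivity and completeness of `Z` -/

section

variable {n : ℕ} {𝕜 : Type*} [RCLike 𝕜]

lemma eLpNorm_tsum_le_tsum {β : Type*} [MeasurableSpace β] (μ : Measure β) {p : ℝ} (hp : 1 < p)
    {F : ℕ → β → ℝ≥0∞} (hF : ∀ i, AEMeasurable (F i) μ) :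
    eLpNorm (fun x => ∑' i, F i x) (ENNReal.ofReal p) μ ≤
      ∑' i, eLpNorm (F i) (ENNReal.ofReal p) μ := by
  have hae : (fun x => ∑' i, F i x) =ᵐ[μ] fun x => ∑' i, (hF i).mk (F i) x := by
    filter_upwards [ae_all_iff.2 fun i => (hF i).ae_eq_mk] with x hx
    exact tsum_congr hx
  have hmk : ∀ i, eLpNorm (F i) (ENNReal.ofReal p) μ =
      eLpNorm ((hF i).mk (F i)) (ENNReal.ofReal p) μ := fun i => eLpNorm_congr_ae (hF i).ae_eq_mk
  rw [eLpNorm_congr_ae hae]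
  simp only [hmk, ENNReal.tsum_eq_iSup_sum]
  have hm : ∀ i, Measurable ((hF i).mk (F i)) := fun i => (hF i).measurable_mk
  refine eLpNorm_iSup_le μ (by linarith)
    (F := fun (S : Finset ℕ) x => ∑ i ∈ S, (hF i).mk (F i) x)
    (fun S => Finset.measurable_fun_sum S fun i _ => hm i)
    (Monotone.directed_le fun S T hST x => Finset.sum_le_sum_of_subset hST) fun S => ?_
  refine le_trans ?_ (le_iSup (fun S : Finset ℕ =>
    ∑ i ∈ S, eLpNorm ((hF i).mk (F i)) (ENNReal.ofReal p) μ) S)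
  have h := eLpNorm_sum_le (s := S) (f := fun i => (hF i).mk (F i)) (p := ENNReal.ofReal p) (μ := μ)
    (fun i _ => (hm i).aestronglyMeasurable) (by simpa using hp.le)
  refine le_trans (le_of_eq ?_) h
  congr 1
  ext x
  simp

lemma coef_le_tsum {q : ℝ} (hq : 1 < q) {f : Amb n → 𝕜} {F : ℕ → Amb n → 𝕜}
    (hF : ∀ i, AEStronglyMeasurable (F i) (mu n)) (h : ∀ᵐ a ∂(mu n), ‖f a‖ₑ ≤ ∑' i, ‖F i a‖ₑ)
    (Q : DIdx n) : coef q f Q ≤ ∑' i, coef q (F i) Q := by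
  have hac := ac_of_subset (box_subset_upper Q)
  have h1 : eLpNorm f (ENNReal.ofReal q) (volume.restrict (box Q)) ≤
      ∑' i, eLpNorm (fun a => ‖F i a‖ₑ) (ENNReal.ofReal q) (volume.restrict (box Q)) :=
    (eLpNorm_mono_enorm_ae (f := f) (g := fun a => ∑' i, ‖F i a‖ₑ) (hac.ae_le h)).trans
      (eLpNorm_tsum_le_tsum _ hq fun i => ((hF i).mono_ac hac).enorm)
  simp only [eLpNorm_enorm] at h1
  simp only [coef, avgNorm]
  rw [ENNReal.tsum_mul_left]
  exact mul_le_mul_right h1 _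

/-- Countable Minkowski twice: in L_q over each box, then in L_p over the boundary. Absolutely
convergent series are thereby controlled without passing to limits in the norm. -/
lemma zNorm_le_tsum {p q : ℝ} (hp : 1 < p) (hq : 1 < q) {f : Amb n → 𝕜} {F : ℕ → Amb n → 𝕜}
    (hF : ∀ i, AEStronglyMeasurable (F i) (mu n)) (h : ∀ᵐ a ∂(mu n), ‖f a‖ₑ ≤ ∑' i, ‖F i a‖ₑ) :
    zNorm p q f ≤ ∑' i, zNorm p q (F i) := by
  refine le_trans (eLpNorm_mono_ennreal fun x => ?_)
    (eLpNorm_tsum_le_tsum volume hp fun i => (measurable_sumFun (zcoef q (F i))).aemeasurable)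
  simp only [sumFun]
  rw [ENNReal.tsum_comm]
  refine ENNReal.tsum_le_tsum fun Q => ?_
  by_cases hx : x ∈ dcube Q
  · simp only [indicator_of_mem hx, zcoef]
    rw [ENNReal.tsum_mul_left]
    exact mul_le_mul_right (coef_le_tsum hq hF h Q) _
  · simp [indicator_of_notMem hx]

/-- On a single box the L_q norm is bounded by the norm of Z, so the series of absolute values has
finite L_q norm there. -/
lemma ae_summable_of_tsum_zNorm {p q : ℝ} (hp : 1 < p) (hq : 1 < q) {F : ℕ → Amb n → 𝕜}
    (hF : ∀ i, AEStronglyMeasurable (F i) (mu n)) (h : ∑' i, zNorm p q (F i) ≠ ∞) :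
    ∀ᵐ a ∂(mu n), ∑' i, ‖F i a‖ₑ ≠ ∞ := by
  refine ae_mu_iff.2 fun Q => ?_
  have hac := ac_of_subset (box_subset_upper Q)
  have hq0 : 0 < q := by linarith
  obtain ⟨C, hC, H⟩ := exists_eLpNorm_box_le_zNorm (𝕜 := 𝕜) hp hq Q
  have hm : ∀ i, AEMeasurable (fun a => ‖F i a‖ₑ) (volume.restrict (box Q)) :=
    fun i => ((hF i).mono_ac hac).enorm
  have h1 := eLpNorm_tsum_le_tsum (volume.restrict (box Q)) hq hm
  simp only [eLpNorm_enorm] at h1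
  have h2 : eLpNorm (fun a => ∑' i, ‖F i a‖ₑ) (ENNReal.ofReal q) (volume.restrict (box Q)) ≠ ∞ := by
    refine ne_top_of_le_ne_top (ENNReal.mul_ne_top hC h) (h1.trans ?_)
    rw [← ENNReal.tsum_mul_left]
    exact ENNReal.tsum_le_tsum fun i => H _
  have h3 : ∫⁻ a in box Q, (∑' i, ‖F i a‖ₑ) ^ q ≠ ∞ := by
    intro h
    rw [eLpNorm_ennreal _ hq0, h] at h2
    exact h2 (ENNReal.top_rpow_of_pos (by positivity))
  filter_upwards [ae_lt_top' ((AEMeasurable.tsum hm).pow_const q) h3] with a ha hcon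
  rw [hcon, ENNReal.top_rpow_of_pos hq0] at ha
  exact lt_irrefl _ ha

lemma completeSpace_ZSpace (hn : 1 ≤ n) (p q : ℝ) [hp : Fact (1 < p)] [hq : Fact (1 < q)] :
    CompleteSpace (ZSpace 𝕜 n p q) := by
  refine NormedAddCommGroup.completeSpace_of_summable_imp_tendsto fun u hu => ?_
  obtain ⟨C, hC, H⟩ := exists_zNorm_le_carlesonNorm (𝕜 := 𝕜) hn hp.out hq.out
  obtain ⟨D, hD, K⟩ := exists_carlesonNorm_le_zNorm (𝕜 := 𝕜) n hp.out hq.out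
  set F : ℕ → Amb n → 𝕜 := fun i => (u i).1 with hFdef
  have hF : ∀ i, AEStronglyMeasurable (F i) (mu n) := fun i => (u i).1.aestronglyMeasurable
  have hsum : ∑' i, zNorm p q (F i) ≠ ∞ := by
    have h1 : ∑' i, carlesonNorm p q (F i) ≠ ∞ := by
      have : ∀ i, carlesonNorm p q (F i) = ENNReal.ofReal ‖u i‖ := fun i => by
        rw [ZSpace.norm_def, ENNReal.ofReal_toReal (u i).2.2.ne]
      simp only [this]
      exact hu.tsum_ofReal_ne_top
    refine ne_top_of_le_ne_top (ENNReal.mul_ne_top hC h1) ?_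
    rw [← ENNReal.tsum_mul_left]
    exact ENNReal.tsum_le_tsum fun i => H _ (u i).2.2.ne
  have hae := ae_summable_of_tsum_zNorm hp.out hq.out hF hsum
  have hsm : ∀ᵐ a ∂(mu n), Summable fun i => F i a := by
    filter_upwards [hae] with a ha
    refine Summable.of_nnnorm ?_
    rw [← ENNReal.tsum_coe_ne_top_iff_summable]
    exact ha
  set f : Amb n → 𝕜 := fun a => ∑' i, F i a with hf
  have hfm : AEStronglyMeasurable f (mu n) := by
    refine aestronglyMeasurable_of_tendsto_ae atTop (f := fun N a => ∑ i ∈ Finset.range N, F i a)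
      (fun N => Finset.aestronglyMeasurable_fun_sum _ fun i _ => hF i) ?_
    filter_upwards [hsm] with a ha using ha.hasSum.tendsto_sum_nat
  -- The error after N terms is dominated by the tail of the series, which gives both convergence
  -- and, for N = 0, membership of the sum in Z.
  have htail : ∀ N, zNorm p q (fun a => f a - ∑ i ∈ Finset.range N, F i a) ≤
      ∑' i, zNorm p q (F (i + N)) := by
    intro N
    refine zNorm_le_tsum hp.out hq.out (F := fun i => F (i + N)) (fun i => hF _) ?_
    filter_upwards [hsm, hae] with a ha ha'
    have h1 : f a - ∑ i ∈ Finset.range N, F i a = ∑' i, F (i + N) a := by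
      rw [show f a = ∑' i, F i a from rfl, ← ha.sum_add_tsum_nat_add N, add_sub_cancel_left]
    show ‖f a - ∑ i ∈ Finset.range N, F i a‖ₑ ≤ _
    rw [h1]
    exact enorm_tsum_le_tsum_enorm
  have hfz : zNorm p q f ≠ ∞ := by
    refine ne_top_of_le_ne_top hsum ?_
    simpa using htail 0
  refine ⟨ZSpace.mk f hfm hfz, ?_⟩
  rw [tendsto_iff_norm_sub_tendsto_zero]
  have hlim := ENNReal.Tendsto.const_mul (ENNReal.tendsto_sum_nat_add _ hsum) (Or.inr hD)
  rw [mul_zero] at hlim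
  have hreal := (ENNReal.tendsto_toReal ENNReal.zero_ne_top).comp hlim
  rw [ENNReal.toReal_zero] at hreal
  have hcoe : ∀ N, ((∑ i ∈ Finset.range N, u i : ZSpace 𝕜 n p q).1 : Amb n → 𝕜) =ᵐ[mu n]
      fun a => ∑ i ∈ Finset.range N, F i a := by
    intro N
    have h1 := AEEqFun.coeFn_finsetSum (Finset.range N) fun i => (u i).1
    rw [show (∑ i ∈ Finset.range N, u i : ZSpace 𝕜 n p q).1 = ∑ i ∈ Finset.range N, (u i).1 from
      Submodule.coe_sum _ _ _]
    filter_upwards [h1] with a ha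
    rw [ha, Finset.sum_apply]
  refine squeeze_zero' (Eventually.of_forall fun _ => norm_nonneg _) ?_ hreal
  filter_upwards [hlim.eventually (gt_mem_nhds ENNReal.zero_lt_top)] with N hN
  rw [norm_sub_rev, ZSpace.norm_sub_eq (h := fun a => f a - ∑ i ∈ Finset.range N, F i a)]
  · exact ENNReal.toReal_mono hN.ne ((K _).trans (mul_le_mul_right (htail N) _))
  · filter_upwards [ZSpace.coe_mk hfm hfz, hcoe N] with a ha ha'
    rw [Pi.sub_apply, ha, ha']

end

/-! ### Duality of `L_q` over a finite measure space -/

section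

variable {β : Type*} [MeasurableSpace β] {𝕜 : Type*} [RCLike 𝕜]

/-- A finitely additive set function dominated by a power of a finite measure has a density. -/
lemma exists_density_of_le_rpow (ν : Measure β) [IsFiniteMeasure ν] {ψ : Set β → ℝ} {K : ℝ≥0∞}
    (hK : K ≠ ∞) {r : ℝ} (hr : 0 < r)
    (hadd : ∀ E F, MeasurableSet E → MeasurableSet F → Disjoint E F → ψ (E ∪ F) = ψ E + ψ F)
    (hb : ∀ E, MeasurableSet E → ‖ψ E‖ₑ ≤ K * ν E ^ r) :
    ∃ g : β → ℝ, Measurable g ∧ Integrable g ν ∧ ∀ E, MeasurableSet E → ψ E = ∫ x in E, g x ∂ν := by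
  classical
  have hnull : ∀ E, MeasurableSet E → ν E = 0 → ψ E = 0 := by
    intro E hE h0
    have := hb E hE
    rw [h0, ENNReal.zero_rpow_of_pos hr, mul_zero, nonpos_iff_eq_zero, enorm_eq_zero] at this
    exact this
  have hempty : ψ ∅ = 0 := hnull ∅ MeasurableSet.empty measure_empty
  have hfin : ∀ (E : ℕ → Set β), (∀ i, MeasurableSet (E i)) → Pairwise (Function.onFun Disjoint E) →
      ∀ s : Finset ℕ, ∑ i ∈ s, ψ (E i) = ψ (⋃ i ∈ s, E i) := by
    intro E hE hd s
    induction s using Finset.induction_on with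
    | empty => simp [hempty]
    | insert a s ha ih =>
      rw [Finset.sum_insert ha, ih, Finset.set_biUnion_insert, hadd _ _ (hE a)
        (Finset.measurableSet_biUnion s fun i _ => hE i)]
      refine disjoint_iUnion₂_right.2 fun i hi => hd ?_
      rintro rfl
      exact ha hi
  -- Countable additivity comes from domination: the value of ψ on the remainder after finitely many
  -- sets is at most K ν(remainder)^r, which tends to zero. The value on non-measurable sets is set
  -- to zero, as the definition of a vector measure demands.
  let s : SignedMeasure β :=
    { measureOf' := fun E => if MeasurableSet E then ψ E else 0
      empty' := by simp [hempty]
      not_measurable' := fun E hE => if_neg hE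
      m_iUnion' := by
        intro E hE hd
        simp only [hE, MeasurableSet.iUnion hE, if_true]
        have hU : ∀ s : Finset ℕ, MeasurableSet (⋃ i ∈ s, E i) :=
          fun s => Finset.measurableSet_biUnion s fun i _ => hE i
        have hsub : ∀ s : Finset ℕ, (⋃ i ∈ s, E i) ⊆ ⋃ i, E i :=
          fun s => iUnion₂_subset fun i _ => subset_iUnion E i
        have hdiff : ∀ s : Finset ℕ, ψ (⋃ i, E i) =
            ∑ i ∈ s, ψ (E i) + ψ ((⋃ i, E i) \ ⋃ i ∈ s, E i) := by
          intro s
          rw [hfin E hE hd, ← hadd _ _ (hU s) ((MeasurableSet.iUnion hE).diff (hU s))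
            disjoint_sdiff_right, union_sdiff_cancel (hsub s)]
        have hlim : Tendsto (fun s : Finset ℕ => ν ((⋃ i, E i) \ ⋃ i ∈ s, E i)) atTop (𝓝 0) := by
          have h1 := tendsto_measure_iInter_atTop (μ := ν)
            (s := fun s : Finset ℕ => (⋃ i, E i) \ ⋃ i ∈ s, E i)
            (fun s => ((MeasurableSet.iUnion hE).diff (hU s)).nullMeasurableSet)
            (fun s t hst => sdiff_subset_sdiff_right (biUnion_subset_biUnion_left hst))
            ⟨∅, measure_ne_top _ _⟩
          have h2 : ⋂ s : Finset ℕ, (⋃ i, E i) \ ⋃ i ∈ s, E i = ∅ := by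
            refine eq_empty_of_forall_notMem fun x hx => ?_
            rw [mem_iInter] at hx
            obtain ⟨i, hi⟩ := mem_iUnion.1 (hx ∅).1
            exact (hx {i}).2 (by simpa using hi)
          rwa [h2, measure_empty] at h1
        have hlim2 : Tendsto (fun s : Finset ℕ => ψ ((⋃ i, E i) \ ⋃ i ∈ s, E i)) atTop (𝓝 0) := by
          rw [tendsto_zero_iff_enorm_tendsto_zero]
          have h1 := (ENNReal.continuous_rpow_const (y := r)).tendsto 0 |>.comp hlim
          rw [ENNReal.zero_rpow_of_pos hr] at h1
          have h2 := ENNReal.Tendsto.const_mul h1 (Or.inr hK)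
          rw [mul_zero] at h2
          exact tendsto_of_tendsto_of_tendsto_of_le_of_le tendsto_const_nhds h2 (fun _ => zero_le)
            fun s => hb _ ((MeasurableSet.iUnion hE).diff (hU s))
        have h3 := (tendsto_const_nhds (x := ψ (⋃ i, E i))).sub hlim2
        rw [sub_zero] at h3
        exact h3.congr fun s => by rw [hdiff s, add_sub_cancel_right] }
  have hs : ∀ E, MeasurableSet E → s E = ψ E := fun E hE => if_pos hE
  have hac : s ≪ᵥ ν.toENNRealVectorMeasure := by
    refine VectorMeasure.AbsolutelyContinuous.mk fun E hE h0 => ?_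
    rw [hs E hE]
    rw [Measure.toENNRealVectorMeasure_apply_measurable hE] at h0
    exact hnull E hE h0
  refine ⟨s.rnDeriv ν, SignedMeasure.measurable_rnDeriv s ν, SignedMeasure.integrable_rnDeriv s ν,
    fun E hE => ?_⟩
  rw [← hs E hE, ← withDensityᵥ_apply (SignedMeasure.integrable_rnDeriv s ν) hE,
    SignedMeasure.withDensityᵥ_rnDeriv_eq s ν hac]

/-- The function `ḡ |g|^{r-2}`, which realizes equality in Hölder's inequality. -/
noncomputable def dualFun (r : ℝ) (z : 𝕜) : 𝕜 := (‖z‖ ^ (r - 2) : ℝ) • (starRingEnd 𝕜) z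

/-- At zero the conjugate factor vanishes, so the value of the possibly negative power of the norm
is irrelevant. -/
lemma dualFun_zero (r : ℝ) : dualFun r (0 : 𝕜) = 0 := by simp [dualFun]

lemma dualFun_mul_self {r : ℝ} (hr : 1 < r) (z : 𝕜) : dualFun r z * z = ((‖z‖ ^ r : ℝ) : 𝕜) := by
  rcases eq_or_ne z 0 with rfl | hz
  · simp [Real.zero_rpow (by linarith : r ≠ 0)]
  · have h : 0 < ‖z‖ := norm_pos_iff.2 hz
    rw [dualFun, RCLike.real_smul_eq_coe_mul, mul_assoc, RCLike.conj_mul, ← RCLike.ofReal_pow,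
      ← RCLike.ofReal_mul, ← Real.rpow_natCast, ← Real.rpow_add h]
    congr 2
    norm_num

lemma norm_dualFun {r : ℝ} (hr : 1 < r) (z : 𝕜) : ‖dualFun r z‖ = ‖z‖ ^ (r - 1) := by
  rcases eq_or_ne z 0 with rfl | hz
  · simp [dualFun_zero, Real.zero_rpow (by linarith : r - 1 ≠ 0)]
  · have h : 0 < ‖z‖ := norm_pos_iff.2 hz
    rw [dualFun, norm_smul, RCLike.norm_conj, Real.norm_of_nonneg (by positivity)]
    nth_rewrite 2 [← Real.rpow_one ‖z‖]
    rw [← Real.rpow_add h]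
    congr 1
    ring

lemma enorm_dualFun {r : ℝ} (hr : 1 < r) (z : 𝕜) : ‖dualFun r z‖ₑ = ‖z‖ₑ ^ (r - 1) := by
  rw [← ofReal_norm, norm_dualFun hr, ← ofReal_norm,
    ENNReal.ofReal_rpow_of_nonneg (norm_nonneg _) (by linarith)]

lemma measurable_dualFun (r : ℝ) : Measurable (dualFun r : 𝕜 → 𝕜) :=
  (measurable_norm.pow_const _).smul RCLike.continuous_conj.measurable

lemma enorm_dualFun_rpow {q q' : ℝ} (hq : q.HolderConjugate q') (z : 𝕜) :
    ‖dualFun q' z‖ₑ ^ q = ‖z‖ₑ ^ q' := by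
  rw [enorm_dualFun hq.symm.lt, ← ENNReal.rpow_mul, hq.symm.sub_one_mul_conj]

end

/-! ### Riesz representation on L_q -/

section

variable {β : Type*} [MeasurableSpace β] {𝕜 : Type*} [RCLike 𝕜]

/-- A bounded linear functional on `L_q`, as a map on functions with values off `L_q` ignored. -/
structure IsBoundedOnLp (ν : Measure β) (q : ℝ) (T : (β → 𝕜) → 𝕜) (K : ℝ≥0∞) : Prop where
  add : ∀ f h, MemLp f (ENNReal.ofReal q) ν → MemLp h (ENNReal.ofReal q) ν → T (f + h) = T f + T h
  smul : ∀ (c : 𝕜) f, MemLp f (ENNReal.ofReal q) ν → T (c • f) = c * T f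
  bound : ∀ f, MemLp f (ENNReal.ofReal q) ν → ‖T f‖ₑ ≤ K * eLpNorm f (ENNReal.ofReal q) ν

namespace IsBoundedOnLp

variable {ν : Measure β} {q : ℝ} {T : (β → 𝕜) → 𝕜} {K : ℝ≥0∞}

lemma map_sub (h : IsBoundedOnLp ν q T K) {f g : β → 𝕜} (hf : MemLp f (ENNReal.ofReal q) ν)
    (hg : MemLp g (ENNReal.ofReal q) ν) : T (f - g) = T f - T g := by
  have e : f - g = f + (-1 : 𝕜) • g := by rw [neg_one_smul, sub_eq_add_neg]
  rw [e, h.add _ _ hf (hg.const_smul _), h.smul _ _ hg, neg_one_mul, sub_eq_add_neg]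

lemma map_simpleFunc [IsFiniteMeasure ν] (h : IsBoundedOnLp ν q T K) {g : β → 𝕜}
    (hg : Integrable g ν)
    (hT : ∀ E, MeasurableSet E → T (E.indicator fun _ => 1) = ∫ x in E, g x ∂ν)
    (s : SimpleFunc β 𝕜) : T s = ∫ x, s x * g x ∂ν := by
  have hint : ∀ s : SimpleFunc β 𝕜, Integrable (fun x => s x * g x) ν := fun s => by
    obtain ⟨C, hC⟩ := s.exists_forall_norm_le
    exact hg.bdd_mul s.aestronglyMeasurable (ae_of_all _ hC)
  induction s using SimpleFunc.induction with
  | const c hE =>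
    rename_i E
    have e : ⇑(SimpleFunc.piecewise E hE (SimpleFunc.const β c) (SimpleFunc.const β 0)) =
        c • E.indicator fun _ => (1 : 𝕜) := by
      ext x
      by_cases hx : x ∈ E <;> simp [hx]
    have e2 : ∀ x, (c • E.indicator fun _ => (1 : 𝕜)) x * g x = c * E.indicator g x := by
      intro x
      by_cases hx : x ∈ E <;> simp [hx]
    rw [e, h.smul _ _ (memLp_indicator_const _ hE _ (Or.inr (measure_ne_top _ _))), hT E hE]
    simp only [e2]
    rw [integral_const_mul, integral_indicator hE]
  | add hd hf hk =>
    rename_i f k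
    have e : ⇑(f + k) = ⇑f + ⇑k := SimpleFunc.coe_add f k
    rw [e, h.add _ _ (SimpleFunc.memLp_of_isFiniteMeasure f _ ν)
      (SimpleFunc.memLp_of_isFiniteMeasure k _ ν), hf, hk, ← integral_add (hint f) (hint k)]
    refine integral_congr_ae (ae_of_all _ fun x => ?_)
    simp [add_mul]

/-- Simple approximations with |s_i| ≤ 2|f| converge in L_q, and under the integral by domination.
Integrability of fg is a hypothesis because g is only known to be integrable when this is used to
improve it to L_{q'}. -/
lemma map_measurable [IsFiniteMeasure ν] (h : IsBoundedOnLp ν q T K) (hK : K ≠ ∞) {g : β → 𝕜}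
    (hg : Integrable g ν)
    (hT : ∀ E, MeasurableSet E → T (E.indicator fun _ => 1) = ∫ x in E, g x ∂ν)
    {f : β → 𝕜} (hfm : Measurable f) (hf : MemLp f (ENNReal.ofReal q) ν)
    (hfg : Integrable (fun x => f x * g x) ν) : T f = ∫ x, f x * g x ∂ν := by
  set s : ℕ → SimpleFunc β 𝕜 := SimpleFunc.approxOn f hfm univ 0 (mem_univ _) with hs
  have h1 : Tendsto (fun i => eLpNorm (⇑(s i) - f) (ENNReal.ofReal q) ν) atTop (𝓝 0) :=
    SimpleFunc.tendsto_approxOn_Lp_eLpNorm hfm (mem_univ _) ENNReal.ofReal_ne_top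
      (ae_of_all _ fun x => by simp) (by simpa using hf.2)
  have hsm : ∀ i, MemLp (s i) (ENNReal.ofReal q) ν :=
    fun i => SimpleFunc.memLp_of_isFiniteMeasure (s i) _ ν
  have h2 : Tendsto (fun i => T (s i)) atTop (𝓝 (T f)) := by
    rw [tendsto_iff_norm_sub_tendsto_zero]
    simp only [← h.map_sub (hsm _) hf]
    rw [← tendsto_zero_iff_norm_tendsto_zero, tendsto_zero_iff_enorm_tendsto_zero]
    have h3 := ENNReal.Tendsto.const_mul h1 (Or.inr hK)
    rw [mul_zero] at h3
    exact tendsto_of_tendsto_of_tendsto_of_le_of_le tendsto_const_nhds h3 (fun _ => zero_le)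
      fun i => h.bound _ ((hsm i).sub hf)
  have h3 : Tendsto (fun i => ∫ x, s i x * g x ∂ν) atTop (𝓝 (∫ x, f x * g x ∂ν)) := by
    refine tendsto_integral_of_dominated_convergence (fun x => 2 * ‖f x * g x‖)
      (fun i => (s i).aestronglyMeasurable.mul hg.aestronglyMeasurable) (hfg.norm.const_mul 2)
      (fun i => ae_of_all _ fun x => ?_) (ae_of_all _ fun x => ?_)
    · rw [norm_mul, norm_mul, ← mul_assoc]
      refine mul_le_mul_of_nonneg_right ?_ (norm_nonneg _)
      rw [two_mul]
      exact SimpleFunc.norm_approxOn_zero_le hfm (mem_univ _) x i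
    · exact (SimpleFunc.tendsto_approxOn hfm (mem_univ _) (by simp)).mul_const _
  refine tendsto_nhds_unique h2 (h3.congr fun i => ?_)
  rw [h.map_simpleFunc hg hT]

/-- Riesz representation of bounded functionals on `L_q` of a finite measure. -/
lemma exists_density [IsFiniteMeasure ν] {q' : ℝ} (hq : q.HolderConjugate q')
    (h : IsBoundedOnLp ν q T K) (hK : K ≠ ∞) :
    ∃ g : β → 𝕜, Measurable g ∧ MemLp g (ENNReal.ofReal q') ν ∧
      ∀ f, MemLp f (ENNReal.ofReal q) ν → T f = ∫ x, f x * g x ∂ν := by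
  have hq0 := hq.pos
  have hq0' := hq.symm.pos
  have hqe : ENNReal.ofReal q ≠ 0 := by simpa using hq0
  have hqe' : ENNReal.ofReal q' ≠ 0 := by simpa using hq0'
  have hind : ∀ {E : Set β}, MeasurableSet E →
      MemLp (E.indicator fun _ => (1 : 𝕜)) (ENNReal.ofReal q) ν :=
    fun hE => memLp_indicator_const _ hE _ (Or.inr (measure_ne_top _ _))
  have hadd : ∀ E F, MeasurableSet E → MeasurableSet F → Disjoint E F →
      T ((E ∪ F).indicator fun _ => 1) = T (E.indicator fun _ => 1) + T (F.indicator fun _ => 1) := by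
    intro E F hE hF hd
    rw [indicator_union_of_disjoint hd, ← h.add _ _ (hind hE) (hind hF)]
    rfl
  have hb : ∀ E, MeasurableSet E → ‖T (E.indicator fun _ => 1)‖ₑ ≤ K * ν E ^ (1 / q) := by
    intro E hE
    have := h.bound _ (hind hE)
    rwa [eLpNorm_indicator_const hE hqe ENNReal.ofReal_ne_top, enorm_one, one_mul,
      ENNReal.toReal_ofReal hq0.le] at this
  obtain ⟨g₁, hm₁, hi₁, hg₁⟩ := exists_density_of_le_rpow ν
    (ψ := fun E => RCLike.re (T (E.indicator fun _ => 1))) hK (one_div_pos.2 hq0)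
    (fun E F hE hF hd => by rw [hadd E F hE hF hd, map_add])
    fun E hE => (hb E hE).trans' (enorm_le_iff_norm_le.2 (by
      rw [Real.norm_eq_abs]; exact RCLike.abs_re_le_norm _))
  obtain ⟨g₂, hm₂, hi₂, hg₂⟩ := exists_density_of_le_rpow ν
    (ψ := fun E => RCLike.im (T (E.indicator fun _ => 1))) hK (one_div_pos.2 hq0)
    (fun E F hE hF hd => by rw [hadd E F hE hF hd, map_add])
    fun E hE => (hb E hE).trans' (enorm_le_iff_norm_le.2 (by
      rw [Real.norm_eq_abs]; exact RCLike.abs_im_le_norm _))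
  set g : β → 𝕜 := fun x => (g₁ x : 𝕜) + (g₂ x : 𝕜) * RCLike.I with hgdef
  have hgm : Measurable g := (RCLike.measurable_ofReal.comp hm₁).add
    ((RCLike.measurable_ofReal.comp hm₂).mul_const _)
  have hgi : Integrable g ν := hi₁.ofReal.add (hi₂.ofReal.mul_const _)
  have hT : ∀ E, MeasurableSet E → T (E.indicator fun _ => 1) = ∫ x in E, g x ∂ν := by
    intro E hE
    rw [hgdef, integral_add (hi₁.ofReal.mono_measure Measure.restrict_le_self)
      ((hi₂.ofReal.mul_const _).mono_measure Measure.restrict_le_self),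
      integral_mul_const, integral_ofReal, integral_ofReal, ← hg₁ E hE, ← hg₂ E hE,
      RCLike.re_add_im]
  -- The converse of Hölder's inequality: testing with ḡ|g|^{q'-2} on {|g| ≤ N} yields J ≤ K
  -- J^{1/q}. The truncation makes J finite so that it can be divided out, and the bound does not
  -- depend on N.
  have htrunc : ∀ N : ℕ, ∫⁻ x in {x | ‖g x‖ ≤ N}, ‖g x‖ₑ ^ q' ∂ν ≤ K ^ q' := by
    intro N
    set A : Set β := {x | ‖g x‖ ≤ N} with hA
    have hAm : MeasurableSet A := measurableSet_le hgm.norm measurable_const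
    set f : β → 𝕜 := A.indicator fun x => dualFun q' (g x) with hfdef
    have hfm : Measurable f := ((measurable_dualFun q').comp hgm).indicator hAm
    have hfb : ∀ x, ‖f x‖ ≤ (N : ℝ) ^ (q' - 1) := by
      intro x
      by_cases hx : x ∈ A
      · rw [hfdef, indicator_of_mem hx, norm_dualFun hq.symm.lt]
        exact Real.rpow_le_rpow (norm_nonneg _) hx (by linarith [hq.symm.lt])
      · rw [hfdef, indicator_of_notMem hx, norm_zero]
        positivity
    have hf : MemLp f (ENNReal.ofReal q) ν :=
      MemLp.of_bound hfm.aestronglyMeasurable _ (ae_of_all _ hfb)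
    have hfg : Integrable (fun x => f x * g x) ν :=
      hgi.bdd_mul hfm.aestronglyMeasurable (ae_of_all _ hfb)
    have hTf := h.map_measurable hK hgi hT hfm hf hfg
    set J : ℝ≥0∞ := ∫⁻ x in A, ‖g x‖ₑ ^ q' ∂ν with hJ
    have hfgx : ∀ x, f x * g x = ((A.indicator (fun x => ‖g x‖ ^ q') x : ℝ) : 𝕜) := by
      intro x
      by_cases hx : x ∈ A
      · rw [hfdef, indicator_of_mem hx, indicator_of_mem hx, dualFun_mul_self hq.symm.lt]
      · simp [hfdef, indicator_of_notMem hx]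
    have hgpow : ∀ x, ENNReal.ofReal (‖g x‖ ^ q') = ‖g x‖ₑ ^ q' := fun x => by
      rw [← ofReal_norm, ENNReal.ofReal_rpow_of_nonneg (norm_nonneg _) hq0'.le]
    have hJlt : J ≠ ∞ := by
      have h1 : J ≤ ∫⁻ _ in A, ENNReal.ofReal ((N : ℝ) ^ q') ∂ν := by
        refine setLIntegral_mono' hAm fun x hx => ?_
        rw [← hgpow]
        exact ENNReal.ofReal_le_ofReal (Real.rpow_le_rpow (norm_nonneg _) hx hq0'.le)
      refine ne_top_of_le_ne_top ?_ h1
      rw [lintegral_const]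
      exact ENNReal.mul_ne_top ENNReal.ofReal_ne_top (measure_ne_top _ _)
    have hTJ : ‖T f‖ₑ = J := by
      rw [hTf]
      simp only [hfgx]
      rw [integral_ofReal, integral_indicator hAm, integral_eq_lintegral_of_nonneg_ae
        (ae_of_all _ fun x => by positivity) (hgm.norm.pow_const _).aestronglyMeasurable]
      simp only [hgpow]
      rw [← ofReal_norm, RCLike.norm_ofReal, abs_of_nonneg ENNReal.toReal_nonneg,
        ENNReal.ofReal_toReal hJlt]
    have hfJ : eLpNorm f (ENNReal.ofReal q) ν = J ^ (1 / q) := by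
      rw [eLpNorm_eq_lintegral_rpow_enorm_toReal hqe ENNReal.ofReal_ne_top,
        ENNReal.toReal_ofReal hq0.le, hJ, ← lintegral_indicator hAm]
      congr 1
      refine lintegral_congr fun x => ?_
      by_cases hx : x ∈ A
      · rw [hfdef, indicator_of_mem hx, indicator_of_mem hx, enorm_dualFun_rpow hq]
      · rw [hfdef, indicator_of_notMem hx, indicator_of_notMem hx, enorm_zero,
          ENNReal.zero_rpow_of_pos hq0]
    have hmain := h.bound f hf
    rw [hTJ, hfJ] at hmain
    rcases eq_or_ne J 0 with h0 | h0
    · rw [h0]; exact zero_le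
    have h5 : J ^ (1 / q') ≤ K := by
      have e : (1 : ℝ) / q' = 1 - 1 / q := by
        have := hq.inv_add_inv_eq_one
        simp only [one_div]
        linarith
      rw [e, ENNReal.rpow_sub _ _ h0 hJlt, ENNReal.rpow_one]
      refine ENNReal.div_le_of_le_mul ?_
      exact hmain
    calc J = (J ^ (1 / q')) ^ q' := by
          rw [← ENNReal.rpow_mul, one_div_mul_cancel hq0'.ne', ENNReal.rpow_one]
      _ ≤ K ^ q' := ENNReal.rpow_le_rpow h5 hq0'.le
  have hgq : MemLp g (ENNReal.ofReal q') ν := by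
    refine ⟨hgm.aestronglyMeasurable, ?_⟩
    rw [eLpNorm_lt_top_iff_lintegral_rpow_enorm_lt_top hqe' ENNReal.ofReal_ne_top,
      ENNReal.toReal_ofReal hq0'.le]
    have hU : ⋃ N : ℕ, {x | ‖g x‖ ≤ N} = univ :=
      eq_univ_of_forall fun x => mem_iUnion.2 (exists_nat_ge ‖g x‖)
    have hmono : Monotone fun N : ℕ => {x | ‖g x‖ ≤ N} := fun N M hNM x hx =>
      le_trans (show ‖g x‖ ≤ N from hx) (by exact_mod_cast hNM)
    rw [← setLIntegral_univ, ← hU, setLIntegral_iUnion_of_directed _ hmono.directed_le]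
    exact (iSup_le htrunc).trans_lt (ENNReal.rpow_lt_top_of_nonneg hq0'.le hK)
  refine ⟨g, hgm, hgq, fun f hf => ?_⟩
  have hconj := hq.ennrealOfReal
  have hf' : MemLp (hf.1.mk f) (ENNReal.ofReal q) ν := (memLp_congr_ae hf.1.ae_eq_mk).1 hf
  -- The norm bound makes T insensitive to null sets, so f may be replaced by a measurable
  -- representative.
  have e1 : T f = T (hf.1.mk f) := by
    rw [← sub_eq_zero, ← h.map_sub hf hf', ← enorm_eq_zero, ← nonpos_iff_eq_zero]
    refine (h.bound _ (hf.sub hf')).trans ?_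
    rw [eLpNorm_congr_ae (g := 0) ?_, eLpNorm_zero, mul_zero]
    filter_upwards [hf.1.ae_eq_mk] with x hx
    rw [Pi.sub_apply, hx, sub_self, Pi.zero_apply]
  rw [e1, h.map_measurable hK hgi hT hf.1.stronglyMeasurable_mk.measurable hf'
    (hf'.integrable_mul hgq)]
  refine integral_congr_ae ?_
  filter_upwards [hf.1.ae_eq_mk] with x hx
  rw [hx]

end IsBoundedOnLp

end

/-! ### The pairing in terms of the dyadic norms -/

section

variable {n : ℕ} {𝕜 : Type*} [RCLike 𝕜]

/-- Hölder over the box. The identity |box Q| = 2ℓ(Q)|Q| accounts for the factor 2 and for the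
weight ℓ(Q) in `zcoef`. -/
lemma lintegral_box_mul_le {q q' : ℝ} (hq : q.HolderConjugate q') {f g : Amb n → 𝕜}
    (hf : AEStronglyMeasurable f (mu n)) (hg : AEStronglyMeasurable g (mu n)) (Q : DIdx n) :
    ∫⁻ a in box Q, ‖f a‖ₑ * ‖g a‖ₑ ≤ 2 * (zcoef q f Q * volume (dcube Q) * coef q' g Q) := by
  have hac := ac_of_subset (box_subset_upper Q)
  have h1 : ∫⁻ a in box Q, ‖f a‖ₑ * ‖g a‖ₑ ≤
      eLpNorm f (ENNReal.ofReal q) (volume.restrict (box Q)) *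
        eLpNorm g (ENNReal.ofReal q') (volume.restrict (box Q)) := by
    rw [← eLpNorm_enorm f, ← eLpNorm_enorm g, eLpNorm_ennreal _ hq.pos, eLpNorm_ennreal _ hq.symm.pos]
    exact ENNReal.lintegral_mul_le_Lp_mul_Lq _ hq (hf.mono_ac hac).enorm (hg.mono_ac hac).enorm
  refine h1.trans (le_of_eq ?_)
  have hV : volume (box Q) ^ (1 / q) * volume (box Q) ^ (1 / q') = volume (box Q) := by
    rw [← ENNReal.rpow_add _ _ (volume_box_ne_zero Q) (volume_box_ne_top Q), one_div, one_div,
      hq.inv_add_inv_eq_one, ENNReal.rpow_one]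
  rw [eLpNorm_box_eq, eLpNorm_box_eq, zcoef]
  calc _ = volume (box Q) ^ (1 / q) * volume (box Q) ^ (1 / q') * (coef q f Q * coef q' g Q) := by
        ring
    _ = _ := by
        rw [hV, volume_box, ENNReal.ofReal_mul zero_le_two, ENNReal.ofReal_ofNat]
        ring

/-- The pairing is controlled by the dyadic norms. -/
lemma lintegral_mul_le_zNorm_mul_xNorm {p p' q q' : ℝ} (hp : p.HolderConjugate p')
    (hq : q.HolderConjugate q') {f g : Amb n → 𝕜} (hf : AEStronglyMeasurable f (mu n))
    (hg : AEStronglyMeasurable g (mu n)) :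
    ∫⁻ a, ‖f a‖ₑ * ‖g a‖ₑ ∂(mu n) ≤ 2 * (zNorm p q f * xNorm p' q' g) := by
  rw [lintegral_mu]
  refine (ENNReal.tsum_le_tsum (lintegral_box_mul_le hq hf hg)).trans ?_
  rw [ENNReal.tsum_mul_left]
  refine mul_le_mul_right ((tsum_mul_le_lintegral _ _).trans ?_) _
  exact lintegral_mul_le_eLpNorm_mul volume hp (measurable_sumFun _) (measurable_supFun _)

lemma integrable_mul_of_norms {p p' q q' : ℝ} (hp : p.HolderConjugate p')
    (hq : q.HolderConjugate q') {f g : Amb n → 𝕜} (hf : AEStronglyMeasurable f (mu n))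
    (hg : AEStronglyMeasurable g (mu n)) (hfz : zNorm p q f ≠ ∞) (hgx : xNorm p' q' g ≠ ∞) :
    Integrable (fun a => f a * g a) (mu n) := by
  refine ⟨hf.mul hg, ?_⟩
  rw [HasFiniteIntegral]
  simp only [enorm_mul]
  exact (lintegral_mul_le_zNorm_mul_xNorm hp hq hf hg).trans_lt
    (ENNReal.mul_lt_top (by simp) (ENNReal.mul_lt_top hfz.lt_top hgx.lt_top))

lemma enorm_integral_mul_le {p p' q q' : ℝ} (hp : p.HolderConjugate p')
    (hq : q.HolderConjugate q') {f g : Amb n → 𝕜} (hf : AEStronglyMeasurable f (mu n))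
    (hg : AEStronglyMeasurable g (mu n)) :
    ‖∫ a, f a * g a ∂(mu n)‖ₑ ≤ 2 * (zNorm p q f * xNorm p' q' g) := by
  refine (enorm_integral_le_lintegral_enorm _).trans ?_
  simp only [enorm_mul]
  exact lintegral_mul_le_zNorm_mul_xNorm hp hq hf hg

lemma enorm_integral_of_eq_norm {β : Type*} [MeasurableSpace β] {μ : Measure β} {F : β → 𝕜}
    (hF : Integrable F μ) (h : ∀ a, F a = ((‖F a‖ : ℝ) : 𝕜)) :
    ‖∫ a, F a ∂μ‖ₑ = ∫⁻ a, ‖F a‖ₑ ∂μ := by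
  rw [← ofReal_integral_norm_eq_lintegral_enorm hF, integral_congr_ae (ae_of_all _ h),
    integral_ofReal, ← ofReal_norm, RCLike.norm_ofReal,
    abs_of_nonneg (integral_nonneg fun _ => norm_nonneg _)]

/-- A function on finitely many boxes, built from multiples of the dual function of `g`. -/
noncomputable def testFun (q' : ℝ) (g : Amb n → 𝕜) (S : Finset (DIdx n)) (c : DIdx n → ℝ)
    (a : Amb n) : 𝕜 :=
  ∑ Q ∈ S, (box Q).indicator (fun a => (c Q : 𝕜) * dualFun q' (g a)) a

lemma measurable_testFun (q' : ℝ) {g : Amb n → 𝕜} (hg : Measurable g) (S : Finset (DIdx n))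
    (c : DIdx n → ℝ) : Measurable (testFun q' g S c) :=
  Finset.measurable_fun_sum _ fun Q _ =>
    (((measurable_dualFun q').comp hg).const_mul _).indicator (measurableSet_box Q)

open Classical in
lemma testFun_of_mem (q' : ℝ) (g : Amb n → 𝕜) (S : Finset (DIdx n)) (c : DIdx n → ℝ) {Q : DIdx n}
    {a : Amb n} (ha : a ∈ box Q) :
    testFun q' g S c a = if Q ∈ S then (c Q : 𝕜) * dualFun q' (g a) else 0 := by
  have h : ∀ R ∈ S, R ≠ Q →
      (box R).indicator (fun a => (c R : 𝕜) * dualFun q' (g a)) a = 0 := fun R _ hR =>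
    indicator_of_notMem (fun haR => hR (slab_eq_of_mem two_pos haR ha)) _
  split_ifs with hQ
  · rw [testFun, Finset.sum_eq_single_of_mem Q hQ h, indicator_of_mem ha]
  · exact Finset.sum_eq_zero fun R hR => h R hR fun e => hQ (e ▸ hR)

lemma testFun_of_notMem (q' : ℝ) (g : Amb n → 𝕜) (S : Finset (DIdx n)) (c : DIdx n → ℝ)
    {a : Amb n} (ha : ∀ Q, a ∉ box Q) : testFun q' g S c a = 0 :=
  Finset.sum_eq_zero fun R _ => indicator_of_notMem (ha R) _

lemma testFun_mul_eq {q' : ℝ} (hq' : 1 < q') (g : Amb n → 𝕜) (S : Finset (DIdx n))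
    {c : DIdx n → ℝ} (hc : ∀ Q, 0 ≤ c Q) (a : Amb n) :
    testFun q' g S c a * g a = ((‖testFun q' g S c a * g a‖ : ℝ) : 𝕜) := by
  classical
  have key : ∃ t : ℝ, 0 ≤ t ∧ testFun q' g S c a * g a = (t : 𝕜) := by
    by_cases ha : ∃ Q, a ∈ box Q
    · obtain ⟨Q, hQ⟩ := ha
      rw [testFun_of_mem q' g S c hQ]
      split_ifs
      · refine ⟨c Q * ‖g a‖ ^ q', mul_nonneg (hc Q) (by positivity), ?_⟩
        rw [mul_assoc, dualFun_mul_self hq', RCLike.ofReal_mul]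
      · exact ⟨0, le_rfl, by simp⟩
    · rw [testFun_of_notMem q' g S c fun Q hQ => ha ⟨Q, hQ⟩]
      exact ⟨0, le_rfl, by simp⟩
  obtain ⟨t, ht, e⟩ := key
  rw [e, RCLike.norm_ofReal, abs_of_nonneg ht]

-- On a box |`dualFun q' g`|^q = |g|^{q'}, and q'/q = q' - 1.
open Classical in
lemma coef_testFun {q q' : ℝ} (hq : q.HolderConjugate q') (g : Amb n → 𝕜) (S : Finset (DIdx n))
    {c : DIdx n → ℝ} (hc : ∀ Q, 0 ≤ c Q) (Q : DIdx n) :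
    coef q (testFun q' g S c) Q =
      if Q ∈ S then ENNReal.ofReal (c Q) * coef q' g Q ^ (q' - 1) else 0 := by
  have hq0 := hq.pos
  split_ifs with hQ
  · have h1 : ∫⁻ a in box Q, ‖testFun q' g S c a‖ₑ ^ q =
        ENNReal.ofReal (c Q) ^ q * (volume (box Q) * coef q' g Q ^ q') := by
      rw [← lintegral_box_rpow hq.symm.lt, ← lintegral_const_mul' _ _
        (ENNReal.rpow_ne_top_of_nonneg hq0.le ENNReal.ofReal_ne_top)]
      refine setLIntegral_congr_fun (measurableSet_box Q) fun a ha => ?_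
      simp only [testFun_of_mem q' g S c ha, if_pos hQ]
      rw [enorm_mul, ENNReal.mul_rpow_of_nonneg _ _ hq0.le, enorm_dualFun_rpow hq, ← ofReal_norm,
        RCLike.norm_ofReal, abs_of_nonneg (hc Q)]
    rw [coef, avgNorm_eq hq.lt, h1, mul_left_comm, ← mul_assoc (volume (box Q))⁻¹,
      ENNReal.inv_mul_cancel (volume_box_ne_zero Q) (volume_box_ne_top Q), one_mul,
      ENNReal.mul_rpow_of_nonneg _ _ (by positivity), ← ENNReal.rpow_mul, ← ENNReal.rpow_mul,
      mul_one_div_cancel hq0.ne', ENNReal.rpow_one, mul_one_div, hq.symm.div_conj_eq_sub_one]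
  · rw [← coef_zero (𝕜 := 𝕜) q Q]
    refine coef_congr q ?_
    filter_upwards [self_mem_ae_restrict (measurableSet_box Q)] with a ha
    rw [testFun_of_mem q' g S c ha, if_neg hQ, Pi.zero_apply]

lemma lintegral_testFun_mul {q q' : ℝ} (hq : q.HolderConjugate q') (g : Amb n → 𝕜)
    (S : Finset (DIdx n)) {c : DIdx n → ℝ} (hc : ∀ Q, 0 ≤ c Q) :
    ∫⁻ a, ‖testFun q' g S c a * g a‖ₑ ∂(mu n) =
      ∑ Q ∈ S, ENNReal.ofReal (c Q) * (volume (box Q) * coef q' g Q ^ q') := by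
  classical
  have h : ∀ Q, ∫⁻ a in box Q, ‖testFun q' g S c a * g a‖ₑ =
      if Q ∈ S then ENNReal.ofReal (c Q) * (volume (box Q) * coef q' g Q ^ q') else 0 := by
    intro Q
    split_ifs with hQ
    · rw [← lintegral_box_rpow hq.symm.lt, ← lintegral_const_mul' _ _ ENNReal.ofReal_ne_top]
      refine setLIntegral_congr_fun (measurableSet_box Q) fun a ha => ?_
      simp only [testFun_of_mem q' g S c ha, if_pos hQ]
      rw [mul_assoc, dualFun_mul_self hq.symm.lt, enorm_mul, ← ofReal_norm, ← ofReal_norm,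
        RCLike.norm_ofReal, RCLike.norm_ofReal, abs_of_nonneg (hc Q), abs_of_nonneg (by positivity),
        ← ofReal_norm, ENNReal.ofReal_rpow_of_nonneg (norm_nonneg _) hq.symm.pos.le]
    · rw [setLIntegral_congr_fun (g := fun _ => 0) (measurableSet_box Q), lintegral_zero]
      intro a ha
      simp [testFun_of_mem q' g S c ha, hQ]
  rw [lintegral_mu]
  simp only [h]
  rw [tsum_eq_sum (s := S) fun Q hQ => if_neg hQ]
  exact Finset.sum_congr rfl fun Q hQ => if_pos hQ

/-- Control of the dyadic norm of `X` by the pairing with functions on finitely many boxes. -/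
lemma exists_xNorm_le_of_pairing (n : ℕ) {p p' q q' : ℝ} (hp : p.HolderConjugate p')
    (hq : q.HolderConjugate q') :
    ∃ C : ℝ≥0∞, C ≠ ∞ ∧ ∀ (g : Amb n → 𝕜) (K : ℝ≥0∞), Measurable g → (∀ Q, coef q' g Q ≠ ∞) →
      (∀ (f : Amb n → 𝕜) (S : Finset (DIdx n)), Measurable f → zNorm p q f ≠ ∞ →
        (∀ a, a ∉ boxes (S : Set (DIdx n)) → f a = 0) →
        ‖∫ a, f a * g a ∂(mu n)‖ₑ ≤ K * zNorm p q f) →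
      xNorm p' q' g ≤ C * K := by
  classical
  obtain ⟨C, hC, H⟩ := exists_eLpNorm_supFun_le n hp
  refine ⟨C, hC, fun g K hg hcoef htest => H _ K hcoef fun S v hv => ?_⟩
  have hq'1 : 0 < q' - 1 := by linarith [hq.symm.lt]
  -- The multiplier that makes `zcoef` of the test function equal to v_Q wherever g has a nonzero
  -- coefficient. If the coefficient vanishes, the inverse is ∞ and the real part `c Q` is 0; there
  -- only the inequality `hck_le` is available, and it suffices.
  set κ : DIdx n → ℝ≥0∞ := fun Q =>
    v Q * (ENNReal.ofReal (side Q))⁻¹ * (coef q' g Q ^ (q' - 1))⁻¹ with hκ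
  set c : DIdx n → ℝ := fun Q => (κ Q).toReal with hcdef
  have hc : ∀ Q, 0 ≤ c Q := fun Q => ENNReal.toReal_nonneg
  have hpow0 : ∀ {Q}, coef q' g Q ≠ 0 → coef q' g Q ^ (q' - 1) ≠ 0 := fun {Q} h =>
    (ENNReal.rpow_pos (pos_iff_ne_zero.2 h) (hcoef Q)).ne'
  have hpowt : ∀ Q, coef q' g Q ^ (q' - 1) ≠ ∞ := fun Q =>
    ENNReal.rpow_ne_top_of_nonneg hq'1.le (hcoef Q)
  have hside : ∀ Q : DIdx n, ENNReal.ofReal (side Q) * (ENNReal.ofReal (side Q))⁻¹ = 1 := fun Q =>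
    ENNReal.mul_inv_cancel (ofReal_side_ne_zero Q) ENNReal.ofReal_ne_top
  have hck : ∀ Q, coef q' g Q ≠ 0 →
      ENNReal.ofReal (side Q) * (ENNReal.ofReal (c Q) * coef q' g Q ^ (q' - 1)) = v Q := by
    intro Q h
    have hfin : κ Q ≠ ∞ := ENNReal.mul_ne_top (ENNReal.mul_ne_top (hv Q)
      (ENNReal.inv_ne_top.2 (ofReal_side_ne_zero Q))) (ENNReal.inv_ne_top.2 (hpow0 h))
    rw [hcdef, ENNReal.ofReal_toReal hfin, hκ, mul_assoc _ (coef q' g Q ^ (q' - 1))⁻¹,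
      ENNReal.inv_mul_cancel (hpow0 h) (hpowt Q), mul_one, mul_left_comm, hside, mul_one]
  have hck_le : ∀ Q, ENNReal.ofReal (side Q) * (ENNReal.ofReal (c Q) * coef q' g Q ^ (q' - 1)) ≤
      v Q := by
    intro Q
    by_cases h : coef q' g Q = 0
    · rw [h, ENNReal.zero_rpow_of_pos hq'1, mul_zero, mul_zero]
      exact zero_le
    · exact (hck Q h).le
  set f := testFun q' g S c with hf
  have hfz : zNorm p q f ≤ eLpNorm (finSum S v) (ENNReal.ofReal p) volume := by
    refine eLpNorm_mono_ennreal fun x => ?_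
    rw [sumFun, finSum, tsum_eq_sum (s := S)]
    · refine Finset.sum_le_sum fun Q hQ => indicator_le_indicator ?_
      rw [zcoef, coef_testFun hq g S hc, if_pos hQ]
      exact hck_le Q
    · intro Q hQ
      rw [zcoef, coef_testFun hq g S hc, if_neg hQ, mul_zero, indicator_zero]
  have hfz' : zNorm p q f ≠ ∞ := ne_top_of_le_ne_top (eLpNorm_finSum_ne_top hp.lt S hv) hfz
  have hfm : Measurable f := measurable_testFun q' hg S c
  have hsupp : ∀ a, a ∉ boxes (S : Set (DIdx n)) → f a = 0 := by
    intro a ha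
    refine Finset.sum_eq_zero fun Q hQ => indicator_of_notMem (fun haQ => ha ?_) _
    exact (mem_boxes_iff haQ).2 hQ
  -- The pairing of the test function with g is twice the sum required by the supremum criterion.
  have hsum : ∑ Q ∈ S, ENNReal.ofReal (c Q) * (volume (box Q) * coef q' g Q ^ q') =
      2 * ∑ Q ∈ S, v Q * volume (dcube Q) * coef q' g Q := by
    rw [Finset.mul_sum]
    refine Finset.sum_congr rfl fun Q _ => ?_
    by_cases h : coef q' g Q = 0
    · rw [h, ENNReal.zero_rpow_of_pos hq.symm.pos]
      simp
    · have e : coef q' g Q ^ q' = coef q' g Q ^ (q' - 1) * coef q' g Q := by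
        conv_rhs => rw [← ENNReal.rpow_one (coef q' g Q), ← ENNReal.rpow_mul, one_mul]
        rw [← ENNReal.rpow_add _ _ h (hcoef Q), sub_add_cancel]
      rw [e, volume_box, ENNReal.ofReal_mul zero_le_two, ENNReal.ofReal_ofNat]
      conv_rhs => rw [← hck Q h]
      ring
  have hint : Integrable (fun a => f a * g a) (mu n) := by
    refine ⟨(hfm.mul hg).aestronglyMeasurable, ?_⟩
    rw [HasFiniteIntegral, hf, lintegral_testFun_mul hq g S hc, hsum]
    exact ENNReal.mul_lt_top (by simp) (ENNReal.sum_lt_top.2 fun Q _ => ENNReal.mul_lt_top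
      (ENNReal.mul_lt_top (hv Q).lt_top (volume_dcube_ne_top Q).lt_top) (hcoef Q).lt_top)
  have hmain := htest f S hfm hfz' hsupp
  rw [enorm_integral_of_eq_norm hint (testFun_mul_eq hq.symm.lt g S hc),
    lintegral_testFun_mul hq g S hc, hsum] at hmain
  calc ∑ Q ∈ S, v Q * volume (dcube Q) * coef q' g Q
      ≤ 2 * ∑ Q ∈ S, v Q * volume (dcube Q) * coef q' g Q := by
        rw [two_mul]
        exact le_self_add
    _ ≤ K * zNorm p q f := hmain
    _ ≤ _ := mul_le_mul_right hfz _

end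

/-! ### Representation of functionals on `Z` -/

section

variable {n : ℕ} {𝕜 : Type*} [RCLike 𝕜] {p q : ℝ} [hp : Fact (1 < p)] [hq : Fact (1 < q)]

lemma boxes_singleton (Q : DIdx n) : boxes {Q} = box Q := by simp [boxes]

lemma zNorm_add_ne_top (hn : 1 ≤ n) {f g : Amb n → 𝕜} (hf : AEStronglyMeasurable f (mu n))
    (hg : AEStronglyMeasurable g (mu n)) (hfz : zNorm p q f ≠ ∞) (hgz : zNorm p q g ≠ ∞) :
    zNorm p q (f + g) ≠ ∞ := by
  have h := zNorm_ne_top hn (ZSpace.mk f hf hfz + ZSpace.mk g hg hgz)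
  rwa [zNorm_congr p q (g := f + g)] at h
  refine (AEEqFun.coeFn_add _ _).trans ?_
  filter_upwards [ZSpace.coe_mk hf hfz, ZSpace.coe_mk hg hgz] with a ha ha'
  rw [Pi.add_apply, Pi.add_apply, ha, ha']

lemma zNorm_smul_ne_top (hn : 1 ≤ n) (c : 𝕜) {f : Amb n → 𝕜} (hf : AEStronglyMeasurable f (mu n))
    (hfz : zNorm p q f ≠ ∞) : zNorm p q (c • f) ≠ ∞ := by
  have h := zNorm_ne_top hn (c • ZSpace.mk f hf hfz)
  rwa [zNorm_congr p q (g := c • f)] at h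
  refine (AEEqFun.coeFn_smul _ _).trans ?_
  filter_upwards [ZSpace.coe_mk hf hfz] with a ha
  rw [Pi.smul_apply, Pi.smul_apply, ha]

open Classical in
/-- A functional on `Z`, evaluated at functions of finite dyadic norm. -/
noncomputable def evalFun (Ψ : StrongDual 𝕜 (ZSpace 𝕜 n p q)) (f : Amb n → 𝕜) : 𝕜 :=
  if h : AEStronglyMeasurable f (mu n) ∧ zNorm p q f ≠ ∞ then Ψ (ZSpace.mk f h.1 h.2) else 0

lemma evalFun_eq (Ψ : StrongDual 𝕜 (ZSpace 𝕜 n p q)) {f : Amb n → 𝕜}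
    (hf : AEStronglyMeasurable f (mu n)) (hfz : zNorm p q f ≠ ∞) :
    evalFun Ψ f = Ψ (ZSpace.mk f hf hfz) := dif_pos ⟨hf, hfz⟩

lemma evalFun_coe (hn : 1 ≤ n) (Ψ : StrongDual 𝕜 (ZSpace 𝕜 n p q)) (f : ZSpace 𝕜 n p q) :
    evalFun Ψ f.1 = Ψ f := by
  rw [evalFun_eq Ψ f.1.aestronglyMeasurable (zNorm_ne_top hn f)]
  congr 1
  exact Subtype.ext (AEEqFun.mk_coeFn f.1)

lemma evalFun_congr (Ψ : StrongDual 𝕜 (ZSpace 𝕜 n p q)) {f g : Amb n → 𝕜}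
    (hf : AEStronglyMeasurable f (mu n)) (hfz : zNorm p q f ≠ ∞) (h : f =ᵐ[mu n] g) :
    evalFun Ψ f = evalFun Ψ g := by
  rw [evalFun_eq Ψ hf hfz, evalFun_eq Ψ (hf.congr h) (by rwa [← zNorm_congr p q h])]
  congr 1
  exact Subtype.ext (AEEqFun.mk_eq_mk.2 h)

lemma evalFun_add (hn : 1 ≤ n) (Ψ : StrongDual 𝕜 (ZSpace 𝕜 n p q)) {f g : Amb n → 𝕜}
    (hf : AEStronglyMeasurable f (mu n)) (hg : AEStronglyMeasurable g (mu n))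
    (hfz : zNorm p q f ≠ ∞) (hgz : zNorm p q g ≠ ∞) :
    evalFun Ψ (f + g) = evalFun Ψ f + evalFun Ψ g := by
  rw [evalFun_eq Ψ hf hfz, evalFun_eq Ψ hg hgz,
    evalFun_eq Ψ (hf.add hg) (zNorm_add_ne_top hn hf hg hfz hgz), ← map_add]
  rfl

lemma evalFun_smul (hn : 1 ≤ n) (Ψ : StrongDual 𝕜 (ZSpace 𝕜 n p q)) (c : 𝕜) {f : Amb n → 𝕜}
    (hf : AEStronglyMeasurable f (mu n)) (hfz : zNorm p q f ≠ ∞) :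
    evalFun Ψ (c • f) = c * evalFun Ψ f := by
  rw [evalFun_eq Ψ hf hfz, evalFun_eq Ψ (hf.const_smul c) (zNorm_smul_ne_top hn c hf hfz),
    ← smul_eq_mul, ← map_smul]
  rfl

lemma exists_enorm_evalFun_le (n : ℕ) (𝕜 : Type*) [RCLike 𝕜] (p q : ℝ) [hp : Fact (1 < p)]
    [hq : Fact (1 < q)] :
    ∃ C : ℝ≥0∞, C ≠ ∞ ∧ ∀ (Ψ : StrongDual 𝕜 (ZSpace 𝕜 n p q)) (f : Amb n → 𝕜),
      AEStronglyMeasurable f (mu n) → zNorm p q f ≠ ∞ →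
        ‖evalFun Ψ f‖ₑ ≤ C * ‖Ψ‖ₑ * zNorm p q f := by
  obtain ⟨C, hC, H⟩ := exists_carlesonNorm_le_zNorm (𝕜 := 𝕜) n hp.out hq.out
  refine ⟨C, hC, fun Ψ f hf hfz => ?_⟩
  rw [evalFun_eq Ψ hf hfz]
  have h1 : ‖Ψ (ZSpace.mk f hf hfz)‖ₑ ≤ ‖Ψ‖ₑ * ‖ZSpace.mk f hf hfz‖ₑ := by
    rw [← ofReal_norm, ← ofReal_norm, ← ofReal_norm, ← ENNReal.ofReal_mul (norm_nonneg _)]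
    exact ENNReal.ofReal_le_ofReal (Ψ.le_opNorm _)
  have h2 : ‖ZSpace.mk f hf hfz‖ₑ ≤ C * zNorm p q f := by
    rw [← ofReal_norm, ZSpace.norm_def, ENNReal.ofReal_toReal (ZSpace.mk f hf hfz).2.2.ne,
      carlesonNorm_congr p q (ZSpace.coe_mk hf hfz)]
    exact H f
  calc _ ≤ _ := h1
    _ ≤ ‖Ψ‖ₑ * (C * zNorm p q f) := mul_le_mul_right h2 _
    _ = _ := by ring

lemma aestronglyMeasurable_indicator_box {f : Amb n → 𝕜} {Q : DIdx n}
    (hf : AEStronglyMeasurable f (volume.restrict (box Q))) :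
    AEStronglyMeasurable ((box Q).indicator f) (mu n) := by
  rwa [aestronglyMeasurable_indicator_iff (measurableSet_box Q), mu_restrict_box]

lemma exists_zNorm_indicator_box_le {q : ℝ} (p : ℝ) [hp : Fact (1 < p)] (Q : DIdx n) :
    ∃ C : ℝ≥0∞, C ≠ ∞ ∧ ∀ f : Amb n → 𝕜, zNorm p q ((box Q).indicator f) ≤
      C * eLpNorm f (ENNReal.ofReal q) (volume.restrict (box Q)) := by
  classical
  have hp0 : 0 < p := by linarith [hp.out]
  refine ⟨ENNReal.ofReal (side Q) * volume (dcube Q) ^ (1 / p) * volume (box Q) ^ (-(1 / q)),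
    ENNReal.mul_ne_top (ENNReal.mul_ne_top ENNReal.ofReal_ne_top
      (ENNReal.rpow_ne_top_of_nonneg (by positivity) (volume_dcube_ne_top Q))) ?_, fun f => ?_⟩
  · simp [ENNReal.rpow_eq_top_iff, volume_box_ne_zero, volume_box_ne_top]
  · have h : sumFun (zcoef q ((box Q).indicator f)) = (dcube Q).indicator fun _ => zcoef q f Q := by
      ext x
      rw [sumFun, tsum_eq_single Q]
      · rw [zcoef, zcoef, ← boxes_singleton, coef_indicator_boxes, if_pos (mem_singleton Q)]
      · intro R hR
        rw [zcoef, ← boxes_singleton, coef_indicator_boxes, if_neg (by simpa using hR), mul_zero,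
          indicator_zero]
    rw [zNorm, h, eLpNorm_indicator_const (measurableSet_dcube Q) (by simpa using hp0) (by simp),
      enorm_eq_self, ENNReal.toReal_ofReal hp0.le, zcoef, coef, avgNorm]
    exact le_of_eq (by ring)

/-- Extension by zero embeds L_q of a box boundedly into Z, so every functional on Z restricts to a
bounded functional there. -/
lemma isBoundedOnLp_evalFun (hn : 1 ≤ n) (Ψ : StrongDual 𝕜 (ZSpace 𝕜 n p q)) (Q : DIdx n) :
    ∃ K : ℝ≥0∞, K ≠ ∞ ∧
      IsBoundedOnLp (volume.restrict (box Q)) q (fun f => evalFun Ψ ((box Q).indicator f)) K := by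
  obtain ⟨C, hC, H⟩ := exists_zNorm_indicator_box_le (𝕜 := 𝕜) (q := q) p Q
  obtain ⟨D, hD, K⟩ := exists_enorm_evalFun_le n 𝕜 p q
  have hz : ∀ f : Amb n → 𝕜, MemLp f (ENNReal.ofReal q) (volume.restrict (box Q)) →
      zNorm p q ((box Q).indicator f) ≠ ∞ := fun f hf =>
    ne_top_of_le_ne_top (ENNReal.mul_ne_top hC hf.2.ne) (H f)
  refine ⟨D * ‖Ψ‖ₑ * C, ENNReal.mul_ne_top (ENNReal.mul_ne_top hD enorm_ne_top) hC, ?_, ?_, ?_⟩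
  · intro f g hf hg
    show evalFun Ψ ((box Q).indicator (f + g)) = _
    rw [indicator_add']
    exact evalFun_add hn Ψ (aestronglyMeasurable_indicator_box hf.1)
      (aestronglyMeasurable_indicator_box hg.1) (hz f hf) (hz g hg)
  · intro c f hf
    show evalFun Ψ ((box Q).indicator (c • f)) = _
    rw [show (box Q).indicator (c • f) = c • (box Q).indicator f from
      indicator_const_smul (box Q) c f]
    exact evalFun_smul hn Ψ c (aestronglyMeasurable_indicator_box hf.1) (hz f hf)
  · intro f hf
    refine (K Ψ _ (aestronglyMeasurable_indicator_box hf.1) (hz f hf)).trans ?_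
    rw [mul_assoc _ C]
    exact mul_le_mul_right (H f) _

/-- A functional on `Z` is locally represented by a function. -/
lemma exists_local_representation (hn : 1 ≤ n) {q' : ℝ} (hqq : q.HolderConjugate q')
    (Ψ : StrongDual 𝕜 (ZSpace 𝕜 n p q)) :
    ∃ g : Amb n → 𝕜, Measurable g ∧ (∀ Q, coef q' g Q ≠ ∞) ∧
      ∀ (f : Amb n → 𝕜) (S : Finset (DIdx n)), AEStronglyMeasurable f (mu n) → zNorm p q f ≠ ∞ →
        IntegrableOn (fun a => f a * g a) (boxes (S : Set (DIdx n))) (mu n) ∧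
        evalFun Ψ ((boxes (S : Set (DIdx n))).indicator f) =
          ∫ a in boxes (S : Set (DIdx n)), f a * g a ∂(mu n) := by
  classical
  have hfinite : ∀ Q : DIdx n, IsFiniteMeasure (volume.restrict (box Q)) := fun Q =>
    ⟨by rw [Measure.restrict_apply_univ]; exact (volume_box_ne_top Q).lt_top⟩
  have hex : ∀ Q : DIdx n, ∃ g : Amb n → 𝕜, Measurable g ∧
      MemLp g (ENNReal.ofReal q') (volume.restrict (box Q)) ∧
      ∀ f : Amb n → 𝕜, MemLp f (ENNReal.ofReal q) (volume.restrict (box Q)) →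
        evalFun Ψ ((box Q).indicator f) = ∫ a in box Q, f a * g a := by
    intro Q
    obtain ⟨K, hK, h⟩ := isBoundedOnLp_evalFun hn Ψ Q
    exact h.exists_density hqq hK
  choose G hGm hGq hG using hex
  have : Nonempty (DIdx n) := ⟨(0, 0)⟩
  -- The local densities are glued; disjointness of the boxes makes compatibility vacuous.
  obtain ⟨g, hgm, hg⟩ := exists_measurable_piecewise (box : DIdx n → Set (Amb n)) measurableSet_box
    G hGm fun Q R hQR => by
      show EqOn (G Q) (G R) (box Q ∩ box R)
      rw [(pairwise_disjoint_box hQR).inter_eq]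
      exact eqOn_empty _ _
  have hae : ∀ Q, g =ᵐ[volume.restrict (box Q)] G Q := fun Q => by
    filter_upwards [self_mem_ae_restrict (measurableSet_box Q)] with a ha using hg Q ha
  have hgq : ∀ Q, MemLp g (ENNReal.ofReal q') (volume.restrict (box Q)) := fun Q =>
    (memLp_congr_ae (hae Q)).2 (hGq Q)
  refine ⟨g, hgm, fun Q => (memLp_box_iff hqq.symm.lt hgm.aestronglyMeasurable Q).1 (hgq Q),
    fun f S hf hfz => ?_⟩
  have hconj := hqq.ennrealOfReal
  have hfq : ∀ Q, MemLp f (ENNReal.ofReal q) (volume.restrict (box Q)) := fun Q =>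
    (memLp_box_iff hq.out hf Q).2 (coef_ne_top_of_zNorm hp.out hfz Q)
  have hint : ∀ Q, IntegrableOn (fun a => f a * g a) (box Q) (mu n) := fun Q => by
    rw [IntegrableOn, mu_restrict_box]
    exact (hfq Q).integrable_mul (hgq Q)
  have hz : ∀ T : Set (DIdx n), zNorm p q ((boxes T).indicator f) ≠ ∞ := fun T =>
    ne_top_of_le_ne_top hfz (zNorm_indicator_boxes_le p q f T)
  have hm : ∀ T : Set (DIdx n), AEStronglyMeasurable ((boxes T).indicator f) (mu n) := fun T =>
    hf.indicator (measurableSet_boxes T)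
  induction S using Finset.induction_on with
  | empty =>
    have e : ((boxes ((∅ : Finset (DIdx n)) : Set (DIdx n))).indicator f) = (0 : 𝕜) • f := by
      ext a
      simp [boxes]
    rw [e, evalFun_smul hn Ψ _ hf hfz]
    simp [boxes]
  | insert R S hR ih =>
    have e : boxes ((insert R S : Finset (DIdx n)) : Set (DIdx n)) =
        box R ∪ boxes (S : Set (DIdx n)) := by
      simp [boxes]
    have hd : Disjoint (box R) (boxes (S : Set (DIdx n))) :=
      disjoint_left.2 fun a ha haS => hR (by simpa using (mem_boxes_iff ha).1 haS)
    have hz1 := hz {R}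
    have hm1 := hm {R}
    rw [boxes_singleton] at hz1 hm1
    rw [e]
    refine ⟨integrableOn_union.2 ⟨hint R, ih.1⟩, ?_⟩
    rw [indicator_union_of_disjoint hd, setIntegral_union hd (measurableSet_boxes _) (hint R) ih.1,
      ← ih.2, mu_restrict_box]
    refine (evalFun_add hn Ψ hm1 (hm S) hz1 (hz S)).trans ?_
    rw [hG R f (hfq R)]
    congr 1
    refine integral_congr_ae ?_
    filter_upwards [hae R] with a ha
    rw [ha]

/-- Every functional on `Z` is the pairing with a function of finite dyadic norm. -/
lemma exists_representation (hn : 1 ≤ n) {p' q' : ℝ} (hpp : p.HolderConjugate p')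
    (hqq : q.HolderConjugate q') (Ψ : StrongDual 𝕜 (ZSpace 𝕜 n p q)) :
    ∃ g : Amb n → 𝕜, Measurable g ∧ xNorm p' q' g ≠ ∞ ∧
      ∀ f : ZSpace 𝕜 n p q, Ψ f = ∫ a, f.1 a * g a ∂(mu n) := by
  classical
  obtain ⟨g, hgm, hgc, hg⟩ := exists_local_representation hn hqq Ψ
  obtain ⟨C, hC, H⟩ := exists_xNorm_le_of_pairing (𝕜 := 𝕜) n hpp hqq
  obtain ⟨D, hD, K⟩ := exists_enorm_evalFun_le n 𝕜 p q
  have hind : ∀ (f : Amb n → 𝕜) (S : Finset (DIdx n)),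
      ∫ a in boxes (S : Set (DIdx n)), f a * g a ∂(mu n) =
        ∫ a, (boxes (S : Set (DIdx n))).indicator f a * g a ∂(mu n) := by
    intro f S
    rw [← integral_indicator (measurableSet_boxes _)]
    refine integral_congr_ae (ae_of_all _ fun a => ?_)
    by_cases ha : a ∈ boxes (S : Set (DIdx n)) <;> simp [ha]
  have hgx : xNorm p' q' g ≠ ∞ := by
    refine ne_top_of_le_ne_top (ENNReal.mul_ne_top hC (ENNReal.mul_ne_top hD
      (enorm_ne_top (x := Ψ)))) (H g _ hgm hgc fun f S hfm hfz hsupp => ?_)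
    have e : (boxes (S : Set (DIdx n))).indicator f = f :=
      indicator_eq_self.2 fun a ha => by_contra fun h => ha (hsupp a h)
    have h := (hg f S hfm.aestronglyMeasurable hfz).2
    rw [hind, e] at h
    rw [← h]
    exact K Ψ f hfm.aestronglyMeasurable hfz
  refine ⟨g, hgm, hgx, fun f => ?_⟩
  have hfm := f.1.aestronglyMeasurable
  have hfz := zNorm_ne_top hn f
  set F : Amb n → 𝕜 := (f.1 : Amb n → 𝕜) with hF
  have hcm : ∀ T : Set (DIdx n), AEStronglyMeasurable ((boxes T).indicator F) (mu n) := fun T =>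
    hfm.indicator (measurableSet_boxes T)
  have hcz : ∀ T : Set (DIdx n), zNorm p q ((boxes T).indicator F) ≠ ∞ := fun T =>
    ne_top_of_le_ne_top hfz (zNorm_indicator_boxes_le p q F T)
  -- On finitely many boxes the representation is already known, so the discrepancy involves only
  -- the tail of f. Both remaining terms are bounded by the norm of the tail, which tends to zero.
  have hsplit : ∀ S : Finset (DIdx n), Ψ f - ∫ a, F a * g a ∂(mu n) =
      evalFun Ψ ((boxes (S : Set (DIdx n))ᶜ).indicator F) -
        ∫ a, (boxes (S : Set (DIdx n))ᶜ).indicator F a * g a ∂(mu n) := by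
    intro S
    have hae := indicator_boxes_add_compl F (S : Set (DIdx n))
    have e1 : Ψ f = evalFun Ψ ((boxes (S : Set (DIdx n))).indicator F) +
        evalFun Ψ ((boxes (S : Set (DIdx n))ᶜ).indicator F) := by
      rw [← evalFun_coe hn, ← evalFun_add hn Ψ (hcm _) (hcm _) (hcz _) (hcz _)]
      exact evalFun_congr Ψ hfm hfz hae
    have hi : ∀ T : Set (DIdx n), Integrable (fun a => (boxes T).indicator F a * g a) (mu n) :=
      fun T => integrable_mul_of_norms hpp hqq (hcm T) hgm.aestronglyMeasurable (hcz T) hgx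
    have e2 : ∫ a, F a * g a ∂(mu n) =
        ∫ a, (boxes (S : Set (DIdx n))).indicator F a * g a ∂(mu n) +
          ∫ a, (boxes (S : Set (DIdx n))ᶜ).indicator F a * g a ∂(mu n) := by
      rw [← integral_add (hi _) (hi _)]
      refine integral_congr_ae ?_
      filter_upwards [hae] with a ha
      rw [ha, Pi.add_apply, add_mul]
    have e3 : evalFun Ψ ((boxes (S : Set (DIdx n))).indicator F) =
        ∫ a, (boxes (S : Set (DIdx n))).indicator F a * g a ∂(mu n) := by
      rw [← hind]
      exact (hg F S hfm hfz).2
    rw [e1, e2, e3, add_sub_add_left_eq_sub]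
  have hbound : ∀ S : Finset (DIdx n), ‖Ψ f - ∫ a, F a * g a ∂(mu n)‖ₑ ≤
      (D * ‖Ψ‖ₑ + 2 * xNorm p' q' g) * zNorm p q ((boxes (S : Set (DIdx n))ᶜ).indicator F) := by
    intro S
    rw [hsplit S]
    refine (enorm_sub_le).trans ?_
    rw [add_mul]
    refine add_le_add (K Ψ _ (hcm _) (hcz _)) ?_
    refine (enorm_integral_mul_le hpp hqq (hcm _) hgm.aestronglyMeasurable).trans (le_of_eq ?_)
    ring
  have hlim := ENNReal.Tendsto.const_mul (tendsto_zNorm_indicator_compl hp.out hfz)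
    (a := D * ‖Ψ‖ₑ + 2 * xNorm p' q' g) (Or.inr (ENNReal.add_ne_top.2
      ⟨ENNReal.mul_ne_top hD enorm_ne_top, ENNReal.mul_ne_top (by simp) hgx⟩))
  rw [mul_zero] at hlim
  have h0 := ge_of_tendsto hlim (Eventually.of_forall hbound)
  rw [nonpos_iff_eq_zero, enorm_eq_zero, sub_eq_zero] at h0
  exact h0

end

/-! ### `X` as the dual of `Z` -/

section

variable {n : ℕ} {𝕜 : Type*} [RCLike 𝕜]

lemma exists_zNorm_le_norm (hn : 1 ≤ n) (𝕜 : Type*) [RCLike 𝕜] (p q : ℝ) [hp : Fact (1 < p)]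
    [hq : Fact (1 < q)] : ∃ C : ℝ, 0 ≤ C ∧ ∀ f : ZSpace 𝕜 n p q,
      (zNorm p q (f.1 : Amb n → 𝕜)).toReal ≤ C * ‖f‖ := by
  obtain ⟨C, hC, H⟩ := exists_zNorm_le_carlesonNorm (𝕜 := 𝕜) hn hp.out hq.out
  refine ⟨C.toReal, ENNReal.toReal_nonneg, fun f => ?_⟩
  rw [ZSpace.norm_def, ← ENNReal.toReal_mul]
  exact ENNReal.toReal_mono (ENNReal.mul_ne_top hC f.2.2.ne) (H _ f.2.2.ne)

lemma exists_xNorm_le_norm (n : ℕ) (𝕜 : Type*) [RCLike 𝕜] (α p q : ℝ) [hα : Fact (0 < α)]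
    [hp : Fact (1 < p)] [hq : Fact (1 < q)] : ∃ C : ℝ, 0 ≤ C ∧ ∀ f : XSpace 𝕜 n α p q,
      (xNorm p q (f.1 : Amb n → 𝕜)).toReal ≤ C * ‖f‖ := by
  obtain ⟨C, hC, H⟩ := exists_xNorm_le_ntNorm (𝕜 := 𝕜) n hα.out hp.out hq.out
  refine ⟨C.toReal, ENNReal.toReal_nonneg, fun f => ?_⟩
  rw [XSpace.norm_def, ← ENNReal.toReal_mul]
  exact ENNReal.toReal_mono (ENNReal.mul_ne_top hC f.2.2.ne) (H _ f.1.stronglyMeasurable)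

variable {α p q p' q' : ℝ} [hα : Fact (0 < α)] [hp : Fact (1 < p)] [hq : Fact (1 < q)]
  [hp' : Fact (1 < p')] [hq' : Fact (1 < q')]

lemma integrable_pairing (hn : 1 ≤ n) (hpp : p.HolderConjugate p') (hqq : q.HolderConjugate q')
    (g : XSpace 𝕜 n α p' q') (f : ZSpace 𝕜 n p q) :
    Integrable (fun a => f.1 a * g.1 a) (mu n) :=
  integrable_mul_of_norms hpp hqq f.1.aestronglyMeasurable g.1.aestronglyMeasurable
    (zNorm_ne_top hn f) (xNorm_ne_top g)

/-- The pairing `⟨f, g⟩ = ∫ f g` as a bounded bilinear map. -/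
lemma exists_pairing (hn : 1 ≤ n) (hpp : p.HolderConjugate p') (hqq : q.HolderConjugate q') :
    ∃ φ : XSpace 𝕜 n α p' q' →L[𝕜] StrongDual 𝕜 (ZSpace 𝕜 n p q),
      ∀ g f, φ g f = ∫ a, f.1 a * g.1 a ∂(mu n) := by
  obtain ⟨C, hC, H⟩ := exists_zNorm_le_norm hn 𝕜 p q
  obtain ⟨D, hD, K⟩ := exists_xNorm_le_norm n 𝕜 α p' q'
  have hint := integrable_pairing (𝕜 := 𝕜) (α := α) hn hpp hqq
  let B : XSpace 𝕜 n α p' q' →ₗ[𝕜] ZSpace 𝕜 n p q →ₗ[𝕜] 𝕜 := LinearMap.mk₂ 𝕜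
    (fun g f => ∫ a, f.1 a * g.1 a ∂(mu n))
    (by
      intro g h f
      rw [← integral_add (hint g f) (hint h f)]
      refine integral_congr_ae ?_
      filter_upwards [AEEqFun.coeFn_add g.1 h.1] with a ha
      rw [show (g + h).1 = g.1 + h.1 from rfl, ha, Pi.add_apply, mul_add])
    (by
      intro c g f
      rw [smul_eq_mul, ← integral_const_mul]
      refine integral_congr_ae ?_
      filter_upwards [AEEqFun.coeFn_smul c g.1] with a ha
      rw [show (c • g).1 = c • g.1 from rfl, ha, Pi.smul_apply, smul_eq_mul, mul_left_comm])
    (by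
      intro g f h
      rw [← integral_add (hint g f) (hint g h)]
      refine integral_congr_ae ?_
      filter_upwards [AEEqFun.coeFn_add f.1 h.1] with a ha
      rw [show (f + h).1 = f.1 + h.1 from rfl, ha, Pi.add_apply, add_mul])
    (by
      intro c g f
      rw [smul_eq_mul, ← integral_const_mul]
      refine integral_congr_ae ?_
      filter_upwards [AEEqFun.coeFn_smul c f.1] with a ha
      rw [show (c • f).1 = c • f.1 from rfl, ha, Pi.smul_apply, smul_eq_mul, mul_assoc])
  refine ⟨B.mkContinuous₂ (2 * (C * D)) fun g f => ?_, fun g f => rfl⟩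
  have hz := zNorm_ne_top hn f
  have hx := xNorm_ne_top g
  have h := enorm_integral_mul_le hpp hqq f.1.aestronglyMeasurable g.1.aestronglyMeasurable
  have h1 : ‖B g f‖ ≤ 2 * ((zNorm p q (f.1 : Amb n → 𝕜)).toReal *
      (xNorm p' q' (g.1 : Amb n → 𝕜)).toReal) := by
    have h2 := ENNReal.toReal_mono (ENNReal.mul_ne_top (by simp) (ENNReal.mul_ne_top hz hx)) h
    rwa [toReal_enorm, ENNReal.toReal_mul, ENNReal.toReal_mul, ENNReal.toReal_ofNat] at h2
  calc ‖B g f‖ ≤ _ := h1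
    _ ≤ 2 * ((C * ‖f‖) * (D * ‖g‖)) := by
        gcongr
        · exact H f
        · exact K g
    _ = _ := by ring

/-- The lower bound, obtained by testing on finitely many boxes. It yields injectivity and
continuity of the inverse at once. -/
lemma exists_norm_le_of_pairing (hpp : p.HolderConjugate p')
    (hqq : q.HolderConjugate q') :
    ∃ C : ℝ, 0 ≤ C ∧ ∀ (g : XSpace 𝕜 n α p' q') (Ψ : StrongDual 𝕜 (ZSpace 𝕜 n p q)),
      (∀ f, Ψ f = ∫ a, f.1 a * g.1 a ∂(mu n)) → ‖g‖ ≤ C * ‖Ψ‖ := by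
  obtain ⟨A, hA, HA⟩ := exists_ntNorm_le_xNorm (𝕜 := 𝕜) n hα.out hp'.out hq'.out
  obtain ⟨C, hC, H⟩ := exists_xNorm_le_of_pairing (𝕜 := 𝕜) n hpp hqq
  obtain ⟨D, hD, K⟩ := exists_enorm_evalFun_le n 𝕜 p q
  refine ⟨(A * (C * D)).toReal, ENNReal.toReal_nonneg, fun g Ψ hΨ => ?_⟩
  have h1 : xNorm p' q' (g.1 : Amb n → 𝕜) ≤ C * (D * ‖Ψ‖ₑ) := by
    refine H _ _ g.1.stronglyMeasurable.measurable (coef_ne_top_of_xNorm hp'.out (xNorm_ne_top g))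
      fun f S hfm hfz _ => ?_
    have e : ∫ a, f a * g.1 a ∂(mu n) = evalFun Ψ f := by
      rw [evalFun_eq Ψ hfm.aestronglyMeasurable hfz, hΨ]
      refine integral_congr_ae ?_
      filter_upwards [ZSpace.coe_mk hfm.aestronglyMeasurable hfz] with a ha
      rw [ha]
    rw [e]
    exact K Ψ f hfm.aestronglyMeasurable hfz
  have h2 : ntNorm α p' q' (g.1 : Amb n → 𝕜) ≤ A * (C * D) * ‖Ψ‖ₑ := by
    refine (HA _).trans ((mul_le_mul_right h1 A).trans (le_of_eq ?_))
    ring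
  rw [XSpace.norm_def, ← toReal_enorm Ψ, ← ENNReal.toReal_mul]
  exact ENNReal.toReal_mono (ENNReal.mul_ne_top (ENNReal.mul_ne_top hA (ENNReal.mul_ne_top hC hD))
    enorm_ne_top) h2

/-- The duality `X = Z*`. -/
lemma exists_dual_equiv (hn : 1 ≤ n) (hpp : p.HolderConjugate p') (hqq : q.HolderConjugate q') :
    ∃ Φ : XSpace 𝕜 n α p' q' ≃L[𝕜] StrongDual 𝕜 (ZSpace 𝕜 n p q),
      ∀ g f, Φ g f = ∫ a, f.1 a * g.1 a ∂(mu n) := by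
  obtain ⟨φ, hφ⟩ := exists_pairing (𝕜 := 𝕜) (α := α) hn hpp hqq
  obtain ⟨C, hC, H⟩ := exists_norm_le_of_pairing (𝕜 := 𝕜) (n := n) (α := α) hpp hqq
  have hbound : ∀ g, ‖g‖ ≤ C * ‖φ g‖ := fun g => H g (φ g) (hφ g)
  have hinj : Function.Injective φ := by
    refine (injective_iff_map_eq_zero φ).2 fun g hg => ?_
    have := hbound g
    rw [hg, norm_zero, mul_zero] at this
    exact norm_le_zero_iff.1 this
  have hsurj : Function.Surjective φ := by
    intro Ψ
    obtain ⟨g, hgm, hgx, hg⟩ := exists_representation hn hpp hqq Ψ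
    refine ⟨XSpace.mk g hgm.aestronglyMeasurable hgx, ?_⟩
    ext f
    rw [hφ, hg]
    refine integral_congr_ae ?_
    filter_upwards [XSpace.coe_mk (α := α) hgm.aestronglyMeasurable hgx] with a ha
    rw [ha]
  -- Explicit bounds in both directions are used instead of the open mapping theorem, which would
  -- need completeness of X; that completeness is itself deduced from this isomorphism.
  refine ⟨(LinearEquiv.ofBijective φ.toLinearMap ⟨hinj, hsurj⟩).toContinuousLinearEquivOfBounds
    ‖φ‖ C (fun g => φ.le_opNorm g) (fun Ψ => ?_), fun g f => hφ g f⟩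
  refine (hbound _).trans (le_of_eq ?_)
  congr 2
  exact LinearEquiv.apply_symm_apply (LinearEquiv.ofBijective φ.toLinearMap ⟨hinj, hsurj⟩) Ψ

end

/-! ### Non-reflexivity of `Z` -/

section

/-- A criterion for non-reflexivity. -/
lemma not_surjective_inclusionInDoubleDual {𝕜 E : Type*} [RCLike 𝕜] [NormedAddCommGroup E]
    [NormedSpace 𝕜 E] {e : ℕ → E} {R : ℝ} (he : ∀ k, ‖e k‖ ≤ R) {Ψ : ℕ → StrongDual 𝕜 E} {c : 𝕜}
    (hc : c ≠ 0) (h : ∀ m k, m ≤ k → Ψ m (e k) = c)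
    (hlim : ∀ f, Tendsto (fun m => Ψ m f) atTop (𝓝 0)) :
    ¬ Function.Surjective (NormedSpace.inclusionInDoubleDual 𝕜 E) := by
  intro hsurj
  -- By Banach–Alaoglu the images of the bounded sequence e_k have a weak-* cluster point in the
  -- bidual, which surjectivity identifies with an element f. For fixed m the values Ψ_m(e_k) are
  -- eventually c, so Ψ_m(f) = c for all m, against Ψ_m(f) → 0.
  have hK := WeakDual.isCompact_closedBall (0 : StrongDual 𝕜 (StrongDual 𝕜 E)) R
  obtain ⟨Λ, -, hΛ⟩ := hK.exists_mapClusterPt (f := atTop)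
    (u := fun k => StrongDual.toWeakDual (NormedSpace.inclusionInDoubleDual 𝕜 E (e k))) (by
      rw [le_principal_iff, mem_map]
      refine Eventually.of_forall fun k => ?_
      show NormedSpace.inclusionInDoubleDual 𝕜 E (e k) ∈ closedBall 0 R
      exact mem_closedBall.2 ((dist_zero_right (NormedSpace.inclusionInDoubleDual 𝕜 E (e k))).trans_le
        ((NormedSpace.double_dual_bound 𝕜 E (e k)).trans (he k))))
  obtain ⟨f, hf⟩ := hsurj (WeakDual.toStrongDual Λ)
  have hval : ∀ m, Ψ m f = c := by
    intro m
    have h1 : Λ (Ψ m) = Ψ m f := by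
      rw [← NormedSpace.dual_def 𝕜 E f (Ψ m), hf]
      rfl
    have h2 := hΛ.continuousAt_comp (WeakDual.eval_continuous (Ψ m)).continuousAt
    have h3 : Tendsto ((fun Λ : WeakDual 𝕜 (StrongDual 𝕜 E) => Λ (Ψ m)) ∘ fun k =>
        StrongDual.toWeakDual (NormedSpace.inclusionInDoubleDual 𝕜 E (e k))) atTop (𝓝 c) := by
      refine tendsto_const_nhds.congr' ?_
      filter_upwards [eventually_ge_atTop m] with k hk
      exact (h m k hk).symm
    rw [← h1]
    exact eq_of_nhds_neBot (NeBot.mono h2 (inf_le_inf_left _ h3))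
  exact hc (tendsto_nhds_unique (tendsto_const_nhds.congr fun m => (hval m).symm) (hlim f))

end

/-! ### A bounded sequence escaping to the boundary -/

section

variable {n : ℕ} {𝕜 : Type*} [RCLike 𝕜]

/-- The unit dyadic cube. -/
def unitCube (n : ℕ) : DIdx n := (0, 0)

lemma volume_unitCube : volume (dcube (unitCube n)) = 1 := by
  rw [volume_dcube, side, unitCube, zpow_zero, ENNReal.ofReal_one, one_pow]

/-- The boxes of generation `-k` over the unit cube. -/
def layer (n k : ℕ) : Set (DIdx n) := {Q | Q.1 = -k ∧ dcube Q ⊆ dcube (unitCube n)}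

/-- The boxes of generation at most `-m` over the unit cube. -/
def bottom (n m : ℕ) : Set (DIdx n) := {Q | Q.1 ≤ -m ∧ dcube Q ⊆ dcube (unitCube n)}

/-- The dyadic cubes of generation -k inside the unit cube tile it, by nesting. -/
lemma boxes_layer (n k : ℕ) : boxes (layer n k) =
    Ico (2 * (2 : ℝ) ^ (-k : ℤ)) (4 * (2 : ℝ) ^ (-k : ℤ)) ×ˢ dcube (unitCube n) := by
  ext a
  constructor
  · intro ha
    simp only [boxes, mem_iUnion, exists_prop] at ha
    obtain ⟨Q, ⟨hQ, hsub⟩, haQ⟩ := ha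
    obtain ⟨h1, h2, h3⟩ := mem_box_iff.1 haQ
    rw [side, hQ] at h1 h2
    exact ⟨⟨h1, h2⟩, hsub h3⟩
  · rintro ⟨⟨h1, h2⟩, h3⟩
    have hQ := mem_dcube_floor (-k : ℤ) a.2
    have ha : a ∈ box ((-k, fun i => ⌊a.2 i / 2 ^ (-k : ℤ)⌋) : DIdx n) :=
      mem_box_iff.2 ⟨h1, h2, hQ⟩
    refine (mem_boxes_iff ha).2 ⟨rfl, dcube_subset_of_mem hQ h3 ?_⟩
    show -(k : ℤ) ≤ 0
    lia

lemma volume_boxes_layer (n k : ℕ) :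
    volume (boxes (layer n k)) = ENNReal.ofReal (2 * (2 : ℝ) ^ (-k : ℤ)) := by
  rw [boxes_layer, volume_prod_amb, Real.volume_Ico, volume_unitCube, mul_one]
  congr 1
  ring

lemma coef_const {q : ℝ} (hq : 1 < q) (c : 𝕜) (Q : DIdx n) :
    coef q (fun _ => c) Q = ‖c‖ₑ := by
  have hq0 : 0 < q := by linarith
  rw [coef, avgNorm_eq hq, lintegral_const, Measure.restrict_apply_univ, mul_left_comm,
    ENNReal.inv_mul_cancel (volume_box_ne_zero Q) (volume_box_ne_top Q), mul_one,
    ← ENNReal.rpow_mul, mul_one_div_cancel hq0.ne', ENNReal.rpow_one]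

/-- Functions concentrating on the boundary, bounded in `Z`. -/
noncomputable def layerFun (n : ℕ) (𝕜 : Type*) [RCLike 𝕜] (k : ℕ) : Amb n → 𝕜 :=
  (boxes (layer n k)).indicator fun _ => (((2 : ℝ) ^ k : ℝ) : 𝕜)

/-- Indicator functions shrinking to the boundary. -/
noncomputable def bottomFun (n : ℕ) (𝕜 : Type*) [RCLike 𝕜] (m : ℕ) : Amb n → 𝕜 :=
  (boxes (bottom n m)).indicator fun _ => 1

lemma measurable_layerFun (k : ℕ) : Measurable (layerFun n 𝕜 k) :=
  measurable_const.indicator (measurableSet_boxes _)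

lemma measurable_bottomFun (m : ℕ) : Measurable (bottomFun n 𝕜 m) :=
  measurable_const.indicator (measurableSet_boxes _)

lemma eLpNorm_indicator_unitCube {p : ℝ} (hp : 1 < p) :
    eLpNorm ((dcube (unitCube n)).indicator fun _ => (1 : ℝ≥0∞)) (ENNReal.ofReal p) volume = 1 := by
  rw [eLpNorm_indicator_const (measurableSet_dcube _) (by simp; linarith) (by simp),
    volume_unitCube, ENNReal.one_rpow, mul_one, enorm_eq_self]

lemma zNorm_layerFun_le {p q : ℝ} (hp : 1 < p) (hq : 1 < q) (k : ℕ) :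
    zNorm p q (layerFun n 𝕜 k) ≤ 1 := by
  classical
  rw [← eLpNorm_indicator_unitCube (n := n) hp]
  refine eLpNorm_mono_ennreal fun x => ?_
  have hz : ∀ Q : DIdx n, zcoef q (layerFun n 𝕜 k) Q = if Q ∈ layer n k then 1 else 0 := by
    intro Q
    rw [zcoef, layerFun, coef_indicator_boxes]
    split_ifs with hQ
    · rw [coef_const hq, ← ofReal_norm, RCLike.norm_ofReal, abs_of_nonneg (by positivity),
        ← ENNReal.ofReal_mul (side_pos Q).le, side, hQ.1, zpow_neg, zpow_natCast,
        inv_mul_cancel₀ (by positivity), ENNReal.ofReal_one]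
    · rw [mul_zero]
  -- Exactly one cube of generation -k contains x, so at most one term of the sum survives; it is 1
  -- because ℓ(Q) 2^k = 1.
  set Q₀ : DIdx n := (-k, fun i => ⌊x i / 2 ^ (-k : ℤ)⌋) with hQ₀
  have hx₀ : x ∈ dcube Q₀ := mem_dcube_floor _ _
  rw [sumFun, tsum_eq_single Q₀]
  · rw [indicator_of_mem hx₀, hz]
    split_ifs with h
    · rw [indicator_of_mem (h.2 hx₀)]
    · exact zero_le
  · intro Q hQ
    by_cases hx : x ∈ dcube Q
    · rw [indicator_of_mem hx, hz, if_neg]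
      exact fun h => hQ (dcube_eq_of_mem hx hx₀ h.1)
    · exact indicator_of_notMem hx _

lemma xNorm_bottomFun_le {p q : ℝ} (hp : 1 < p) (hq : 1 < q) (m : ℕ) :
    xNorm p q (bottomFun n 𝕜 m) ≤ 1 := by
  classical
  rw [← eLpNorm_indicator_unitCube (n := n) hp]
  refine eLpNorm_mono_ennreal fun x => supFun_le fun Q hx => ?_
  rw [bottomFun, coef_indicator_boxes]
  split_ifs with h
  · rw [coef_const hq, enorm_one, indicator_of_mem (h.2 hx)]
  · exact zero_le

/-- The layer lies in the bottom set, has measure 2 · 2^{-k}, and carries the value 2^k. -/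
lemma integral_layerFun_mul_bottomFun {m k : ℕ} (h : m ≤ k) :
    ∫ a, layerFun n 𝕜 k a * bottomFun n 𝕜 m a ∂(mu n) = 2 := by
  have hsub : boxes (layer n k) ⊆ boxes (bottom n m) := by
    refine biUnion_subset_biUnion_left fun Q hQ => ⟨?_, hQ.2⟩
    rw [hQ.1]
    lia
  have hup : boxes (layer n k) ⊆ upper n := iUnion₂_subset fun Q _ => box_subset_upper Q
  have e : ∀ a, layerFun n 𝕜 k a * bottomFun n 𝕜 m a = layerFun n 𝕜 k a := by
    intro a
    by_cases ha : a ∈ boxes (layer n k)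
    · rw [bottomFun, indicator_of_mem (hsub ha), mul_one]
    · rw [layerFun, indicator_of_notMem ha, zero_mul]
  simp only [e]
  rw [layerFun, integral_indicator (measurableSet_boxes _), setIntegral_const, measureReal_def, mu,
    Measure.restrict_apply (measurableSet_boxes _), inter_eq_left.2 hup, volume_boxes_layer,
    ENNReal.toReal_ofReal (by positivity), RCLike.real_smul_eq_coe_mul, ← RCLike.ofReal_mul,
    zpow_neg, zpow_natCast, mul_assoc, inv_mul_cancel₀ (by positivity), mul_one, RCLike.ofReal_ofNat]

/-- Each point lies in a single box, which leaves the bottom set as soon as m exceeds minus its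
generation. -/
lemma tendsto_bottomFun {a : Amb n} (ha : a ∈ upper n) :
    Tendsto (fun m => bottomFun n 𝕜 m a) atTop (𝓝 0) := by
  obtain ⟨Q, hQ⟩ := exists_mem_box ha
  refine tendsto_const_nhds.congr' ?_
  filter_upwards [eventually_gt_atTop (-Q.1).toNat] with m hm
  rw [bottomFun, indicator_of_notMem]
  intro h
  have := ((mem_boxes_iff hQ).1 h).1
  lia

lemma not_surjective_ZSpace (hn : 1 ≤ n) {p q p' q' : ℝ} [hp : Fact (1 < p)] [hq : Fact (1 < q)]
    (hpp : p.HolderConjugate p') (hqq : q.HolderConjugate q') :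
    ¬ Function.Surjective (NormedSpace.inclusionInDoubleDual 𝕜 (ZSpace 𝕜 n p q)) := by
  have : Fact (1 < p') := ⟨hpp.symm.lt⟩
  have : Fact (1 < q') := ⟨hqq.symm.lt⟩
  -- Any aperture serves here, since Z does not depend on it.
  have : Fact ((0 : ℝ) < 1) := ⟨one_pos⟩
  obtain ⟨C, hC, H⟩ := exists_carlesonNorm_le_zNorm (𝕜 := 𝕜) n hp.out hq.out
  obtain ⟨φ, hφ⟩ := exists_pairing (𝕜 := 𝕜) (α := 1) hn hpp hqq
  have hz : ∀ k, zNorm p q (layerFun n 𝕜 k) ≠ ∞ := fun k =>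
    ne_top_of_le_ne_top ENNReal.one_ne_top (zNorm_layerFun_le hp.out hq.out k)
  have hx : ∀ m, xNorm p' q' (bottomFun n 𝕜 m) ≠ ∞ := fun m =>
    ne_top_of_le_ne_top ENNReal.one_ne_top (xNorm_bottomFun_le hpp.symm.lt hqq.symm.lt m)
  have hlm := fun k => (measurable_layerFun (n := n) (𝕜 := 𝕜) k).aestronglyMeasurable (μ := mu n)
  have hbm := fun m => (measurable_bottomFun (n := n) (𝕜 := 𝕜) m).aestronglyMeasurable (μ := mu n)
  set e : ℕ → ZSpace 𝕜 n p q := fun k => ZSpace.mk _ (hlm k) (hz k) with he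
  set g : ℕ → XSpace 𝕜 n 1 p' q' := fun m => XSpace.mk _ (hbm m) (hx m) with hg
  have hφg : ∀ m f, φ (g m) f = ∫ a, f.1 a * bottomFun n 𝕜 m a ∂(mu n) := by
    intro m f
    rw [hφ]
    refine integral_congr_ae ?_
    filter_upwards [XSpace.coe_mk (α := 1) (hbm m) (hx m)] with a ha
    rw [hg, ha]
  refine not_surjective_inclusionInDoubleDual (e := e) (R := C.toReal) (fun k => ?_)
    (Ψ := fun m => φ (g m)) (c := 2) two_ne_zero (fun m k hmk => ?_) fun f => ?_
  · rw [ZSpace.norm_def, carlesonNorm_congr p q (ZSpace.coe_mk (hlm k) (hz k))]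
    refine ENNReal.toReal_mono hC ((H _).trans ?_)
    calc C * zNorm p q (layerFun n 𝕜 k) ≤ C * 1 :=
          mul_le_mul_right (zNorm_layerFun_le hp.out hq.out k) _
      _ = C := mul_one C
  · show φ (g m) (e k) = 2
    rw [hφg, ← integral_layerFun_mul_bottomFun (n := n) (𝕜 := 𝕜) hmk]
    refine integral_congr_ae ?_
    filter_upwards [ZSpace.coe_mk (hlm k) (hz k)] with a ha
    rw [he, ha]
  · simp only [hφg]
    -- The pairings with a fixed f tend to zero by dominated convergence, with majorant |f g_0|.
    have hint := integrable_mul_of_norms hpp hqq f.1.aestronglyMeasurable (hbm 0)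
      (zNorm_ne_top hn f) (hx 0)
    rw [← integral_zero (Amb n) 𝕜 (μ := mu n)]
    refine tendsto_integral_of_dominated_convergence (fun a => ‖f.1 a * bottomFun n 𝕜 0 a‖)
      (fun m => f.1.aestronglyMeasurable.mul (hbm m)) hint.norm
      (fun m => ae_of_all _ fun a => ?_) ?_
    · rw [norm_mul, norm_mul]
      refine mul_le_mul_of_nonneg_left ?_ (norm_nonneg _)
      have hsub : boxes (bottom n m) ⊆ boxes (bottom n 0) :=
        biUnion_subset_biUnion_left fun Q hQ => ⟨hQ.1.trans (by simp), hQ.2⟩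
      by_cases ha : a ∈ boxes (bottom n m)
      · rw [bottomFun, bottomFun, indicator_of_mem ha, indicator_of_mem (hsub ha)]
      · rw [bottomFun, indicator_of_notMem ha, norm_zero]
        exact norm_nonneg _
    · filter_upwards [self_mem_ae_restrict (isOpen_upper n).measurableSet] with a ha
      have := (tendsto_bottomFun (𝕜 := 𝕜) ha).const_mul (f.1 a)
      rwa [mul_zero] at this

end

end HalfSpace

/-! ### The main theorem -/

open HalfSpace in
theorem lemma5p2 {𝕜 : Type*} [RCLike 𝕜] (n : ℕ) (hn : 1 ≤ n) (α : ℝ) [Fact (0 < α)]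
    (p q p' q' : ℝ) [Fact (1 < p)] [Fact (1 < q)] [Fact (1 < p')] [Fact (1 < q')]
    (hp : p.HolderConjugate p') (hq : q.HolderConjugate q') :
    -- `Z` and `X` are Banach spaces
    CompleteSpace (ZSpace 𝕜 n p q) ∧
    CompleteSpace (XSpace 𝕜 n α p' q') ∧
    -- density of `Z₀` in `Z` and of `X₀` in `X`
    Dense (ZZero 𝕜 n p q) ∧
    Dense (XZero 𝕜 n α p' q') ∧
    -- `Z` is not reflexive
    ¬ Function.Surjective (NormedSpace.inclusionInDoubleDual 𝕜 (ZSpace 𝕜 n p q)) ∧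
    -- `X = Z*` with equivalent norms, through the pairing `∫ f g`
    ∃ Φ : XSpace 𝕜 n α p' q' ≃L[𝕜] StrongDual 𝕜 (ZSpace 𝕜 n p q),
      ∀ (g : XSpace 𝕜 n α p' q') (f : ZSpace 𝕜 n p q),
        Integrable (fun a => f.1 a * g.1 a) (mu n) ∧
        Φ g f = ∫ a, f.1 a * g.1 a ∂(mu n) := by
  obtain ⟨Φ, hΦ⟩ := exists_dual_equiv (𝕜 := 𝕜) (α := α) hn hp hq
  exact ⟨completeSpace_ZSpace hn p q,
    -- X inherits completeness from the dual of Z through the isomorphism.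
    (completeSpace_congr (e := Φ.toEquiv) Φ.isUniformEmbedding).2 inferInstance,
    dense_ZZero hn p q, dense_XZero hn α p' q', not_surjective_ZSpace hn hp hq,
    Φ, fun g f => ⟨integrable_pairing hn hp hq g f, hΦ g f⟩⟩
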